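/- Let $k=\mathbb{F}_q$ be a finite field of characteristic $p$ with algebraic closure $\bar k$. Let $r>1$ and $d\ge 1$ be integers prime to $p$, and let $h\in k[x]$ be a polynomial of positive degree with $h(0)\neq 0$ which is not the $e$-th power of an element of $k(t)$ for any divisor $e>1$ of $r$. Let $\mathcal{C}$ be the smooth projective curve over $k$ associated to $w^r=h(z^d)$ (that is, $\mathcal{C}$ is smooth and projective over $k$ and is equipped with a birational map over $k$ to this affine curve). Let $X$ be the smooth projective curve over $k(t)$ associated to $y^r=h(x)\,h(t^d/x)$, and let $\mathcal{X}$ be an irreducible smooth projective surface over $k$ equipped with a $k$-morphism $\mathcal{X}\to\mathbb{P}^1_t$ whose generic fibre is isomorphic to $X$. The group $G=\mu_r(\bar k)\times\mu_d(\bar k)$ acts on $\mathcal{C}$ over $\bar k$ by $(\zeta,\xi)\cdot(z,w)=(\xi z,\zeta w)$, and it acts on $\mathcal{C}\times\mathcal{C}$ over $\bar k$ anti-diagonally, by $g(P_1,P_2)=(gP_1,g^{-1}P_2)$. Let $(\mathcal{C}\times\mathcal{C})/G$ be the quotient, as a scheme over $k$: it is equipped with a $k$-morphism $\pi:\mathcal{C}\times_k\mathcal{C}\to(\mathcal{C}\times\mathcal{C})/G$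 whose base change to $\bar k$ is the quotient of $(\mathcal{C}\times\mathcal{C})_{\bar k}$ by $G$ (an affine $G$-invariant morphism such that the functions on each open set of the target are exactly the $G$-invariant functions on its preimage). Then $\mathcal{X}$ is birational over $k$ to $(\mathcal{C}\times\mathcal{C})/G$. More precisely, the coordinates $x,y$ of $X$ together with $t$ define a birational map over $k$ from $\mathcal{X}$ to the affine surface $y^r=h(x)\,h(t^d/x)$, $x\neq0$, in $(x,y,t)$-space, and there is a birational map over $k$ from $(\mathcal{C}\times\mathcal{C})/G$ to $\mathcal{X}$ whose composite with $\pi$ is the rational map from $\mathcal{C}\times\mathcal{C}$ to $\mathcal{X}$ given by $$x=z_1^d,\qquad y=w_1w_2,\qquad t=z_1z_2,$$ where $(z_i,w_i)$ are the coordinates on the $i$-th factor. -/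

import Mathlib

open CategoryTheory Limits AlgebraicGeometry

universe u

noncomputable section

namespace UlmerVoloch

attribute [local instance] MvPolynomial.gradedAlgebra

/-! ### Projective space, smooth projective varieties -/

/-- Projective `n`-space over a field, as the `Proj` of the graded polynomial ring. -/
abbrev ProjSpace (n : ℕ) (F : Type u) [Field F] : Scheme.{u} :=
  Proj (MvPolynomial.homogeneousSubmodule (Fin (n + 1)) F)

/-- The structure morphism of projective space. -/
def ProjSpace.str (n : ℕ) (F : Type u) [Field F] : ProjSpace n F ⟶ Spec (.of F) :=
  Proj.toSpecZero (MvPolynomial.homogeneousSubmodule (Fin (n + 1)) F) ≫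
    Spec.map (CommRingCat.ofHom
      (algebraMap F (MvPolynomial.homogeneousSubmodule (Fin (n + 1)) F 0)))

/-- A scheme over a field which is smooth, of pure dimension `n`, and projective, i.e. isomorphic
over the field to a closed subscheme of some projective space. -/
structure IsSmoothProjective (n : ℕ) {F : Type u} [Field F] {X : Scheme.{u}}
    (s : X ⟶ Spec (.of F)) : Prop where
  smooth : SmoothOfRelativeDimension n s
  projective : ∃ (N : ℕ) (i : X ⟶ ProjSpace N F), IsClosedImmersion i ∧ i ≫ ProjSpace.str N F = s

/-- The coordinate ring `F[X₀/X₁]` of the chart `X₁ ≠ 0` of the projective line. -/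
abbrev ChartRing (F : Type u) [Field F] : Type u :=
  HomogeneousLocalization.Away (MvPolynomial.homogeneousSubmodule (Fin (1 + 1)) F) (MvPolynomial.X 1)

/-- The inclusion of `F[X₀/X₁]` in `F(t)` sending `X₀/X₁` to `t`. -/
def chartToRatFunc (F : Type u) [Field F] : ChartRing F →+* RatFunc F :=
  (IsLocalization.Away.lift (S := Localization.Away (MvPolynomial.X 1 : MvPolynomial (Fin (1 + 1)) F))
    (MvPolynomial.X 1)
    (g := (MvPolynomial.aeval (R := F) ![(RatFunc.X : RatFunc F), 1]).toRingHom)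
    (by simp)).comp
  (algebraMap (ChartRing F) (Localization.Away (MvPolynomial.X 1 : MvPolynomial (Fin (1 + 1)) F)))

/-- The generic point `Spec F(t) ⟶ ℙ¹` of the projective line with coordinate `t = X₀/X₁`. -/
def genericPointP1 (F : Type u) [Field F] : Spec (.of (RatFunc F)) ⟶ ProjSpace 1 F :=
  Spec.map (CommRingCat.ofHom (chartToRatFunc F)) ≫
    Proj.awayι (MvPolynomial.homogeneousSubmodule (Fin (1 + 1)) F) (MvPolynomial.X 1)
      (m := 1) ((MvPolynomial.mem_homogeneousSubmodule _ _).mpr (MvPolynomial.isHomogeneous_X F 1)) one_pos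

/-! ### The affine equations -/

section Affine

variable {k : Type u} [Field k] (h : Polynomial k) (r : ℕ)

/-- The ring `k[z, w] / (w ^ r - h(z ^ d))`, with `z`, `w` the variables `0`, `1`. -/
abbrev CurveRing (d : ℕ) : Type u :=
  MvPolynomial (Fin 2) k ⧸ Ideal.span
    {(MvPolynomial.X 1 ^ r - Polynomial.aeval (MvPolynomial.X 0 ^ d) h : MvPolynomial (Fin 2) k)}

def CurveRing.z (d : ℕ) : CurveRing h r d := Ideal.Quotient.mk _ (MvPolynomial.X 0)

def CurveRing.w (d : ℕ) : CurveRing h r d := Ideal.Quotient.mk _ (MvPolynomial.X 1)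

/-- For a `k`-algebra `A` and `a : A`, the ring `A[x, x⁻¹, y] / (y ^ r - h(x) h(a / x))`, with
`x`, `y`, `x⁻¹` the variables `0`, `1`, `2`. -/
abbrev FamilyRing (A : Type u) [CommRing A] [Algebra k A] (a : A) : Type u :=
  MvPolynomial (Fin 3) A ⧸ Ideal.span
    {(MvPolynomial.X 0 * MvPolynomial.X 2 - 1 : MvPolynomial (Fin 3) A),
     MvPolynomial.X 1 ^ r - Polynomial.aeval (MvPolynomial.X 0 : MvPolynomial (Fin 3) A) h *
       Polynomial.aeval (MvPolynomial.C a * MvPolynomial.X 2 : MvPolynomial (Fin 3) A) h}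

variable (A : Type u) [CommRing A] [Algebra k A] (a : A)

def FamilyRing.x : FamilyRing h r A a := Ideal.Quotient.mk _ (MvPolynomial.X 0)

def FamilyRing.y : FamilyRing h r A a := Ideal.Quotient.mk _ (MvPolynomial.X 1)

/-- The coordinate ring over `k(t)` of the affine curve `y ^ r = h(x) h(t ^ d / x)`, `x ≠ 0`. -/
abbrev GenericRing (d : ℕ) : Type u := FamilyRing h r (RatFunc k) (RatFunc.X ^ d)

/-- The coordinate ring over `k` of the affine surface `y ^ r = h(x) h(t ^ d / x)`, `x ≠ 0`, in the
coordinates `x`, `y`, `t`. -/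
abbrev SurfaceRing (d : ℕ) : Type u := FamilyRing h r (Polynomial k) (Polynomial.X ^ d)

/-- The coordinate `t` of the affine surface. -/
def SurfaceRing.t (d : ℕ) : SurfaceRing h r d := algebraMap (Polynomial k) _ Polynomial.X

end Affine

/-- The structure morphism `Spec A ⟶ Spec R` of an `R`-algebra `A`. -/
abbrev specStr (R A : Type u) [CommRing R] [CommRing A] [Algebra R A] :
    Spec (.of A) ⟶ Spec (.of R) :=
  Spec.map (CommRingCat.ofHom (algebraMap R A))

/-! ### Coordinate functions -/

/-- The regular function on `X` induced by `a : A` along a morphism `X ⟶ Spec A`, restricted to the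
open set `W`. -/
def pullFun {X : Scheme.{u}} {A : Type u} [CommRing A] (f : X ⟶ Spec (.of A)) (a : A)
    (W : X.Opens) : Γ(X, W) :=
  (f.appLE ⊤ W le_top).hom ((Scheme.ΓSpecIso (.of A)).inv.hom a)

/-- The rational function on `X` (regular on the source of `j`) which is induced by `a : A` along a
birational map `j` from `X` to `Spec A`. -/
def coord {X : Scheme.{u}} {A : Type u} [CommRing A] (j : X.PartialIso (Spec (.of A))) (a : A) :
    Γ(X, j.source) :=
  j.source.topIso.hom.hom (pullFun (j.iso.hom ≫ j.target.ι) a ⊤)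

/-! ### Quotients by finite groups -/

/-- `π : Y ⟶ Q` is the quotient of the scheme `Y` by the action `σ` of the finite group `G`:
`π` is an affine invariant morphism and the functions on an open `U` of `Q` are exactly
the invariant functions on its preimage. -/
structure IsQuotient {G : Type*} {Y Q : Scheme.{u}} (σ : G → (Y ⟶ Y)) (π : Y ⟶ Q) : Prop where
  affine : IsAffineHom π
  invariant : ∀ g, σ g ≫ π = π
  injective : ∀ U : Q.Opens, Function.Injective (π.app U).hom
  surjective : ∀ (U : Q.Opens) (s : Γ(Y, π ⁻¹ᵁ U)),
    (∀ g, ∃ hU : π ⁻¹ᵁ U ≤ σ g ⁻¹ᵁ (π ⁻¹ᵁ U),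
      ((σ g).appLE (π ⁻¹ᵁ U) (π ⁻¹ᵁ U) hU).hom s = s) →
    s ∈ Set.range (π.app U).hom

/-! ### The action of `μ_r × μ_d` -/

section Action

variable {k : Type u} [Field k]

/-- The structure morphism `Spec k̄ ⟶ Spec k`. -/
abbrev closureStr (k : Type u) [Field k] : Spec (.of (AlgebraicClosure k)) ⟶ Spec (.of k) :=
  specStr k (AlgebraicClosure k)

/-- The group `μ_r × μ_d` over `k̄`. -/
abbrev MuGroup (k : Type u) [Field k] (r d : ℕ) : Type u :=
  rootsOfUnity r (AlgebraicClosure k) × rootsOfUnity d (AlgebraicClosure k)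

/-- The base change of `X` to `k̄`, as a scheme over `k̄`. -/
abbrev geom {X : Scheme.{u}} (s : X ⟶ Spec (.of k)) : Over (Spec (.of (AlgebraicClosure k))) :=
  Over.mk (pullback.snd s (closureStr k))

variable {C : Scheme.{u}} (sC : C ⟶ Spec (.of k))

/-- `ρ` is the action of `μ_r × μ_d` on `C` over `k̄` by `(ζ, ξ) · (z, w) = (ξ z, ζ w)`,
where `C` is equipped with a birational map `j` to the affine curve `w ^ r = h(z ^ d)`. -/
def IsMuAction {h : Polynomial k} {r d : ℕ} (j : C.PartialIso (Spec (.of (CurveRing h r d))))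
    (ρ : MuGroup k r d →* Aut (geom sC)) : Prop :=
  ∀ g : MuGroup k r d,
    ∃ (W : (geom sC).left.Opens) (_ : Dense (W : Set (geom sC).left))
      (h₁ : W ≤ pullback.fst sC (closureStr k) ⁻¹ᵁ j.source)
      (h₂ : W ≤ ((ρ g).hom.left ≫ pullback.fst sC (closureStr k)) ⁻¹ᵁ j.source),
      (((ρ g).hom.left ≫ pullback.fst sC (closureStr k)).appLE j.source W h₂).hom
          (coord j (CurveRing.z h r d)) =
        pullFun (pullback.snd sC (closureStr k)) ((g.2 : (AlgebraicClosure k)ˣ) : AlgebraicClosure k) W *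
          ((pullback.fst sC (closureStr k)).appLE j.source W h₁).hom
            (coord j (CurveRing.z h r d)) ∧
      (((ρ g).hom.left ≫ pullback.fst sC (closureStr k)).appLE j.source W h₂).hom
          (coord j (CurveRing.w h r d)) =
        pullFun (pullback.snd sC (closureStr k)) ((g.1 : (AlgebraicClosure k)ˣ) : AlgebraicClosure k) W *
          ((pullback.fst sC (closureStr k)).appLE j.source W h₁).hom
            (coord j (CurveRing.w h r d))

/-- The self-product `C_k̄ × C_k̄` over `k̄`. -/
abbrev geomSq : Scheme.{u} := pullback (geom sC).hom (geom sC).hom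

/-- The action `g (P₁, P₂) = (g P₁, g⁻¹ P₂)` on `C_k̄ × C_k̄`. -/
def antiDiag {G : Type*} [Group G] (ρ : G →* Aut (geom sC)) (g : G) : geomSq sC ⟶ geomSq sC :=
  pullback.map _ _ _ _ (ρ g).hom.left (ρ g⁻¹).hom.left (𝟙 _)
    (by rw [Category.comp_id]; exact (Over.w _).symm)
    (by rw [Category.comp_id]; exact (Over.w _).symm)

/-- The structure morphism of `C × C` over `k`. -/
abbrev sqStr : pullback sC sC ⟶ Spec (.of k) := pullback.fst sC sC ≫ sC

/-- The projection `C_k̄ × C_k̄ ⟶ C × C`. -/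
def geomSqProj : geomSq sC ⟶ pullback sC sC :=
  pullback.map _ _ _ _ (pullback.fst sC (closureStr k)) (pullback.fst sC (closureStr k))
    (closureStr k) pullback.condition.symm pullback.condition.symm

/-- The base change `C_k̄ × C_k̄ ⟶ Q_k̄` of a morphism `C × C ⟶ Q` over `k`. -/
def geomSqMap {Q : Scheme.{u}} (sQ : Q ⟶ Spec (.of k)) (π : pullback sC sC ⟶ Q)
    (hπ : π ≫ sQ = sqStr sC) : geomSq sC ⟶ (geom sQ).left :=
  pullback.lift (geomSqProj sC ≫ π) (pullback.fst _ _ ≫ (geom sC).hom) (by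
    rw [Category.assoc, hπ, sqStr, geomSqProj, pullback.lift_fst_assoc, Category.assoc,
      Category.assoc, pullback.condition]
    rfl)

/-- `π : C × C ⟶ Q` is, as a morphism of schemes over `k`, the quotient of `C × C` by the
anti-diagonal action of a group `G` which acts on `C` over `k̄`: its base change to `k̄` is
the quotient of `C_k̄ × C_k̄` by `G`. -/
structure IsAntiDiagQuotient {G : Type*} [Group G] (ρ : G →* Aut (geom sC)) {Q : Scheme.{u}}
    (sQ : Q ⟶ Spec (.of k)) (π : pullback sC sC ⟶ Q) : Prop where
  isOver : π ≫ sQ = sqStr sC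
  quotient : IsQuotient (antiDiag sC ρ) (geomSqMap sC sQ π isOver)

end Action

end UlmerVoloch

end

/-! Let `R` be the coordinate ring of the affine surface `y ^ r = h(x) h(t ^ d / x)`, `x ≠ 0`. Each
of the two surfaces is shown to be birational to `Spec R`, and the map from the quotient to the
fibred surface is the composite of one of these maps with the inverse of the other.

For the fibred surface, the generic point of `S` lies on the generic fibre `X`, so `S` and `X` have
the same function field. Since `X` is birational to the affine curve over `k(t)`, this field is the
fraction field of the generic ring, hence of `R`, which differs only by inverting polynomials in
`t`. Two finitely generated domains with the same fraction field agree after one element of each is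
inverted (`exists_awaySubalgebra_eq`), which gives the birational map
(`exists_partialIso_surfaceRing`). Along the way `R` embeds in the functions on an integral scheme,
so it is a domain.

For the quotient, choose an affine chart `a(z ^ d) ≠ 0` of `C` with `h ∣ a` and `X ∣ a`. It is
stable under the group, and `z`, `w` are units on it. On its square, `x = z₁ ^ d`, `y = w₁ w₂`, `t =
z₁ z₂` are invariant and satisfy the equation of the surface, while `z₂ = t x⁻¹ z₁ ^ (d - 1)` and
`h(x) w₂ = y w₁ ^ (r - 1)`. So, up to a unit coming from `R`, every function is an `R`-combination
of the monomials `z₁ ^ i w₁ ^ j` with `i < d`, `j < r` (`IsProductHom.exists_mul_eq_sum`). The group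
acts on these monomials through distinct characters. As `r` and `d` are invertible in `k`, averaging
isolates each coefficient (`sum_twist_eq`), so an invariant function has only its `(0, 0)` term and
lies in a localization of `R` (`IsTwistedChart.exists_isAwayHom`). Conversely `R` embeds, and its
nonzero elements remain nonzerodivisors, because `z₁ ^ d` and `z₁ z₂` are algebraically independent
and `R` is algebraic over `k[x, t]`.

Three transfers make this work for schemes. The action is prescribed only on a dense open set, and
extends to the chart because `C` is separated and its base change is reduced. The quotient property
is given over `k̄`, and functions are brought down to `k` by a linear retraction `k̄ → k`
(`exists_descent`). Open sets of the quotient whose preimage lies in the chart exist because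
functions upstairs are integral over functions on the quotient. -/

section Algebra

/-! ### Reducedness, prime avoidance and integrality in commutative rings -/

open TensorProduct Polynomial

/-- A smooth algebra over a field is reduced. -/
theorem Algebra.Smooth.isReduced_of_field (K S : Type*) [Field K] [CommRing S] [Algebra K S]
    [Algebra.Smooth K S] : IsReduced S := by
  let B := FractionRing K[X]
  have hinj : Function.Injective (algebraMap K[X] B) := IsFractionRing.injective _ _
  have hX : algebraMap K[X] B X ≠ 0 := by
    rw [Ne, map_eq_zero_iff _ hinj]; exact X_ne_zero
  refine ⟨fun n hn => ?_⟩
  -- Integral closure commutes with smooth base change. As `K[X]` is integrally closed in its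
  -- fraction field, every element of `(K[X] ⊗ S) ⊗ K(X)` integral over `K[X] ⊗ S` comes from `K[X]
  -- ⊗ S`.
  have hbij := TensorProduct.toIntegralClosure_bijective_of_smooth
    (R := K[X]) (S := K[X] ⊗[K] S) (B := B)
  let v : K[X] ⊗[K] S := 1 ⊗ₜ n
  have hv : IsNilpotent v := hn.map (Algebra.TensorProduct.includeRight : S →ₐ[K] K[X] ⊗[K] S)
  -- The nilpotent element divided by `X` is still nilpotent, hence integral. So `1 ⊗ n` is a
  -- multiple of `X` in `K[X] ⊗ S`, and evaluating at `X = 0` gives `n = 0`.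
  let w : (K[X] ⊗[K] S) ⊗[K[X]] B := v ⊗ₜ (algebraMap K[X] B X)⁻¹
  have hwi : IsIntegral (K[X] ⊗[K] S) w := by
    obtain ⟨m, hm⟩ := hv
    refine ⟨X ^ m, monic_X_pow m, ?_⟩
    rw [eval₂_X_pow, Algebra.TensorProduct.tmul_pow, hm, TensorProduct.zero_tmul]
  obtain ⟨s, hs⟩ := hbij.2 ⟨w, hwi⟩
  have key : ∀ s : (K[X] ⊗[K] S) ⊗[K[X]] integralClosure K[X] B, ∃ a : K[X] ⊗[K] S,
      ((TensorProduct.toIntegralClosure K[X] (K[X] ⊗[K] S) B s :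
        integralClosure (K[X] ⊗[K] S) ((K[X] ⊗[K] S) ⊗[K[X]] B)) :
        (K[X] ⊗[K] S) ⊗[K[X]] B) = a ⊗ₜ 1 := by
    intro s
    induction s with
    | zero => exact ⟨0, by simp⟩
    | add x y hx hy =>
      obtain ⟨a, ha⟩ := hx
      obtain ⟨b, hb⟩ := hy
      exact ⟨a + b, by rw [map_add, TensorProduct.add_tmul]; simp [ha, hb]⟩
    | tmul x y =>
      obtain ⟨r, hr⟩ := IsIntegrallyClosed.algebraMap_eq_of_integral y.2
      refine ⟨r • x, ?_⟩
      rw [TensorProduct.smul_tmul, ← Algebra.algebraMap_eq_smul_one, hr]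
      rfl
  obtain ⟨a, ha⟩ := key s
  rw [hs] at ha
  have h1 : v ⊗ₜ[K[X]] (1 : B) = (((X : K[X]) • a) ⊗ₜ[K[X]] (1 : B)) := by
    have h2 := congrArg (fun z => (X : K[X]) • z) ha
    simp only [w] at h2
    rw [← TensorProduct.tmul_smul, TensorProduct.smul_tmul', Algebra.smul_def,
      mul_inv_cancel₀ hX] at h2
    exact h2
  have hT : Function.Injective (fun z : K[X] ⊗[K] S => z ⊗ₜ[K[X]] (1 : B)) :=
    Algebra.TensorProduct.includeLeft_injective (S := K[X]) (A := K[X] ⊗[K] S) (B := B) hinj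
  have h3 : v = (X : K[X]) • a := hT h1
  let ev : K[X] ⊗[K] S →ₐ[K] S :=
    Algebra.TensorProduct.lift ((Algebra.ofId K S).comp (aeval (0 : K))) (AlgHom.id K S)
      (fun _ _ => .all _ _)
  have hev : ∀ b, ev ((X : K[X]) • b) = 0 := by
    intro b
    induction b with
    | zero => simp
    | add x y hx hy => rw [smul_add, map_add, hx, hy, add_zero]
    | tmul x y =>
      rw [TensorProduct.smul_tmul', smul_eq_mul]
      simp [ev]
  have h4 := congrArg ev h3
  rw [hev] at h4
  simpa [ev, v] using h4

/-- In a reduced Noetherian ring, a dense open subset of the spectrum contains the basic open set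
of a nonzerodivisor. -/
theorem PrimeSpectrum.exists_basicOpen_le_of_dense {B : Type*} [CommRing B] [IsNoetherianRing B]
    [IsReduced B] (O : TopologicalSpace.Opens (PrimeSpectrum B))
    (hO : Dense (O : Set (PrimeSpectrum B))) :
    ∃ b ∈ nonZeroDivisors B, PrimeSpectrum.basicOpen b ≤ O := by
  obtain ⟨I, hI⟩ := (PrimeSpectrum.isClosed_iff_zeroLocus_ideal _).mp O.isOpen.isClosed_compl
  have hmem : ∀ P : PrimeSpectrum B, P ∈ O ↔ ¬ I ≤ P.asIdeal := by
    intro P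
    have : P ∈ (O : Set (PrimeSpectrum B))ᶜ ↔ P ∈ PrimeSpectrum.zeroLocus (I : Set B) := by rw [hI]
    rw [Set.mem_compl_iff, PrimeSpectrum.mem_zeroLocus] at this
    exact (not_iff_comm.mp this).symm.trans Iff.rfl
  have hfin := minimalPrimes.finite_of_isNoetherianRing B
  -- The point `p` has an open neighbourhood meeting no other irreducible component. Density puts a
  -- point of `O` in it, and the only minimal prime below that point is `p`.
  have hmin : ∀ p ∈ minimalPrimes B, ¬ I ≤ p := by
    intro p hp hIp
    have hpp : p.IsPrime := hp.1.1
    let U : Set (PrimeSpectrum B) :=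
      (⋃ q ∈ minimalPrimes B \ {p}, PrimeSpectrum.zeroLocus (q : Set B))ᶜ
    have hU : IsOpen U :=
      ((hfin.subset Set.sdiff_subset).isClosed_biUnion
        fun q _ => PrimeSpectrum.isClosed_zeroLocus _).isOpen_compl
    have hpU : (⟨p, hpp⟩ : PrimeSpectrum B) ∈ U := by
      simp only [U, Set.mem_compl_iff, Set.mem_iUnion, not_exists, PrimeSpectrum.mem_zeroLocus]
      rintro q ⟨hq, hqp⟩ hle
      exact hqp (le_antisymm hle (hp.2 ⟨hq.1.1, bot_le⟩ hle))
    obtain ⟨P, hPU, hPO⟩ := hO.inter_open_nonempty U hU ⟨_, hpU⟩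
    obtain ⟨q, hq, hqP⟩ := Ideal.exists_minimalPrimes_le (bot_le : (⊥ : Ideal B) ≤ P.asIdeal)
    by_cases hqp : q = p
    · exact (hmem P).mp hPO (hIp.trans (hqp ▸ hqP))
    · exact hPU (Set.mem_biUnion (⟨hq, hqp⟩ : q ∈ minimalPrimes B \ {p}) hqP)
  -- Prime avoidance over the finitely many minimal primes; in a reduced ring an element outside all
  -- of them is a nonzerodivisor.
  obtain ⟨b, hbI, hb⟩ : ∃ b ∈ I, ∀ p ∈ minimalPrimes B, b ∉ p := by
    by_contra! H
    have : (I : Set B) ⊆ ⋃ p ∈ minimalPrimes B, ((id p : Ideal B) : Set B) := fun b hb => by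
      obtain ⟨p, hp, hbp⟩ := H b hb
      exact Set.mem_biUnion hp hbp
    obtain ⟨p, hp, hIp⟩ := (Ideal.subset_union_prime_finite hfin ⊥ ⊥
      fun p hp _ _ => hp.1.1).mp this
    exact hmin p hp hIp
  refine ⟨b, mem_nonZeroDivisors_iff_right.mpr fun y hy => ?_, fun P hP => (hmem P).mpr fun hIP =>
    (PrimeSpectrum.mem_basicOpen b P).mp hP (hIP hbI)⟩
  have : y ∈ sInf (minimalPrimes B) := by
    rw [Submodule.mem_sInf]
    intro p hp
    have hpp : Ideal.IsPrime p := hp.1.1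
    exact (hpp.mem_or_mem (hy ▸ p.zero_mem : y * b ∈ p)).resolve_right (hb p hp)
  have h2 : y ∈ (⊥ : Ideal B).radical := by rw [← Ideal.sInf_minimalPrimes]; exact this
  rwa [Ideal.radical_bot_of_isReduced] at h2

/-! ### Finitely generated algebras with a common fraction field -/

section CommonLocalization

variable {k A R L : Type*} [Field k] [CommRing A] [CommRing R] [Field L] [Algebra k A] [Algebra k R]
  [Algebra k L] [Algebra A L] [Algebra R L]

/-- The subalgebra `A[1 / u]` of a field containing `A`. -/
def awaySubalgebra (k : Type*) {A L : Type*} [Field k] [CommRing A] [Field L] [Algebra k A]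
    [Algebra k L] [Algebra A L] (u : A) : Subalgebra k L :=
  Algebra.adjoin k (Set.range (algebraMap A L) ∪ {(algebraMap A L u)⁻¹})

theorem algebraMap_mem_awaySubalgebra (u a : A) : algebraMap A L a ∈ awaySubalgebra k (L := L) u :=
  Algebra.subset_adjoin (Or.inl ⟨a, rfl⟩)

theorem inv_mem_awaySubalgebra (u : A) : (algebraMap A L u)⁻¹ ∈ awaySubalgebra k (L := L) u :=
  Algebra.subset_adjoin (Or.inr rfl)

theorem mem_awaySubalgebra_iff [IsScalarTower k A L] {u : A} (hu : algebraMap A L u ≠ 0) {x : L} :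
    x ∈ awaySubalgebra k u ↔ ∃ (a : A) (n : ℕ), x * algebraMap A L u ^ n = algebraMap A L a := by
  constructor
  · intro hx
    induction hx using Algebra.adjoin_induction with
    | mem x hx =>
      rcases hx with ⟨a, rfl⟩ | rfl
      · exact ⟨a, 0, by simp⟩
      · exact ⟨1, 1, by simp [hu]⟩
    | algebraMap r => exact ⟨algebraMap k A r, 0, by
        rw [pow_zero, mul_one, ← IsScalarTower.algebraMap_apply]⟩
    | add x y _ _ hx hy =>
      obtain ⟨a, n, ha⟩ := hx
      obtain ⟨b, m, hb⟩ := hy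
      refine ⟨a * u ^ m + b * u ^ n, n + m, ?_⟩
      simp only [map_add, map_mul, map_pow, ← ha, ← hb]; ring
    | mul x y _ _ hx hy =>
      obtain ⟨a, n, ha⟩ := hx
      obtain ⟨b, m, hb⟩ := hy
      refine ⟨a * b, n + m, ?_⟩
      simp only [map_mul, ← ha, ← hb]; ring
  · rintro ⟨a, n, h⟩
    have : x = algebraMap A L a * (algebraMap A L u)⁻¹ ^ n := by
      rw [← h, mul_assoc, ← mul_pow, mul_inv_cancel₀ hu, one_pow, mul_one]
    rw [this]
    exact mul_mem (algebraMap_mem_awaySubalgebra u a) (pow_mem (inv_mem_awaySubalgebra u) n)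

/-- Finitely many generators of `R` have a common denominator in `A`. -/
theorem exists_range_le_awaySubalgebra [IsScalarTower k A L]
    [IsScalarTower k R L] [Algebra.FiniteType k R] [IsFractionRing A L] :
    ∃ u : A, u ≠ 0 ∧ ∀ r : R, algebraMap R L r ∈ awaySubalgebra k (L := L) u := by
  classical
  have : IsDomain A := (IsFractionRing.injective A L).isDomain
  obtain ⟨s, hs⟩ := (‹Algebra.FiniteType k R› : Algebra.FiniteType k R).1
  obtain ⟨u, hu⟩ := IsLocalization.exist_integer_multiples_of_finset (nonZeroDivisors A)
    (s.image (algebraMap R L))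
  have hu0 : (u : A) ≠ 0 := nonZeroDivisors.ne_zero u.2
  refine ⟨u, hu0, fun r => ?_⟩
  have hr : r ∈ Algebra.adjoin k (s : Set R) := by rw [hs]; trivial
  induction hr using Algebra.adjoin_induction with
  | mem x hx =>
    obtain ⟨a, ha⟩ := hu _ (Finset.mem_image_of_mem _ hx)
    refine (mem_awaySubalgebra_iff ?_).mpr ⟨a, 1, ?_⟩
    · rwa [Ne, map_eq_zero_iff _ (IsFractionRing.injective A L)]
    · rw [ha, pow_one, Algebra.smul_def, mul_comm]
  | algebraMap r =>
    rw [← IsScalarTower.algebraMap_apply]; exact Subalgebra.algebraMap_mem _ _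
  | add x y _ _ hx hy => rw [map_add]; exact add_mem hx hy
  | mul x y _ _ hx hy => rw [map_mul]; exact mul_mem hx hy

/-- In `L` one has `u * a = m * u ^ (i + 1)` and `m * b = u * m ^ (j + 1)`, so inverting either
product makes both `u` and `m` units. Exchanging the two algebras gives the opposite inclusion. -/
theorem awaySubalgebra_le_of_mul_pow_eq {u a : A} {m b : R} {i j : ℕ}
    (hu : algebraMap A L u ≠ 0) (hm : algebraMap R L m ≠ 0)
    (hRA : ∀ r : R, algebraMap R L r ∈ awaySubalgebra k (L := L) u)
    (ha : algebraMap R L m * algebraMap A L u ^ i = algebraMap A L a)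
    (hb : algebraMap A L u * algebraMap R L m ^ j = algebraMap R L b) :
    awaySubalgebra k (L := L) (m * b) ≤ awaySubalgebra k (L := L) (u * a) := by
  have hu' : (algebraMap A L u)⁻¹ ∈ awaySubalgebra k (L := L) (u * a) := by
    have := mul_mem (inv_mem_awaySubalgebra (k := k) (L := L) (u * a))
      (algebraMap_mem_awaySubalgebra (k := k) (L := L) (u * a) a)
    rwa [map_mul, mul_inv, mul_assoc, inv_mul_cancel₀, mul_one] at this
    rw [← ha]; positivity
  have hle : awaySubalgebra k (L := L) u ≤ awaySubalgebra k (L := L) (u * a) := by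
    refine Algebra.adjoin_le ?_
    rintro _ (⟨x, rfl⟩ | rfl)
    · exact algebraMap_mem_awaySubalgebra _ _
    · exact hu'
  have hm' : (algebraMap R L m)⁻¹ ∈ awaySubalgebra k (L := L) (u * a) := by
    have := mul_mem (inv_mem_awaySubalgebra (k := k) (L := L) (u * a))
      (algebraMap_mem_awaySubalgebra (k := k) (L := L) (u * a) (u * u ^ i))
    convert this using 1
    rw [map_mul, map_mul, map_pow, ← ha]
    field_simp
  refine Algebra.adjoin_le ?_
  rintro _ (⟨x, rfl⟩ | rfl)
  · exact hle (hRA x)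
  · rw [map_mul, ← hb, mul_inv, mul_inv, ← inv_pow]
    exact mul_mem hm' (mul_mem hu' (pow_mem hm' j))

/-- Two finitely generated algebras with the same field of fractions become equal after inverting
one nonzero element in each. -/
theorem exists_awaySubalgebra_eq (k A R L : Type*) [Field k] [CommRing A] [CommRing R] [Field L]
    [Algebra k A] [Algebra k R]
    [Algebra k L] [Algebra A L] [Algebra R L] [IsScalarTower k A L] [IsScalarTower k R L]
    [Algebra.FiniteType k A] [Algebra.FiniteType k R]
    [IsFractionRing A L] [IsFractionRing R L] :
    ∃ (u : A) (m : R), u ≠ 0 ∧ m ≠ 0 ∧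
      awaySubalgebra k (L := L) u = awaySubalgebra k (L := L) m := by
  have : IsDomain A := (IsFractionRing.injective A L).isDomain
  have : IsDomain R := (IsFractionRing.injective R L).isDomain
  obtain ⟨u, hu, hRA⟩ := exists_range_le_awaySubalgebra (k := k) (A := A) (R := R) (L := L)
  obtain ⟨m, hm, hAR⟩ := exists_range_le_awaySubalgebra (k := k) (A := R) (R := A) (L := L)
  have hu' : algebraMap A L u ≠ 0 := by
    rwa [Ne, map_eq_zero_iff _ (IsFractionRing.injective A L)]
  have hm' : algebraMap R L m ≠ 0 := by
    rwa [Ne, map_eq_zero_iff _ (IsFractionRing.injective R L)]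
  obtain ⟨a, i, ha⟩ := (mem_awaySubalgebra_iff hu').mp (hRA m)
  obtain ⟨b, j, hb⟩ := (mem_awaySubalgebra_iff hm').mp (hAR u)
  refine ⟨u * a, m * b, mul_ne_zero hu ?_, mul_ne_zero hm ?_, le_antisymm ?_ ?_⟩
  · rintro rfl
    rw [map_zero] at ha
    exact mul_ne_zero hm' (pow_ne_zero _ hu') ha
  · rintro rfl
    rw [map_zero] at hb
    exact mul_ne_zero hu' (pow_ne_zero _ hm') hb
  · exact awaySubalgebra_le_of_mul_pow_eq hm' hu' hAR hb ha
  · exact awaySubalgebra_le_of_mul_pow_eq hu' hm' hRA ha hb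

end CommonLocalization

/-- A ring is integral over the invariants of a finite group. -/
theorem isIntegral_of_finite_group {G A B : Type*} [Group G] [Finite G] [CommRing A]
    [CommRing B] (f : A →+* B) (σ : G → (B →+* B)) (h1 : ∀ b, σ 1 b = b)
    (hmul : ∀ g g' b, σ g (σ g' b) = σ (g * g') b)
    (hinv : ∀ b, (∀ g, σ g b = b) → b ∈ f.range) : f.IsIntegral := by
  classical
  have := Fintype.ofFinite G
  intro b
  -- The orbit polynomial of `b`: it is monic, has the root `b`, and has invariant coefficients,
  -- which therefore lift along `f`.
  let P : B[X] := ∏ g, (X - C (σ g b))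
  have hP : P.Monic := monic_prod_of_monic _ _ fun g _ => monic_X_sub_C _
  have hPmap : ∀ g, P.map (σ g) = P := by
    intro g
    simp only [P, Polynomial.map_prod, Polynomial.map_sub, map_X, map_C, hmul]
    exact Fintype.prod_equiv (Equiv.mulLeft g) _ _ fun _ => rfl
  have hlift : P ∈ Polynomial.lifts f := by
    rw [Polynomial.lifts_iff_coeff_lifts]
    intro n
    refine hinv _ fun g => ?_
    rw [← Polynomial.coeff_map, hPmap]
  obtain ⟨q, hq, -, hqm⟩ := Polynomial.lifts_and_natDegree_eq_and_monic hlift hP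
  refine ⟨q, hqm, ?_⟩
  rw [← Polynomial.eval_map, hq, Polynomial.eval_prod]
  exact Finset.prod_eq_zero (Finset.mem_univ 1) (by simp [h1])

end Algebra

noncomputable section

namespace UlmerVoloch

/-! ### The affine rings -/

section Rings

open Polynomial

/-- Divisibility by a monic polynomial can be tested after an injective extension of the
coefficients. -/
theorem adjoinRoot_map_injective {B L : Type*} [CommRing B] [CommRing L] (i : B →+* L)
    (hi : Function.Injective i) (p : B[X]) (hp : p.Monic) :
    Function.Injective (AdjoinRoot.map i p (p.map i) dvd_rfl) := by
  rw [injective_iff_map_eq_zero]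
  intro a ha
  obtain ⟨q, rfl⟩ := AdjoinRoot.mk_surjective a
  rw [AdjoinRoot.map, AdjoinRoot.lift_mk, ← eval₂_map, ← AdjoinRoot.algebraMap_eq,
    ← aeval_def, AdjoinRoot.aeval_eq, AdjoinRoot.mk_eq_zero] at ha
  exact AdjoinRoot.mk_eq_zero.mpr ((map_dvd_map i hi hp).mp ha)

/-- Since `r` and `F` are nonzero in `L`, the polynomial `X ^ r - F` is separable, hence squarefree,
and generates a radical ideal. -/
theorem isReduced_adjoinRoot_X_pow_sub_C {L : Type*} [Field L] {r : ℕ} (hr : (r : L) ≠ 0) {F : L}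
    (hF : F ≠ 0) : IsReduced (AdjoinRoot (X ^ r - C F)) := by
  have hsep := separable_X_pow_sub_C F hr hF
  have hr0 : 0 < r := Nat.pos_of_ne_zero (by rintro rfl; simp at hr)
  have h1 : IsRadical (X ^ r - C F) :=
    (isRadical_iff_squarefree_of_ne_zero (X_pow_sub_C_ne_zero hr0 F)).mpr hsep.squarefree
  exact (Ideal.isRadical_iff_quotient_reduced _).mp (isRadical_iff_span_singleton.mp h1)

variable {k : Type u} [Field k] {h : Polynomial k} {r : ℕ}

namespace CurveRing

variable {d : ℕ}

theorem w_pow : (w h r d) ^ r = aeval (z h r d ^ d) h := by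
  have : (Ideal.Quotient.mk (Ideal.span
    {(MvPolynomial.X 1 ^ r - aeval (MvPolynomial.X 0 ^ d) h : MvPolynomial (Fin 2) k)}))
      (MvPolynomial.X 1 ^ r - aeval (MvPolynomial.X 0 ^ d) h) = 0 :=
    Ideal.Quotient.eq_zero_iff_mem.mpr (Ideal.subset_span rfl)
  rw [map_sub, sub_eq_zero, map_pow] at this
  rw [w, this, ← Ideal.Quotient.mkₐ_eq_mk k, ← aeval_algHom_apply, map_pow]
  rfl

variable {D : Type*} [CommRing D]

/-- Ring homomorphisms out of the coordinate ring of the affine curve. -/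
def lift (i : k →+* D) (z w : D) (hw : w ^ r = h.eval₂ i (z ^ d)) : CurveRing h r d →+* D :=
  Ideal.Quotient.lift _ (MvPolynomial.eval₂Hom i ![z, w]) (by
    intro a ha
    rw [← RingHom.mem_ker]
    revert a
    change Ideal.span _ ≤ _
    rw [Ideal.span_le, Set.singleton_subset_iff, SetLike.mem_coe, RingHom.mem_ker, map_sub, map_pow,
      Polynomial.aeval_def, Polynomial.hom_eval₂, sub_eq_zero]
    simp only [MvPolynomial.coe_eval₂Hom, MvPolynomial.eval₂_X, map_pow, Matrix.cons_val_one,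
      Matrix.cons_val_zero, Matrix.cons_val_fin_one]
    rw [hw]
    congr 1
    ext a; simp)

variable {i : k →+* D} {z' w' : D} {hw : w' ^ r = h.eval₂ i (z' ^ d)}

@[simp] theorem lift_z : lift i z' w' hw (z h r d) = z' := by simp [lift, z]

@[simp] theorem lift_w : lift i z' w' hw (w h r d) = w' := by simp [lift, w]

@[simp] theorem lift_algebraMap (c : k) : lift i z' w' hw (algebraMap k _ c) = i c := by
  rw [IsScalarTower.algebraMap_apply k (MvPolynomial (Fin 2) k) (CurveRing h r d), lift,
    Ideal.Quotient.algebraMap_eq, Ideal.Quotient.lift_mk]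
  simp

theorem ringHom_ext {f g : CurveRing h r d →+* D}
    (hk : ∀ c, f (algebraMap k _ c) = g (algebraMap k _ c)) (hz : f (z h r d) = g (z h r d))
    (hw : f (w h r d) = g (w h r d)) : f = g := by
  refine Ideal.Quotient.ringHom_ext (MvPolynomial.ringHom_ext (fun c => hk c) fun j => ?_)
  fin_cases j
  · exact hz
  · exact hw

theorem induction {P : CurveRing h r d → Prop} (hk : ∀ c, P (algebraMap k _ c))
    (hz : P (z h r d)) (hw : P (w h r d)) (hadd : ∀ a b, P a → P b → P (a + b))
    (hmul : ∀ a b, P a → P b → P (a * b)) (a : CurveRing h r d) : P a := by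
  obtain ⟨p, rfl⟩ := Ideal.Quotient.mk_surjective a
  induction p using MvPolynomial.induction_on with
  | C c => exact hk c
  | add p q hp hq => rw [map_add]; exact hadd _ _ hp hq
  | mul_X p j hp =>
    rw [map_mul]
    refine hmul _ _ hp ?_
    fin_cases j
    · exact hz
    · exact hw

end CurveRing

namespace FamilyRing

variable {A : Type u} [CommRing A] [Algebra k A] {a : A}

variable (h r A a) in
/-- The inverse of the coordinate `x`. -/
def xinv : FamilyRing h r A a := Ideal.Quotient.mk _ (MvPolynomial.X 2)

theorem x_mul_xinv : x h r A a * xinv h r A a = 1 := by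
  have : (Ideal.Quotient.mk (Ideal.span
    {(MvPolynomial.X 0 * MvPolynomial.X 2 - 1 : MvPolynomial (Fin 3) A),
     MvPolynomial.X 1 ^ r - Polynomial.aeval (MvPolynomial.X 0 : MvPolynomial (Fin 3) A) h *
       Polynomial.aeval (MvPolynomial.C a * MvPolynomial.X 2 : MvPolynomial (Fin 3) A) h}))
      (MvPolynomial.X 0 * MvPolynomial.X 2 - 1) = 0 :=
    Ideal.Quotient.eq_zero_iff_mem.mpr (Ideal.subset_span (Or.inl rfl))
  rw [map_sub, sub_eq_zero, map_one, map_mul] at this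
  exact this

theorem y_pow : y h r A a ^ r = aeval (x h r A a) h *
    aeval (algebraMap A _ a * xinv h r A a) h := by
  have : (Ideal.Quotient.mk (Ideal.span
    {(MvPolynomial.X 0 * MvPolynomial.X 2 - 1 : MvPolynomial (Fin 3) A),
     MvPolynomial.X 1 ^ r - Polynomial.aeval (MvPolynomial.X 0 : MvPolynomial (Fin 3) A) h *
       Polynomial.aeval (MvPolynomial.C a * MvPolynomial.X 2 : MvPolynomial (Fin 3) A) h}))
      (MvPolynomial.X 1 ^ r - Polynomial.aeval (MvPolynomial.X 0 : MvPolynomial (Fin 3) A) h *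
       Polynomial.aeval (MvPolynomial.C a * MvPolynomial.X 2 : MvPolynomial (Fin 3) A) h) = 0 :=
    Ideal.Quotient.eq_zero_iff_mem.mpr (Ideal.subset_span (Or.inr rfl))
  rw [map_sub, sub_eq_zero, map_pow, map_mul] at this
  rw [y, this, ← Ideal.Quotient.mkₐ_eq_mk k, ← aeval_algHom_apply, ← aeval_algHom_apply, map_mul]
  rfl

variable {D : Type*} [CommRing D]

/-- Ring homomorphisms out of the coordinate ring of the affine family. -/
def lift (i : A →+* D) (x y x' : D) (hx : x * x' = 1)
    (hy : y ^ r = h.eval₂ (i.comp (algebraMap k A)) x *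
      h.eval₂ (i.comp (algebraMap k A)) (i a * x')) : FamilyRing h r A a →+* D :=
  Ideal.Quotient.lift _ (MvPolynomial.eval₂Hom i ![x, y, x']) (by
    intro a ha
    rw [← RingHom.mem_ker]
    revert a
    change Ideal.span _ ≤ _
    rw [Ideal.span_le, Set.pair_subset_iff]
    constructor
    · rw [SetLike.mem_coe, RingHom.mem_ker]
      simp [hx]
    · rw [SetLike.mem_coe, RingHom.mem_ker, map_sub, map_pow, map_mul,
        Polynomial.aeval_def, Polynomial.hom_eval₂, Polynomial.aeval_def, Polynomial.hom_eval₂,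
        sub_eq_zero]
      have hc : (MvPolynomial.eval₂Hom i ![x, y, x']).comp
          (algebraMap k (MvPolynomial (Fin 3) A)) = i.comp (algebraMap k A) := by
        ext c; exact MvPolynomial.eval₂_C _ _ _
      rw [hc]
      simpa using hy)

variable {i : A →+* D} {x₀ y₀ x' : D} {hx : x₀ * x' = 1}
  {hy : y₀ ^ r = h.eval₂ (i.comp (algebraMap k A)) x₀ *
      h.eval₂ (i.comp (algebraMap k A)) (i a * x')}

@[simp] theorem lift_x : lift i x₀ y₀ x' hx hy (x h r A a) = x₀ := by simp [lift, x]

@[simp] theorem lift_y : lift i x₀ y₀ x' hx hy (y h r A a) = y₀ := by simp [lift, y]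

@[simp] theorem lift_algebraMap (c : A) : lift i x₀ y₀ x' hx hy (algebraMap A _ c) = i c := by
  rw [IsScalarTower.algebraMap_apply A (MvPolynomial (Fin 3) A) (FamilyRing h r A a), lift,
    Ideal.Quotient.algebraMap_eq, Ideal.Quotient.lift_mk]
  simp

theorem ringHom_ext {f g : FamilyRing h r A a →+* D}
    (hk : ∀ c, f (algebraMap A _ c) = g (algebraMap A _ c)) (hx : f (x h r A a) = g (x h r A a))
    (hy : f (y h r A a) = g (y h r A a)) : f = g := by
  have hx' : f (xinv h r A a) = g (xinv h r A a) := by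
    have h1 : f (x h r A a) * f (xinv h r A a) = 1 := by rw [← map_mul, x_mul_xinv, map_one]
    have h2 : g (x h r A a) * g (xinv h r A a) = 1 := by rw [← map_mul, x_mul_xinv, map_one]
    calc f (xinv h r A a) = f (xinv h r A a) * (g (x h r A a) * g (xinv h r A a)) := by
          rw [h2, mul_one]
      _ = (f (x h r A a) * f (xinv h r A a)) * g (xinv h r A a) := by rw [hx]; ring
      _ = g (xinv h r A a) := by rw [h1, one_mul]
  refine Ideal.Quotient.ringHom_ext (MvPolynomial.ringHom_ext (fun c => hk c) fun j => ?_)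
  fin_cases j
  · exact hx
  · exact hy
  · exact hx'

theorem induction {P : FamilyRing h r A a → Prop} (hk : ∀ c, P (algebraMap A _ c))
    (hx : P (x h r A a)) (hy : P (y h r A a)) (hx' : P (xinv h r A a))
    (hadd : ∀ a b, P a → P b → P (a + b))
    (hmul : ∀ a b, P a → P b → P (a * b)) (b : FamilyRing h r A a) : P b := by
  obtain ⟨p, rfl⟩ := Ideal.Quotient.mk_surjective b
  induction p using MvPolynomial.induction_on with
  | C c => exact hk c
  | add p q hp hq => rw [map_add]; exact hadd _ _ hp hq
  | mul_X p j hp =>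
    rw [map_mul]
    refine hmul _ _ hp ?_
    fin_cases j
    · exact hx
    · exact hy
    · exact hx'

end FamilyRing

end Rings

end UlmerVoloch

end

noncomputable section

namespace UlmerVoloch

/-! ### Embedding the coordinate rings in algebras over fields -/

section RingFacts

open Polynomial

theorem adjoinRoot_root_pow {B : Type*} [CommRing B] (r : ℕ) (b : B) :
    AdjoinRoot.root (X ^ r - C b) ^ r = AdjoinRoot.of (X ^ r - C b) b := by
  have := AdjoinRoot.eval₂_root (X ^ r - C b)
  rwa [eval₂_sub, sub_eq_zero, eval₂_pow, eval₂_X, eval₂_C] at this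

variable {k : Type u} [Field k] {h : Polynomial k} {r : ℕ}

namespace CurveRing

variable (h r) in
/-- The polynomial `w ^ r - h(z ^ d)` over `k[z]`. -/
def poly (d : ℕ) : k[X][X] := X ^ r - C (h.comp (X ^ d))

variable (h r) in
/-- The comparison of the curve ring with `k[z][w] / (w ^ r - h(z ^ d))`. -/
def toAdjoinRoot (d : ℕ) : CurveRing h r d →+* AdjoinRoot (poly h r d) :=
  lift ((AdjoinRoot.of _).comp C) (AdjoinRoot.of _ X) (AdjoinRoot.root _) (by
    rw [poly, adjoinRoot_root_pow, ← map_pow, ← hom_eval₂]; rfl)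

theorem toAdjoinRoot_injective (d : ℕ) : Function.Injective (toAdjoinRoot h r d) := by
  let g : AdjoinRoot (poly h r d) →+* CurveRing h r d :=
    AdjoinRoot.lift ((aeval (z h r d) : k[X] →ₐ[k] _) : k[X] →+* CurveRing h r d) (w h r d) (by
      rw [poly, eval₂_sub, eval₂_pow, eval₂_X, eval₂_C, w_pow, sub_eq_zero]
      simp [aeval_comp])
  have : g.comp (toAdjoinRoot h r d) = RingHom.id _ := by
    apply ringHom_ext
    · intro c
      simp [g, toAdjoinRoot]
    · simp [g, toAdjoinRoot]
    · simp [g, toAdjoinRoot]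
  exact Function.LeftInverse.injective (g := g) fun a => congrArg (fun φ => φ a) this

theorem poly_monic (hr : r ≠ 0) (d : ℕ) : (poly h r d).Monic := monic_X_pow_sub_C _ hr

theorem toAdjoinRoot_aeval_z (d : ℕ) (p : k[X]) :
    toAdjoinRoot h r d (aeval (z h r d) p) = AdjoinRoot.of _ p := by
  have : ((toAdjoinRoot h r d).comp (aeval (z h r d) : k[X] →ₐ[k] _).toRingHom) =
      AdjoinRoot.of (poly h r d) := by
    apply Polynomial.ringHom_ext
    · intro a; simp [toAdjoinRoot]
    · simp [toAdjoinRoot]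
  exact congrArg (fun φ => φ p) this

/-- The embedding of the curve ring in the corresponding algebra over `k(z)`. -/
def toField (h : k[X]) (r d : ℕ) : CurveRing h r d →+*
    AdjoinRoot ((poly h r d).map (algebraMap k[X] (FractionRing k[X]))) :=
  (AdjoinRoot.map _ _ _ dvd_rfl).comp (toAdjoinRoot h r d)

theorem toField_injective (hr : r ≠ 0) (d : ℕ) : Function.Injective (toField h r d) :=
  (adjoinRoot_map_injective _ (IsFractionRing.injective _ _) _ (poly_monic hr d)).comp
    (toAdjoinRoot_injective d)

/-- Reducedness is inherited from `k(z)[w] / (w ^ r - h(z ^ d))`; here `h(z ^ d)` is nonzero because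
`h` is and `d` is positive. -/
theorem isReduced (hr : (r : k) ≠ 0) (hh : h ≠ 0) (d : ℕ) (hd : d ≠ 0) :
    IsReduced (CurveRing h r d) := by
  have hr0 : r ≠ 0 := by rintro rfl; simp at hr
  have hmap : (poly h r d).map (algebraMap k[X] (FractionRing k[X])) =
      X ^ r - C (algebraMap k[X] (FractionRing k[X]) (h.comp (X ^ d))) := by
    simp [poly]
  have : IsReduced (AdjoinRoot ((poly h r d).map (algebraMap k[X] (FractionRing k[X])))) := by
    rw [hmap]
    refine isReduced_adjoinRoot_X_pow_sub_C ?_ ?_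
    · rw [← map_natCast ((algebraMap k[X] (FractionRing k[X])).comp C)]
      exact (_root_.map_ne_zero _).mpr hr
    · rw [Ne, map_eq_zero_iff _ (IsFractionRing.injective _ _), ← expand_eq_comp_X_pow,
        expand_eq_zero (Nat.pos_of_ne_zero hd)]
      exact hh
  exact isReduced_of_injective _ (toField_injective hr0 d)

/-- A nonzero polynomial in `z` becomes a unit in the `k(z)`-algebra in which the curve ring embeds,
so no irreducibility of the curve enters. -/
theorem aeval_z_mem_nonZeroDivisors (hr : r ≠ 0) (d : ℕ) {p : k[X]} (hp : p ≠ 0) :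
    aeval (z h r d) p ∈ nonZeroDivisors (CurveRing h r d) := by
  rw [mem_nonZeroDivisors_iff_right]
  intro b hb
  have h1 : toField h r d (aeval (z h r d) p) =
      AdjoinRoot.of _ (algebraMap k[X] (FractionRing k[X]) p) := by
    rw [toField, RingHom.comp_apply, toAdjoinRoot_aeval_z, AdjoinRoot.map, AdjoinRoot.lift_of]
    rfl
  have hu : IsUnit (toField h r d (aeval (z h r d) p)) := by
    rw [h1]
    refine IsUnit.map _ (isUnit_iff_ne_zero.mpr ?_)
    rwa [Ne, map_eq_zero_iff _ (IsFractionRing.injective _ _)]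
  have h2 := congrArg (toField h r d) hb
  rw [map_mul, map_zero, hu.mul_left_eq_zero] at h2
  exact (map_eq_zero_iff _ (toField_injective hr d)).mp h2

/-- With `x = z ^ d`, the generators `z` and `w` are roots of `T ^ d - x` and `T ^ r - h(x)`. -/
theorem isIntegral_aeval_z_pow (hr : r ≠ 0) (d : ℕ) (hd : d ≠ 0) :
    ((aeval (z h r d ^ d) : k[X] →ₐ[k] _) : k[X] →+* CurveRing h r d).IsIntegral := by
  intro a
  have hz : RingHom.IsIntegralElem
      ((aeval (z h r d ^ d) : k[X] →ₐ[k] _) : k[X] →+* CurveRing h r d) (z h r d) :=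
    ⟨X ^ d - C X, monic_X_pow_sub_C _ hd, by simp⟩
  induction a using CurveRing.induction with
  | hk c => exact ⟨X - C (C c), monic_X_sub_C _, by simp⟩
  | hz => exact hz
  | hw => exact ⟨X ^ r - C h, monic_X_pow_sub_C _ hr, by simp [w_pow]⟩
  | hadd a b ha hb => exact RingHom.IsIntegralElem.add _ ha hb
  | hmul a b ha hb => exact RingHom.IsIntegralElem.mul _ ha hb

instance (d : ℕ) : IsNoetherianRing (CurveRing h r d) := inferInstance

end CurveRing

namespace FamilyRing

variable {A : Type u} [CommRing A] [Algebra k A] {a : A} {L : Type u} [Field L]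

/-- The right hand side `h(x) h(a / x)`. -/
def rhs {B : Type*} [CommRing B] (h : k[X]) (i : k →+* B) (x y : B) : B := h.eval₂ i x * h.eval₂ i y

theorem y_pow_eq_rhs : y h r A a ^ r =
    rhs h (algebraMap k _) (x h r A a) (algebraMap A _ a * xinv h r A a) := y_pow

theorem map_rhs {B B' : Type*} [CommRing B] [CommRing B'] (i : k →+* B) (x y : B) (f : B →+* B') :
    f (rhs h i x y) = rhs h (f.comp i) (f x) (f y) := by
  simp [rhs, hom_eval₂]

theorem root_pow_eq_rhs {B : Type*} [CommRing B] (i : k →+* B) (x c y : B) :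
    AdjoinRoot.root (X ^ r - C (rhs h i x (c * y))) ^ r =
      h.eval₂ ((AdjoinRoot.of _).comp i) (AdjoinRoot.of (X ^ r - C (rhs h i x (c * y))) x) *
      h.eval₂ ((AdjoinRoot.of _).comp i) (AdjoinRoot.of (X ^ r - C (rhs h i x (c * y))) c *
        AdjoinRoot.of (X ^ r - C (rhs h i x (c * y))) y) := by
  refine (adjoinRoot_root_pow r _).trans ((map_rhs i x (c * y) (AdjoinRoot.of _)).trans ?_)
  rw [map_mul (AdjoinRoot.of _) c y]
  rfl

section

variable (B : Type u) [CommRing B] [Algebra A[X] B] [IsLocalization.Away (X : A[X]) B]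

variable (h r a) in
/-- The polynomial `y ^ r - h(x) h(a / x)` over `A[x, x⁻¹]`. -/
def poly : B[X] := X ^ r - C (rhs h (((algebraMap A[X] B).comp C).comp (algebraMap k A))
  (algebraMap A[X] B X) (algebraMap A[X] B (C a) * IsLocalization.Away.invSelf (X : A[X])))

variable (h r a) in
/-- The comparison of the family ring with `A[x, x⁻¹][y] / (y ^ r - h(x) h(a / x))`. -/
def toAdjoinRoot : FamilyRing h r A a →+* AdjoinRoot (poly h r a B) :=
  lift ((AdjoinRoot.of _).comp ((algebraMap A[X] B).comp C)) (AdjoinRoot.of _ (algebraMap A[X] B X))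
    (AdjoinRoot.root _) (AdjoinRoot.of _ (IsLocalization.Away.invSelf (X : A[X])))
    (by rw [← map_mul, IsLocalization.Away.mul_invSelf, map_one])
    (root_pow_eq_rhs _ _ _ _)

@[simp] theorem toAdjoinRoot_x : toAdjoinRoot h r a B (x h r A a) =
    AdjoinRoot.of _ (algebraMap A[X] B X) := lift_x

@[simp] theorem toAdjoinRoot_y : toAdjoinRoot h r a B (y h r A a) = AdjoinRoot.root _ := lift_y

@[simp] theorem toAdjoinRoot_algebraMap (c : A) : toAdjoinRoot h r a B (algebraMap A _ c) =
    AdjoinRoot.of _ (algebraMap A[X] B (C c)) := lift_algebraMap c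

theorem toAdjoinRoot_injective : Function.Injective (toAdjoinRoot h r a B) := by
  have hX : IsUnit (eval₂RingHom (algebraMap A (FamilyRing h r A a)) (x h r A a) X) := by
    rw [coe_eval₂RingHom, eval₂_X]
    exact IsUnit.of_mul_eq_one _ x_mul_xinv
  have hinv : IsLocalization.Away.lift (S := B) X hX (IsLocalization.Away.invSelf (X : A[X])) =
      xinv h r A a := by
    have h1 := congrArg (IsLocalization.Away.lift (S := B) X hX)
      (IsLocalization.Away.mul_invSelf (S := B) (X : A[X]))
    rw [map_mul, map_one, IsLocalization.Away.lift_eq, coe_eval₂RingHom, eval₂_X] at h1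
    exact (IsUnit.of_mul_eq_one _ (x_mul_xinv (h := h) (r := r) (a := a))).mul_left_cancel
      (h1.trans x_mul_xinv.symm)
  have hc : ∀ c, IsLocalization.Away.lift (S := B) X hX (algebraMap A[X] B (C c)) =
      algebraMap A (FamilyRing h r A a) c := by
    intro c
    rw [IsLocalization.Away.lift_eq, coe_eval₂RingHom, eval₂_C]
  let g : AdjoinRoot (poly h r a B) →+* FamilyRing h r A a :=
    AdjoinRoot.lift (IsLocalization.Away.lift (S := B) X hX) (y h r A a) (by
      have hk : (IsLocalization.Away.lift (S := B) X hX).comp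
          (((algebraMap A[X] B).comp C).comp (algebraMap k A)) =
          algebraMap k (FamilyRing h r A a) := by
        ext c
        simp only [RingHom.comp_apply]
        rw [hc, ← IsScalarTower.algebraMap_apply]
      rw [poly, eval₂_sub, eval₂_pow, eval₂_X, eval₂_C, y_pow_eq_rhs, sub_eq_zero, map_rhs, map_mul,
        hinv, hc, IsLocalization.Away.lift_eq, coe_eval₂RingHom, eval₂_X, hk])
  have : g.comp (toAdjoinRoot h r a B) = RingHom.id _ := by
    apply ringHom_ext
    · intro c
      simp [g, hc]
    · simp [g]
    · simp [g]
  exact Function.LeftInverse.injective (g := g) fun a => congrArg (fun φ => φ a) this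

end

/-- The embedding of the family ring in the algebra `L[y] / (y ^ r - h(x) h(a / x))` over a field
`L` containing `A[x]`. -/
def toField (h : k[X]) (r : ℕ) (a : A) (j : A[X] →+* L) (hj : j X ≠ 0) : FamilyRing h r A a →+*
    AdjoinRoot (X ^ r - C (rhs h ((j.comp C).comp (algebraMap k A)) (j X) (j (C a) * (j X)⁻¹))) :=
  lift ((AdjoinRoot.of _).comp (j.comp C)) (AdjoinRoot.of _ (j X))
    (AdjoinRoot.root _) (AdjoinRoot.of _ (j X)⁻¹)
    (by rw [← map_mul, mul_inv_cancel₀ hj, map_one])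
    (root_pow_eq_rhs _ _ _ _)

section

variable {j : A[X] →+* L} {hj : j X ≠ 0}

@[simp] theorem toField_x : toField h r a j hj (x h r A a) = AdjoinRoot.of _ (j X) := lift_x

@[simp] theorem toField_y : toField h r a j hj (y h r A a) = AdjoinRoot.root _ := lift_y

@[simp] theorem toField_algebraMap (c : A) : toField h r a j hj (algebraMap A _ c) =
    AdjoinRoot.of _ (j (C c)) := lift_algebraMap c

end

/-- The map factors through `A[x, x⁻¹][y] / (y ^ r - h(x) h(a / x))`. The Laurent polynomial ring
embeds in `L`, and the equation is monic in `y`. -/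
theorem toField_injective (hr : r ≠ 0) (j : A[X] →+* L) (hinj : Function.Injective j)
    (hj : j X ≠ 0) : Function.Injective (toField h r a j hj) := by
  have : IsDomain A[X] := hinj.isDomain
  let B := Localization.Away (X : A[X])
  have hu : IsUnit (j X) := isUnit_iff_ne_zero.mpr hj
  let i : B →+* L := IsLocalization.Away.lift (X : A[X]) hu
  have hi : Function.Injective i := by
    rw [injective_iff_map_eq_zero]
    intro b hb
    obtain ⟨⟨p, s⟩, hs⟩ := IsLocalization.surj (Submonoid.powers (X : A[X])) b
    have h1 := congrArg i hs
    rw [map_mul, hb, zero_mul] at h1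
    have h2 : j p = 0 := by rw [h1]; exact (IsLocalization.Away.lift_eq _ hu p).symm
    rw [map_eq_zero_iff _ hinj] at h2
    simp only [h2, map_zero] at hs
    exact (IsLocalization.map_units B s).mul_left_eq_zero.mp hs
  have hiX : i (IsLocalization.Away.invSelf (X : A[X])) = (j X)⁻¹ := by
    have h1 := congrArg i (IsLocalization.Away.mul_invSelf (S := B) (X : A[X]))
    rw [map_mul, map_one] at h1
    have h2 : i (algebraMap A[X] B X) = j X := IsLocalization.Away.lift_eq _ hu X
    rw [h2] at h1
    exact (inv_eq_of_mul_eq_one_right h1).symm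
  have hij : ∀ p, i (algebraMap A[X] B p) = j p := fun p => IsLocalization.Away.lift_eq _ hu p
  have hmap : (poly h r a B).map i = X ^ r - C (rhs h ((j.comp C).comp (algebraMap k A)) (j X)
      (j (C a) * (j X)⁻¹)) := by
    rw [poly, Polynomial.map_sub, Polynomial.map_pow, map_X, map_C, map_rhs, map_mul, hiX, hij, hij]
    congr 3
    ext c
    simp [hij]
  have h2 := (adjoinRoot_map_injective i hi (poly h r a B) (monic_X_pow_sub_C _ hr)).comp
    (toAdjoinRoot_injective (h := h) (r := r) (a := a) B)
  rw [← RingHom.coe_comp] at h2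
  have hdvd : (poly h r a B).map i ∣ X ^ r - C (rhs h ((j.comp C).comp (algebraMap k A)) (j X)
      (j (C a) * (j X)⁻¹)) := hmap ▸ dvd_rfl
  have key : toField h r a j hj = ((AdjoinRoot.map i (poly h r a B) _ (hmap ▸ dvd_rfl)).comp
      (toAdjoinRoot h r a B)) := by
    apply ringHom_ext
    · intro c; simp [AdjoinRoot.map, hij]
    · simp [AdjoinRoot.map, hij]
    · simp [AdjoinRoot.map]
  rw [key]
  have gen : ∀ q (hq : q = (poly h r a B).map i) (hd : q ∣ (poly h r a B).map i),
      Function.Injective ((AdjoinRoot.map i (poly h r a B) q hd).comp (toAdjoinRoot h r a B)) := by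
    rintro q rfl hd
    exact h2
  exact gen _ hmap.symm _

theorem isReduced [IsDomain A] (hr : (r : k) ≠ 0) (h0 : h.coeff 0 ≠ 0) :
    IsReduced (FamilyRing h r A a) := by
  have hr0 : r ≠ 0 := by rintro rfl; simp at hr
  let j : A[X] →+* FractionRing A[X] := algebraMap _ _
  have hinj : Function.Injective j := IsFractionRing.injective _ _
  have hA : Function.Injective (algebraMap k A) := (algebraMap k A).injective
  have hj : j X ≠ 0 := by rw [Ne, map_eq_zero_iff _ hinj]; exact X_ne_zero
  have h1 : h.eval₂ ((j.comp C).comp (algebraMap k A)) (j X) ≠ 0 := by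
    rw [RingHom.comp_assoc, ← hom_eval₂, Ne, map_eq_zero_iff _ hinj, ← eval₂_map, eval₂_C_X]
    rw [Polynomial.map_eq_zero_iff hA]
    rintro rfl
    simp at h0
  have h2 : h.eval₂ ((j.comp C).comp (algebraMap k A)) (j (C a) * (j X)⁻¹) ≠ 0 := by
    intro h2
    -- Multiply `h(a / X)` by `X ^ deg h` to clear denominators. The coefficient of `X ^ deg h` in
    -- the result is the constant term of `h`, which is nonzero whatever `a` is.
    have h3 : j (∑ i ∈ Finset.range (h.natDegree + 1),
        C (algebraMap k A (h.coeff i) * a ^ i) * X ^ (h.natDegree - i)) = 0 := by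
      rw [← mul_zero (j X ^ h.natDegree), ← h2, eval₂_eq_sum_range, map_sum, Finset.mul_sum]
      refine Finset.sum_congr rfl fun i hi => ?_
      have hi' : i ≤ h.natDegree := Nat.lt_succ_iff.mp (Finset.mem_range.mp hi)
      rw [← pow_sub_mul_pow (j X) hi', mul_pow, inv_pow]
      simp only [map_mul, map_pow, RingHom.comp_apply]
      field_simp
    rw [map_eq_zero_iff _ hinj] at h3
    have h4 := congrArg (fun p => coeff p h.natDegree) h3
    simp only [finsetSum_coeff, coeff_C_mul_X_pow, coeff_zero] at h4
    rw [Finset.sum_eq_single 0] at h4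
    · simp only [tsub_zero, if_true, pow_zero, mul_one] at h4
      exact h0 ((map_eq_zero_iff _ hA).mp h4)
    · intro i hi hi0
      have hi' : i ≤ h.natDegree := Nat.lt_succ_iff.mp (Finset.mem_range.mp hi)
      rw [if_neg (by omega)]
    · simp
  have : IsReduced (AdjoinRoot (X ^ r - C (rhs h ((j.comp C).comp (algebraMap k A)) (j X)
      (j (C a) * (j X)⁻¹)))) := by
    refine isReduced_adjoinRoot_X_pow_sub_C ?_ (mul_ne_zero h1 h2)
    rw [← map_natCast ((j.comp C).comp (algebraMap k A))]
    exact (_root_.map_ne_zero _).mpr hr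
  exact isReduced_of_injective _ (toField_injective hr0 j hinj hj)

end FamilyRing

end RingFacts

end UlmerVoloch

end

noncomputable section

namespace UlmerVoloch

/-! ### Algebraic independence of `x` and `t`; the surface ring inside the generic ring -/

section RingFacts

open Polynomial TensorProduct

variable {k : Type u} [Field k] {h : Polynomial k} {r : ℕ}

/-- If polynomials in `z₁` and in `z₂` are nonzerodivisors in `R₁` and `R₂`, then polynomials in
`z₁ ⊗ 1` and `1 ⊗ z₂` are nonzerodivisors in `R₁ ⊗ R₂`. -/
theorem eval₂_tmul_mem_nonZeroDivisors {R₁ R₂ : Type*} [CommRing R₁] [CommRing R₂] [Algebra k R₁]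
    [Algebra k R₂] (z₁ : R₁) (z₂ : R₂) (h₁ : ∀ p : k[X], p ≠ 0 → aeval z₁ p ∈ nonZeroDivisors R₁)
    (h₂ : ∀ p : k[X], p ≠ 0 → aeval z₂ p ∈ nonZeroDivisors R₂) (q : k[X][X]) (hq : q ≠ 0) :
    q.eval₂ ((Algebra.TensorProduct.includeLeft : R₁ →ₐ[k] R₁ ⊗[k] R₂).comp (aeval z₁)).toRingHom
      (1 ⊗ₜ z₂) ∈ nonZeroDivisors (R₁ ⊗[k] R₂) := by
  -- Let `k[X]` act on `R₂` with `X` acting as `z₂`. Then `R₁ ⊗[k] R₂` is identified with `R₁[X]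
  -- ⊗[k[X]] R₂`, and `q(z₁, z₂)` becomes `Q ⊗ 1` with `Q = q(z₁, X)`.
  let i₁ : Algebra k[X] R₁[X] := (mapRingHom (algebraMap k R₁)).toAlgebra
  let i₂ : Algebra k[X] R₂ := (aeval z₂).toRingHom.toAlgebra
  have hX₁ : ∀ p : k[X], algebraMap k[X] R₁[X] p = p.map (algebraMap k R₁) := fun _ => rfl
  have hX₂ : ∀ p : k[X], algebraMap k[X] R₂ p = aeval z₂ p := fun _ => rfl
  have : IsScalarTower k k[X] R₁[X] := IsScalarTower.of_algebraMap_eq fun c => by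
    rw [hX₁, algebraMap_eq, map_C]; rfl
  have : IsScalarTower k k[X] R₂ := IsScalarTower.of_algebraMap_eq fun c => by
    rw [hX₂, algebraMap_eq, aeval_C]
  -- Over the principal ideal domain `k[X]`, torsion-free implies flat. Multiplication by `Q` is
  -- injective on `R₁[X]` because the leading coefficient of `Q` is a nonzero polynomial evaluated
  -- at `z₁`; flatness keeps it injective after tensoring with `R₂`.
  have : Module.IsTorsionFree k[X] R₂ := by
    refine Module.isTorsionFree_iff_smul_eq_zero.mpr fun p b hb => ?_
    rw [or_iff_not_imp_left]
    intro hp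
    rw [Algebra.smul_def, hX₂] at hb
    exact (mem_nonZeroDivisors_iff.mp (h₂ p hp)).1 b hb
  have : Module.Flat k[X] R₂ := inferInstance
  let Q : R₁[X] := q.map (aeval z₁).toRingHom
  have hQ : Function.Injective (LinearMap.mulLeft k[X] Q) := by
    rcases subsingleton_or_nontrivial R₁ with hs | hs
    · exact Function.injective_of_subsingleton _
    have hlc : Q.leadingCoeff ∈ nonZeroDivisors R₁ := by
      have h3 := h₁ _ (leadingCoeff_ne_zero.mpr hq)
      have h4 : (aeval z₁).toRingHom q.leadingCoeff ≠ 0 := nonZeroDivisors.ne_zero h3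
      rw [leadingCoeff_map_of_leadingCoeff_ne_zero _ h4]
      exact h3
    rw [← LinearMap.ker_eq_bot, LinearMap.ker_eq_bot']
    intro m hm
    exact (mem_nonZeroDivisors_iff.mp (mem_nonZeroDivisors_of_leadingCoeff hlc)).1 m hm
  have hQ2 := Module.Flat.rTensor_preserves_injective_linearMap (M := R₂) _ hQ
  let e : R₁ ⊗[k] R₂ →ₐ[k] R₁[X] ⊗[k[X]] R₂ := Algebra.TensorProduct.lift
    (((Algebra.TensorProduct.includeLeft : R₁[X] →ₐ[k[X]] R₁[X] ⊗[k[X]] R₂).restrictScalars k).comp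
      (CAlgHom : R₁ →ₐ[k] R₁[X]))
    ((Algebra.TensorProduct.includeRight : R₂ →ₐ[k[X]] R₁[X] ⊗[k[X]] R₂).restrictScalars k)
    fun _ _ => mul_comm _ _
  have he₀ : ∀ a b, e (a ⊗ₜ b) = C a ⊗ₜ b := fun a b => by
    refine (Algebra.TensorProduct.lift_tmul _ _ _ _ _).trans ?_
    change (C a ⊗ₜ 1) * (1 ⊗ₜ b) = _
    rw [Algebra.TensorProduct.tmul_mul_tmul, mul_one, one_mul]
  let i₃ : Algebra k[X] (R₁ ⊗[k] R₂) :=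
    (Algebra.TensorProduct.includeRight.comp (aeval z₂)).toRingHom.toAlgebra
  have hX₃ : ∀ p : k[X], algebraMap k[X] (R₁ ⊗[k] R₂) p = 1 ⊗ₜ aeval z₂ p := fun _ => rfl
  let e' : R₁[X] ⊗[k[X]] R₂ →ₐ[k[X]] R₁ ⊗[k] R₂ := Algebra.TensorProduct.lift
    { toRingHom := eval₂RingHom
        (Algebra.TensorProduct.includeLeft : R₁ →ₐ[k] R₁ ⊗[k] R₂).toRingHom (1 ⊗ₜ z₂)
      commutes' := by
        intro p
        have : (eval₂RingHom (Algebra.TensorProduct.includeLeft : R₁ →ₐ[k] R₁ ⊗[k] R₂).toRingHom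
            (1 ⊗ₜ z₂)).comp (mapRingHom (algebraMap k R₁)) =
            (Algebra.TensorProduct.includeRight.comp (aeval z₂)).toRingHom := by
          apply Polynomial.ringHom_ext
          · intro c
            simp
          · simp
        exact congrArg (fun φ => φ p) this }
    { toRingHom := (Algebra.TensorProduct.includeRight : R₂ →ₐ[k] R₁ ⊗[k] R₂).toRingHom
      commutes' := fun p => rfl }
    fun _ _ => mul_comm _ _
  -- Only the injectivity of `e` matters, so a left inverse is enough.
  have hee : ∀ n, e' (e n) = n := by
    intro n
    induction n using TensorProduct.induction_on with
    | zero => simp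
    | add a b ha hb => rw [map_add, map_add, ha, hb]
    | tmul a b =>
      rw [he₀]
      refine (Algebra.TensorProduct.lift_tmul _ _ _ _ _).trans ?_
      change eval₂ _ _ (C a) * _ = _
      rw [eval₂_C]
      simp
  have he : ∀ p : k[X][X], e (p.eval₂
      ((Algebra.TensorProduct.includeLeft : R₁ →ₐ[k] R₁ ⊗[k] R₂).comp (aeval z₁)).toRingHom
      (1 ⊗ₜ z₂)) = (p.map (aeval z₁).toRingHom) ⊗ₜ 1 := by
    intro p
    have : e.toRingHom.comp (eval₂RingHom ((Algebra.TensorProduct.includeLeft :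
        R₁ →ₐ[k] R₁ ⊗[k] R₂).comp (aeval z₁)).toRingHom (1 ⊗ₜ z₂)) =
        (Algebra.TensorProduct.includeLeft : R₁[X] →ₐ[k[X]] R₁[X] ⊗[k[X]] R₂).toRingHom.comp
          (mapRingHom (aeval z₁).toRingHom) := by
      apply Polynomial.ringHom_ext
      · intro c
        simp [he₀]
      · have : (1 : R₁[X]) ⊗ₜ[k[X]] z₂ = (X : R₁[X]) ⊗ₜ[k[X]] (1 : R₂) := by
          have h3 : (X : R₁[X]) = (X : k[X]) • (1 : R₁[X]) := by
            rw [Algebra.smul_def, hX₁, map_X, mul_one]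
          have h4 : z₂ = (X : k[X]) • (1 : R₂) := by
            rw [Algebra.smul_def, hX₂, aeval_X, mul_one]
          rw [h3, TensorProduct.smul_tmul, ← h4]
        simpa [he₀] using this
    exact congrArg (fun φ => φ p) this
  rw [mem_nonZeroDivisors_iff_right]
  intro n hn
  have h3 := congrArg e hn
  rw [map_mul, he, map_zero, mul_comm] at h3
  have h4 : LinearMap.rTensor R₂ (LinearMap.mulLeft k[X] Q) (e n) = 0 := by
    rw [← h3]
    generalize e n = m
    induction m using TensorProduct.induction_on with
    | zero => simp
    | add a b ha hb => rw [map_add, ha, hb, mul_add]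
    | tmul a b => simp [Q]
  rw [← hee n, (map_eq_zero_iff _ hQ2).mp h4, map_zero]

/-- The substitution `p(x, t) ↦ p(z₁ ^ d, z₁ z₂)`, with `t`, `z₁` the inner variables. -/
def substMonomial (k : Type*) [Field k] (d : ℕ) : k[X][X] →+* k[X][X] :=
  eval₂RingHom (aeval (C X * X) : k[X] →ₐ[k] k[X][X]).toRingHom (C (X ^ d))

/-- The monomial `t ^ i x ^ j` goes to `z₁ ^ (i + d j) z₂ ^ i`, and for `d ≠ 0` this pair of
exponents determines `(i, j)`. -/
theorem coeff_substMonomial {d : ℕ} (p : k[X][X]) (i j : ℕ) (hd : d ≠ 0) :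
    ((substMonomial k d p).coeff i).coeff (i + d * j) = (p.coeff j).coeff i := by
  induction p using Polynomial.induction_on' with
  | add p q hp hq => simp only [map_add, coeff_add, hp, hq]
  | monomial n a =>
    induction a using Polynomial.induction_on' with
    | add p q hp hq => simp only [map_add, coeff_add, hp, hq]
    | monomial m c =>
      have : substMonomial k d (monomial n (monomial m c)) =
          C (C c * X ^ (m + d * n)) * X ^ m := by
        rw [substMonomial, coe_eval₂RingHom, eval₂_monomial]
        simp only [AlgHom.toRingHom_eq_coe, RingHom.coe_coe, aeval_monomial, mul_pow, map_mul,
          map_pow, Polynomial.algebraMap_apply, Algebra.algebraMap_self, RingHom.id_apply, pow_add,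
          pow_mul]
        ring
      rw [this, coeff_C_mul, coeff_X_pow, coeff_monomial]
      by_cases him : i = m
      · subst him
        rw [if_pos rfl, mul_one, coeff_C_mul, coeff_X_pow]
        by_cases hjn : j = n
        · subst hjn
          simp
        · rw [if_neg (by simpa [hd] using hjn), if_neg (Ne.symm hjn)]
          simp
      · rw [if_neg him]
        split_ifs
        · rw [coeff_monomial, if_neg (Ne.symm him)]; simp
        · simp

theorem substMonomial_injective {d : ℕ} (hd : d ≠ 0) : Function.Injective (substMonomial k d) := by
  intro p q hpq
  ext j i
  rw [← coeff_substMonomial p i j hd, hpq, coeff_substMonomial q i j hd]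

namespace SurfaceRing

variable {d : ℕ}

variable (h r d) in
/-- The inclusion of the surface ring in the coordinate ring of its generic fibre. -/
def toGeneric : SurfaceRing h r d →+* GenericRing h r d :=
  FamilyRing.lift ((algebraMap (RatFunc k) _).comp (algebraMap k[X] (RatFunc k)))
    (FamilyRing.x h r _ _) (FamilyRing.y h r _ _) (FamilyRing.xinv h r _ _) FamilyRing.x_mul_xinv
    (by
      refine FamilyRing.y_pow.trans ?_
      rw [RingHom.comp_assoc, ← IsScalarTower.algebraMap_eq, ← IsScalarTower.algebraMap_eq,
        RingHom.comp_apply, map_pow (algebraMap k[X] (RatFunc k)), RatFunc.algebraMap_X]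
      rfl)

@[simp] theorem toGeneric_x : toGeneric h r d (FamilyRing.x h r _ _) = FamilyRing.x h r _ _ :=
  FamilyRing.lift_x

@[simp] theorem toGeneric_y : toGeneric h r d (FamilyRing.y h r _ _) = FamilyRing.y h r _ _ :=
  FamilyRing.lift_y

@[simp] theorem toGeneric_algebraMap (p : k[X]) : toGeneric h r d (algebraMap _ _ p) =
    algebraMap (RatFunc k) _ (algebraMap _ _ p) := FamilyRing.lift_algebraMap p

@[simp] theorem toGeneric_t : toGeneric h r d (t h r d) = algebraMap (RatFunc k) _ RatFunc.X := by
  rw [t, toGeneric_algebraMap, RatFunc.algebraMap_X]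

theorem toGeneric_xinv : toGeneric h r d (FamilyRing.xinv h r _ _) = FamilyRing.xinv h r _ _ := by
  have h1 := congrArg (toGeneric h r d) (FamilyRing.x_mul_xinv (h := h) (r := r))
  rw [map_mul, map_one, toGeneric_x] at h1
  exact (IsUnit.of_mul_eq_one _ (FamilyRing.x_mul_xinv (h := h) (r := r))).mul_left_cancel
    (h1.trans FamilyRing.x_mul_xinv.symm)

/-- Both rings map to `k(t)(x)[y] / (y ^ r - h(x) h(t ^ d / x))`, and the map from the surface ring,
injective by `FamilyRing.toField_injective`, factors through the generic ring. -/
theorem toGeneric_injective (hr : r ≠ 0) : Function.Injective (toGeneric h r d) := by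
  let L := FractionRing (RatFunc k)[X]
  let j₂ : (RatFunc k)[X] →+* L := algebraMap _ _
  let j₁ : k[X][X] →+* L := j₂.comp (mapRingHom (algebraMap k[X] (RatFunc k)))
  have hj₂ : Function.Injective j₂ := IsFractionRing.injective _ _
  have hj₁ : Function.Injective j₁ :=
    hj₂.comp (map_injective _ (IsFractionRing.injective _ _))
  have hX : j₁ X ≠ 0 := by
    rw [Ne, map_eq_zero_iff _ hj₁]; exact X_ne_zero
  have hk : (j₁.comp C).comp (algebraMap k k[X]) = (j₂.comp C).comp (algebraMap k (RatFunc k)) := by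
    ext c
    simp only [j₁, RingHom.comp_apply, coe_mapRingHom, map_C]
    rw [← IsScalarTower.algebraMap_apply]
  let O := AdjoinRoot.of (X ^ r - C (FamilyRing.rhs h ((j₁.comp C).comp (algebraMap k k[X])) (j₁ X)
      (j₁ (C (X ^ d)) * (j₁ X)⁻¹)))
  have hO : (O.comp (j₂.comp C)).comp (algebraMap k (RatFunc k)) =
      O.comp ((j₁.comp C).comp (algebraMap k k[X])) := by
    exact congrArg O.comp hk.symm
  have hjC : ∀ p, j₁ (C p) = j₂ (C (algebraMap k[X] (RatFunc k) p)) := fun p => by simp [j₁]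
  have hO' : (O.comp (j₂.comp C)) (RatFunc.X ^ d) = O (j₁ (C (X ^ d))) := by
    refine congrArg O (Eq.trans ?_ (hjC _).symm)
    rw [map_pow (algebraMap k[X] (RatFunc k)), RatFunc.algebraMap_X]
    rfl
  let ψ : GenericRing h r d →+* _ := FamilyRing.lift (O.comp (j₂.comp C))
    (O (j₁ X)) (AdjoinRoot.root _) (O (j₁ X)⁻¹)
    (by rw [← map_mul, mul_inv_cancel₀ hX, map_one])
    (by rw [hO, hO']; exact FamilyRing.root_pow_eq_rhs _ _ _ _)
  have key : ψ.comp (toGeneric h r d) = FamilyRing.toField h r (X ^ d) j₁ hX := by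
    apply FamilyRing.ringHom_ext
    · intro c
      refine (congrArg ψ (toGeneric_algebraMap c)).trans ((FamilyRing.lift_algebraMap _).trans
        (Eq.trans ?_ (FamilyRing.toField_algebraMap c).symm))
      exact congrArg O (hjC c).symm
    · exact (congrArg ψ toGeneric_x).trans (FamilyRing.lift_x.trans FamilyRing.toField_x.symm)
    · exact (congrArg ψ toGeneric_y).trans (FamilyRing.lift_y.trans FamilyRing.toField_y.symm)
  have h3 := FamilyRing.toField_injective (h := h) (a := X ^ d) hr j₁ hj₁ hX
  rw [← key] at h3
  exact Function.Injective.of_comp (f := ψ) h3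

/-- The generic ring arises from the surface ring by inverting the nonzero polynomials in `t`; this
clears the denominators. -/
theorem exists_toGeneric_eq (b : GenericRing h r d) : ∃ (p : k[X]) (c : SurfaceRing h r d),
    p ≠ 0 ∧ toGeneric h r d c = b * toGeneric h r d (algebraMap _ _ p) := by
  induction b using FamilyRing.induction with
  | hk c =>
    refine ⟨c.denom, algebraMap _ _ c.num, c.denom_ne_zero, ?_⟩
    rw [toGeneric_algebraMap, toGeneric_algebraMap, ← map_mul]
    congr 1
    exact (div_eq_iff (RatFunc.algebraMap_ne_zero c.denom_ne_zero)).mp (RatFunc.num_div_denom c)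
  | hx => exact ⟨1, FamilyRing.x h r _ _, one_ne_zero, by simp⟩
  | hy => exact ⟨1, FamilyRing.y h r _ _, one_ne_zero, by simp⟩
  | hx' => exact ⟨1, FamilyRing.xinv h r _ _, one_ne_zero, by rw [toGeneric_xinv]; simp⟩
  | hadd a b ha hb =>
    obtain ⟨p, c, hp, hc⟩ := ha
    obtain ⟨q, e, hq, he⟩ := hb
    refine ⟨p * q, c * algebraMap _ _ q + e * algebraMap _ _ p, mul_ne_zero hp hq, ?_⟩
    simp only [map_mul, map_add, hc, he]
    ring
  | hmul a b ha hb =>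
    obtain ⟨p, c, hp, hc⟩ := ha
    obtain ⟨q, e, hq, he⟩ := hb
    refine ⟨p * q, c * e, mul_ne_zero hp hq, ?_⟩
    simp only [map_mul, hc, he]
    ring

instance : Algebra.FiniteType k (SurfaceRing h r d) :=
  Algebra.FiniteType.trans (S := k[X]) inferInstance inferInstance

variable (h r d) in
/-- The polynomials in `x` and `t`, with `t` the inner variable. -/
def ofPoly : k[X][X] →+* SurfaceRing h r d := eval₂RingHom (algebraMap _ _) (FamilyRing.x h r _ _)

/-- The surface ring is algebraic over `k[t][x]`. In a domain, a nonzero algebraic element divides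
the constant term of a suitable equation for it, and this term can be taken nonzero. -/
theorem exists_dvd_ofPoly [IsDomain (SurfaceRing h r d)] (hr : r ≠ 0) (f : SurfaceRing h r d)
    (hf : f ≠ 0) : ∃ p, p ≠ 0 ∧ f ∣ ofPoly h r d p := by
  let _ : Algebra k[X][X] (SurfaceRing h r d) := (ofPoly h r d).toAlgebra
  have hp : ∀ p, algebraMap k[X][X] (SurfaceRing h r d) p = ofPoly h r d p := fun _ => rfl
  have halg : ∀ f : SurfaceRing h r d, IsAlgebraic k[X][X] f := by
    intro f
    have hx : IsAlgebraic k[X][X] (FamilyRing.x h r k[X] (X ^ d)) := by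
      have := isAlgebraic_algebraMap (R := k[X][X]) (A := SurfaceRing h r d) X
      rwa [hp, ofPoly, coe_eval₂RingHom, eval₂_X] at this
    have hc : ∀ c, IsAlgebraic k[X][X] (algebraMap k[X] (SurfaceRing h r d) c) := fun c => by
      have := isAlgebraic_algebraMap (R := k[X][X]) (A := SurfaceRing h r d) (C c)
      rwa [hp, ofPoly, coe_eval₂RingHom, eval₂_C] at this
    have hx' : IsAlgebraic k[X][X] (FamilyRing.xinv h r k[X] (X ^ d)) := by
      refine ⟨C X * X - 1, ?_, ?_⟩
      · intro h0
        have := congrArg (fun p => coeff p 0) h0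
        simp at this
      · rw [map_sub, map_mul, aeval_C, aeval_X, map_one, hp, ofPoly, coe_eval₂RingHom, eval₂_X,
          FamilyRing.x_mul_xinv, sub_self]
    have hpoly : ∀ (g : k[X]) (b : SurfaceRing h r d), IsAlgebraic k[X][X] b →
        IsAlgebraic k[X][X] (aeval b g) := by
      intro g b hb
      induction g using Polynomial.induction_on with
      | C c =>
        rw [aeval_C, IsScalarTower.algebraMap_apply k k[X]]
        exact hc _
      | add p q hp hq => rw [map_add]; exact hp.add hq
      | monomial n c hn =>
        rw [pow_succ, ← mul_assoc, map_mul, aeval_X]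
        exact hn.mul hb
    induction f using FamilyRing.induction with
    | hk c => exact hc c
    | hx => exact hx
    | hx' => exact hx'
    | hy =>
      refine IsAlgebraic.of_pow (Nat.pos_of_ne_zero hr) ?_
      rw [FamilyRing.y_pow]
      exact (hpoly _ _ hx).mul (hpoly _ _ ((hc _).mul hx'))
    | hadd a b ha hb => exact ha.add hb
    | hmul a b ha hb => exact ha.mul hb
  exact (halg f).exists_nonzero_dvd (mem_nonZeroDivisors_of_ne_zero hf)

end SurfaceRing

end RingFacts

end UlmerVoloch

end

noncomputable section

namespace UlmerVoloch

/-! ### Functions on open subschemes -/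

section Functions

open Opposite TopologicalSpace

variable {X Y Z : Scheme.{u}} {A B : Type u} [CommRing A] [CommRing B]

/-- Restriction of functions. -/
def res {U V : X.Opens} (e : V ≤ U) : Γ(X, U) →+* Γ(X, V) := (X.presheaf.map (homOfLE e).op).hom

@[simp] theorem res_res {U V W : X.Opens} (e : V ≤ U) (e' : W ≤ V) (s : Γ(X, U)) :
    res e' (res e s) = res (e'.trans e) s := by
  rw [res, res, ← CommRingCat.comp_apply, ← Functor.map_comp]; rfl

@[simp] theorem res_appLE (f : X ⟶ Y) {U : Y.Opens} {V V' : X.Opens} (e : V ≤ f ⁻¹ᵁ U) (e' : V' ≤ V)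
    (s : Γ(Y, U)) : res e' ((f.appLE U V e).hom s) = (f.appLE U V' (e'.trans e)).hom s := by
  rw [res, ← CommRingCat.comp_apply, Scheme.Hom.appLE_map]

@[simp] theorem appLE_res (f : X ⟶ Y) {U U' : Y.Opens} {V : X.Opens} (e : V ≤ f ⁻¹ᵁ U)
    (e' : U ≤ U') (s : Γ(Y, U')) : (f.appLE U V e).hom (res e' s) =
      (f.appLE U' V (e.trans (f.preimage_mono e'))).hom s := by
  rw [res, ← CommRingCat.comp_apply, Scheme.Hom.map_appLE]

theorem appLE_appLE (f : X ⟶ Y) (g : Y ⟶ Z) {U : Z.Opens} {V : Y.Opens} {W : X.Opens}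
    (e : V ≤ g ⁻¹ᵁ U) (e' : W ≤ f ⁻¹ᵁ V) (s : Γ(Z, U)) :
    (f.appLE V W e').hom ((g.appLE U V e).hom s) =
      ((f ≫ g).appLE U W (e'.trans (f.preimage_mono e))).hom s := by
  rw [← CommRingCat.comp_apply, Scheme.Hom.appLE_comp_appLE]

theorem appLE_congr_hom {f g : X ⟶ Y} (h : f = g) {U : Y.Opens} {V : X.Opens}
    (e : V ≤ f ⁻¹ᵁ U) (s : Γ(Y, U)) : (f.appLE U V e).hom s = (g.appLE U V (h ▸ e)).hom s := by
  subst h; rfl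

/-- `pullFun` as a morphism in the category of commutative rings. -/
def pullCat (f : X ⟶ Spec (.of A)) (W : X.Opens) : CommRingCat.of A ⟶ Γ(X, W) :=
  (Scheme.ΓSpecIso (.of A)).inv ≫ f.appLE ⊤ W (show W ≤ f ⁻¹ᵁ ⊤ from by rw [Scheme.Hom.preimage_top]; exact le_top)

theorem pullCat_res (f : X ⟶ Spec (.of A)) {V W : X.Opens} (e : V ≤ W) :
    pullCat f W ≫ X.presheaf.map (homOfLE e).op = pullCat f V := by
  rw [pullCat, Category.assoc, Scheme.Hom.appLE_map, pullCat]

theorem pullCat_appLE (g : X ⟶ Y) (f : Y ⟶ Spec (.of A)) {W : Y.Opens} {V : X.Opens}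
    (e : V ≤ g ⁻¹ᵁ W) : pullCat f W ≫ g.appLE W V e = pullCat (g ≫ f) V := by
  rw [pullCat, Category.assoc, Scheme.Hom.appLE_comp_appLE, pullCat]

theorem pullCat_top (f : X ⟶ Spec (.of A)) : pullCat f ⊤ = (Scheme.ΓSpecIso (.of A)).inv ≫ f.appTop := by
  rw [pullCat]
  congr 1
  exact f.appLE_eq_app

theorem pullCat_comp_specMap (f : X ⟶ Spec (.of B)) (φ : CommRingCat.of A ⟶ CommRingCat.of B)
    (W : X.Opens) : pullCat (f ≫ Spec.map φ) W = φ ≫ pullCat f W := by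
  rw [← pullCat_res _ (le_top : W ≤ ⊤), ← pullCat_res f (le_top : W ≤ ⊤), pullCat_top, pullCat_top,
    Scheme.Hom.comp_appTop, ← Scheme.ΓSpecIso_inv_naturality_assoc]
  simp only [Category.assoc]

theorem toSpecΓ_specMap_pullCat (f : X ⟶ Spec (.of A)) (W : X.Opens) :
    W.toSpecΓ ≫ Spec.map (pullCat f W) = W.ι ≫ f := by
  rw [← pullCat_res f (le_top : W ≤ ⊤), Spec.map_comp,
    Scheme.Opens.toSpecΓ_SpecMap_presheaf_map_top_assoc, pullCat_top, Spec.map_comp,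
    ← Scheme.toSpecΓ_naturality_assoc, toSpecΓ_SpecMap_ΓSpecIso_inv]
  simp

/-- `pullFun` as a ring homomorphism. -/
def pullHom (f : X ⟶ Spec (.of A)) (W : X.Opens) : A →+* Γ(X, W) := (pullCat f W).hom

theorem pullFun_eq (f : X ⟶ Spec (.of A)) (a : A) (W : X.Opens) :
    pullFun f a W = pullHom f W a := rfl

@[simp] theorem res_pullHom (f : X ⟶ Spec (.of A)) {V W : X.Opens} (e : V ≤ W) (a : A) :
    res e (pullHom f W a) = pullHom f V a :=
  congrArg (fun φ => φ.hom a) (pullCat_res f e)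

@[simp] theorem appLE_pullHom (g : X ⟶ Y) (f : Y ⟶ Spec (.of A)) {W : Y.Opens} {V : X.Opens}
    (e : V ≤ g ⁻¹ᵁ W) (a : A) : (g.appLE W V e).hom (pullHom f W a) = pullHom (g ≫ f) V a :=
  congrArg (fun φ => φ.hom a) (pullCat_appLE g f e)

theorem pullHom_comp_specMap (f : X ⟶ Spec (.of B)) (φ : A →+* B) (W : X.Opens) (a : A) :
    pullHom (f ≫ Spec.map (CommRingCat.ofHom φ)) W a = pullHom f W (φ a) :=
  congrArg (fun φ => φ.hom a) (pullCat_comp_specMap f (CommRingCat.ofHom φ) W)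

/-- The morphism to an affine scheme given by a ring homomorphism. -/
def toSpec (U : X.Opens) (φ : A →+* Γ(X, U)) : U.toScheme ⟶ Spec (.of A) :=
  U.toSpecΓ ≫ Spec.map (CommRingCat.ofHom φ)

theorem toSpec_pullHom (f : X ⟶ Spec (.of A)) (U : X.Opens) : toSpec U (pullHom f U) = U.ι ≫ f :=
  toSpecΓ_specMap_pullCat f U

theorem pullCat_toSpec (U : X.Opens) (φ : A →+* Γ(X, U)) :
    pullCat (toSpec U φ) ⊤ ≫ U.topIso.hom = CommRingCat.ofHom φ := by
  rw [toSpec, pullCat_top, Scheme.Hom.comp_appTop, Scheme.Opens.toSpecΓ_appTop,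
    ← Scheme.ΓSpecIso_inv_naturality_assoc, Iso.inv_hom_id_assoc, Category.assoc, Iso.inv_hom_id,
    Category.comp_id]

theorem exists_eq_toSpec (U : X.Opens) (f : U.toScheme ⟶ Spec (.of A)) : ∃ φ, f = toSpec U φ := by
  refine ⟨(pullCat f ⊤ ≫ U.topIso.hom).hom, ?_⟩
  rw [toSpec, CommRingCat.ofHom_hom, Spec.map_comp, Scheme.Opens.toSpecΓ, Category.assoc,
    ← Spec.map_comp_assoc, Iso.hom_inv_id, Spec.map_id, Category.id_comp, pullCat_top,
    Spec.map_comp, ← Scheme.toSpecΓ_naturality_assoc, toSpecΓ_SpecMap_ΓSpecIso_inv]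
  simp

theorem toSpec_injective (U : X.Opens) {φ ψ : A →+* Γ(X, U)} (h : toSpec U φ = toSpec U ψ) :
    φ = ψ := by
  rw [← CommRingCat.hom_ofHom φ, ← CommRingCat.hom_ofHom ψ, ← pullCat_toSpec, h, pullCat_toSpec]

/-- `coord` as a ring homomorphism. -/
def coordHom (j : X.PartialIso (Spec (.of A))) : A →+* Γ(X, j.source) :=
  (pullCat (j.iso.hom ≫ j.target.ι) ⊤ ≫ j.source.topIso.hom).hom

theorem coord_eq (j : X.PartialIso (Spec (.of A))) (a : A) : coord j a = coordHom j a := rfl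

theorem toSpec_coordHom (j : X.PartialIso (Spec (.of A))) :
    toSpec j.source (coordHom j) = j.iso.hom ≫ j.target.ι := by
  obtain ⟨φ, hφ⟩ := exists_eq_toSpec j.source (j.iso.hom ≫ j.target.ι)
  rw [coordHom, hφ, pullCat_toSpec]
  rfl

theorem toSpec_res {U V : X.Opens} (e : V ≤ U) (φ : A →+* Γ(X, U)) :
    toSpec V ((res e).comp φ) = X.homOfLE e ≫ toSpec U φ := by
  rw [toSpec, toSpec, ← Scheme.Opens.toSpecΓ_SpecMap_presheaf_map_assoc, ← Spec.map_comp]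
  rfl

/-- The open subset `a ≠ 0` of `Spec A`. -/
def basicSpec (a : A) : (Spec (.of A)).Opens := PrimeSpectrum.basicOpen a

theorem preimage_basicSpec (f : X ⟶ Spec (.of A)) (a : A) :
    f ⁻¹ᵁ basicSpec a = X.basicOpen (pullHom f ⊤ a) := by
  have h : basicSpec a = (Spec (.of A)).basicOpen ((Scheme.ΓSpecIso (.of A)).inv.hom a) :=
    (basicOpen_eq_of_affine (R := .of A) a).symm
  rw [h, Scheme.preimage_basicOpen_top, pullHom, pullCat_top]
  rfl

/-- The open subset `a ≠ 0` of the source of a morphism to `Spec A` given by functions. -/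
theorem toSpec_preimage_basicSpec (U : X.Opens) (φ : A →+* Γ(X, U)) (a : A) :
    U.ι ''ᵁ (toSpec U φ ⁻¹ᵁ basicSpec a) = X.basicOpen (φ a) := by
  have h1 : (pullCat (toSpec U φ) ⊤).hom a = U.topIso.inv.hom (φ a) := by
    have h := congrArg (fun ψ => (ψ ≫ U.topIso.inv).hom a) (pullCat_toSpec U φ)
    simp only [Category.assoc, Iso.hom_inv_id, Category.comp_id] at h
    exact h
  rw [preimage_basicSpec, pullHom, h1]
  exact Scheme.Opens.ι_image_basicOpen_topIso_inv _ _

/-- The ring homomorphism `φ` is a localization away from `m`. -/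
def IsAwayHom (φ : A →+* B) (m : A) : Prop :=
  letI := φ.toAlgebra
  IsLocalization.Away m B

theorem isAwayHom_iff (φ : A →+* B) (m : A) : IsAwayHom φ m ↔ IsUnit (φ m) ∧
    (∀ b, ∃ a n, b * φ m ^ n = φ a) ∧ ∀ a, φ a = 0 → ∃ n, m ^ n * a = 0 := by
  let _ := φ.toAlgebra
  constructor
  · intro (h : IsLocalization.Away m B)
    refine ⟨IsLocalization.Away.algebraMap_isUnit m, fun b => ?_, fun a ha => ?_⟩
    · obtain ⟨n, a, h⟩ := IsLocalization.Away.surj m b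
      exact ⟨a, n, h⟩
    · obtain ⟨⟨_, n, rfl⟩, h⟩ := (IsLocalization.map_eq_zero_iff (Submonoid.powers m) B a).mp ha
      exact ⟨n, h⟩
  · rintro ⟨h1, h2, h3⟩
    refine (IsLocalization.Away.mk m h1 (fun b => ?_) fun a b h => ?_ : IsLocalization.Away m B)
    · obtain ⟨a, n, h⟩ := h2 b
      exact ⟨n, a, h⟩
    · obtain ⟨n, h⟩ := h3 (a - b) (by rw [map_sub, sub_eq_zero]; exact h)
      exact ⟨n, by rwa [mul_sub, sub_eq_zero] at h⟩

/-- Two open immersions with the same image have isomorphic sources, so `W` is `Spec A_b` over `Spec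
A`. A morphism to an affine scheme is a ring homomorphism, so this is an isomorphism of
`A`-algebras. -/
theorem isAwayHom_of_opensRange (W : X.Opens) (φ : A →+* Γ(X, W)) [IsOpenImmersion (toSpec W φ)]
    (b : A) (h : (toSpec W φ).opensRange = basicSpec b) :
    IsAffineOpen W ∧ IsAwayHom φ b := by
  let L := Localization.Away b
  let g : Spec (.of L) ⟶ Spec (.of A) := Spec.map (CommRingCat.ofHom (algebraMap A L))
  have hg : g.opensRange = basicSpec b :=
    Scheme.Hom.opensRange_localizationAway (R := .of A) b
  let u := IsOpenImmersion.isoOfRangeEq (toSpec W φ) g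
    (congrArg (fun O : Scheme.Opens _ => (O : Set (Spec (.of A)))) (h.trans hg.symm))
  have hW : IsAffineOpen W := IsAffine.of_isIso u.hom
  refine ⟨hW, ?_⟩
  obtain ⟨ψ, hψ⟩ := exists_eq_toSpec W u.hom
  have hu : u.hom ≫ g = toSpec W φ := IsOpenImmersion.isoOfRangeEq_hom_fac _ _ _
  have hψφ : ψ.comp (algebraMap A L) = φ := by
    apply toSpec_injective
    rw [← hu, hψ, toSpec, toSpec, Category.assoc, ← Spec.map_comp, ← CommRingCat.ofHom_comp]
  have : IsAffine W := hW
  have h1 : IsIso W.toSpecΓ := by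
    rw [← hW.isoSpec_hom]; infer_instance
  have h2 : IsIso (W.toSpecΓ ≫ Spec.map (CommRingCat.ofHom ψ)) := by
    change IsIso (toSpec W ψ)
    rw [← hψ]
    infer_instance
  have h3 : IsIso (Spec.map (CommRingCat.ofHom ψ)) := IsIso.of_isIso_comp_left W.toSpecΓ _
  have h4 : IsIso (CommRingCat.ofHom ψ) := by
    have h6 : IsIso (Scheme.Spec.map (CommRingCat.ofHom ψ).op) := h3
    have h7 := isIso_of_reflects_iso (CommRingCat.ofHom ψ).op Scheme.Spec
    rwa [isIso_op_iff] at h7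
  have h5 : Function.Bijective ψ := (ConcreteCategory.isIso_iff_bijective _).mp h4
  let _ := φ.toAlgebra
  let e : L ≃ₐ[A] Γ(X, W) := AlgEquiv.ofBijective
    { ψ with commutes' := fun a => congrArg (fun f => f a) hψφ } h5
  exact IsLocalization.isLocalization_of_algEquiv (Submonoid.powers b) e

theorem isOpenImmersion_toSpec {W : X.Opens} (hW : IsAffineOpen W) {φ : A →+* Γ(X, W)} {b : A}
    (h : IsAwayHom φ b) : IsOpenImmersion (toSpec W φ) := by
  let _ := φ.toAlgebra
  have h' : IsLocalization.Away b Γ(X, W) := h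
  have h1 : IsIso W.toSpecΓ := by
    rw [← hW.isoSpec_hom]; infer_instance
  have h2 : IsOpenImmersion (Spec.map (CommRingCat.ofHom φ)) :=
    IsOpenImmersion.of_isLocalization (R := A) (S := Γ(X, W)) b
  rw [toSpec]
  infer_instance

theorem range_toSpec {W : X.Opens} (hW : IsAffineOpen W) {φ : A →+* Γ(X, W)} {b : A}
    (h : IsAwayHom φ b) : Set.range (toSpec W φ) = basicSpec b := by
  let _ := φ.toAlgebra
  have h' : IsLocalization.Away b Γ(X, W) := h
  have h1 : IsIso W.toSpecΓ := by
    rw [← hW.isoSpec_hom]; infer_instance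
  have h4 : Set.range (Spec.map (CommRingCat.ofHom φ)) = basicSpec b :=
    PrimeSpectrum.localization_away_comap_range Γ(X, W) b
  rw [← h4, toSpec, Scheme.Hom.comp_base]
  simp only [TopCat.hom_comp, ContinuousMap.coe_comp]
  exact Function.Surjective.range_comp W.toSpecΓ.surjective _

/-- The partial isomorphism to `Spec A` given by an affine open set whose ring of functions is
`A[1/m]`. -/
def partialIsoOfAway (U : X.Opens) (hU : Dense (U : Set X)) (hU' : IsAffineOpen U)
    (φ : A →+* Γ(X, U)) (m : A) (hm : IsAwayHom φ m)
    (hm' : Dense (PrimeSpectrum.basicOpen m : Set (PrimeSpectrum A))) :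
    X.PartialIso (Spec (.of A)) :=
  haveI := isOpenImmersion_toSpec hU' hm
  { source := U
    dense_source := hU
    target := (toSpec U φ).opensRange
    dense_target := by rw [Scheme.Hom.coe_opensRange, range_toSpec hU' hm]; exact hm'
    iso := (toSpec U φ).isoOpensRange }

section

variable {U : X.Opens} {hU : Dense (U : Set X)} {hU' : IsAffineOpen U}
    {φ : A →+* Γ(X, U)} {m : A} {hm : IsAwayHom φ m}
    {hm' : Dense (PrimeSpectrum.basicOpen m : Set (PrimeSpectrum A))}

theorem partialIsoOfAway_hom : (partialIsoOfAway U hU hU' φ m hm hm').iso.hom ≫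
    (partialIsoOfAway U hU hU' φ m hm hm').target.ι = toSpec U φ := by
  have := isOpenImmersion_toSpec hU' hm
  exact (toSpec U φ).isoOpensRange_hom_ι

theorem coordHom_partialIsoOfAway : coordHom (partialIsoOfAway U hU hU' φ m hm hm') = φ := by
  apply toSpec_injective
  rw [toSpec_coordHom]
  exact partialIsoOfAway_hom

end

theorem isOver_iff {k : Type u} [CommRing k] [Algebra k A] (j : X.PartialIso (Spec (.of A)))
    (s : X ⟶ Spec (.of k)) : j.IsOver s (specStr k A) ↔
      ∀ c, coordHom j (algebraMap k A c) = pullHom s j.source c := by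
  rw [Scheme.PartialIso.IsOver, ← Category.assoc, ← toSpec_coordHom, ← toSpec_pullHom, toSpec,
    Category.assoc, ← Spec.map_comp, ← CommRingCat.ofHom_comp]
  constructor
  · intro h c
    exact congrArg (fun f => f c) (toSpec_injective j.source h)
  · intro h
    exact congrArg (toSpec j.source) (RingHom.ext h)

/-- Sufficiently small basic opens of the affine scheme pull back to affine open sets. -/
theorem isAwayHom_coordHom (j : X.PartialIso (Spec (.of A))) (b : A)
    (hb : basicSpec b ≤ j.target) :
    IsAffineOpen (X.basicOpen (coordHom j b)) ∧
      IsAwayHom ((res (X.basicOpen_le (coordHom j b))).comp (coordHom j)) b := by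
  have h1 : toSpec (X.basicOpen (coordHom j b))
      ((res (X.basicOpen_le (coordHom j b))).comp (coordHom j)) =
      X.homOfLE (X.basicOpen_le _) ≫ j.iso.hom ≫ j.target.ι := by
    rw [toSpec_res, toSpec_coordHom]
  have h2 : IsOpenImmersion (toSpec (X.basicOpen (coordHom j b))
      ((res (X.basicOpen_le (coordHom j b))).comp (coordHom j))) := by
    rw [h1]; infer_instance
  refine isAwayHom_of_opensRange _ _ _ ?_
  have h3 := toSpec_preimage_basicSpec j.source (coordHom j) b
  rw [toSpec_coordHom] at h3
  have h4 : ∀ x, (toSpec (X.basicOpen (coordHom j b))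
      ((res (X.basicOpen_le (coordHom j b))).comp (coordHom j))) x =
      (j.iso.hom ≫ j.target.ι) (X.homOfLE (X.basicOpen_le (coordHom j b)) x) := fun x => by
    rw [h1]; rfl
  ext y
  simp only [SetLike.mem_coe, Scheme.Hom.mem_opensRange]
  constructor
  · rintro ⟨x, rfl⟩
    rw [h4]
    have hx : x.1 ∈ j.source.ι ''ᵁ ((j.iso.hom ≫ j.target.ι) ⁻¹ᵁ basicSpec b) := by
      rw [h3]; exact x.2
    obtain ⟨x', hx', hxx'⟩ := hx
    have : x' = X.homOfLE (X.basicOpen_le (coordHom j b)) x := by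
      apply j.source.ι.injective
      exact hxx'.trans (congrArg (fun f => f x) (X.homOfLE_ι _)).symm
    rw [← this]
    exact hx'
  · intro hy
    obtain ⟨x', rfl⟩ : ∃ x', (j.iso.hom ≫ j.target.ι) x' = y := by
      obtain ⟨x', hx'⟩ := j.iso.hom.surjective ⟨y, hb hy⟩
      exact ⟨x', congrArg j.target.ι hx'⟩
    have hx : j.source.ι x' ∈ X.basicOpen (coordHom j b) := by
      rw [← h3]
      exact ⟨x', hy, rfl⟩
    refine ⟨⟨_, hx⟩, (h4 ⟨_, hx⟩).trans (congrArg _ (j.source.ι.injective ?_))⟩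
    exact congrArg (fun f => f ⟨_, hx⟩) (X.homOfLE_ι (X.basicOpen_le (coordHom j b)))

theorem restrictSource_hom (f : X.PartialIso Y) (U : X.Opens) (hU : Dense (U : Set X))
    (hU' : U ≤ f.source) : (f.restrictSource U hU hU').iso.hom ≫
      (f.restrictSource U hU hU').target.ι = X.homOfLE hU' ≫ f.iso.hom ≫ f.target.ι := by
  change ((Scheme.Opens.isoOfLE hU').inv ≫ (f.iso.hom.isoImage (f.source.ι ⁻¹ᵁ U)).hom ≫
    (f.target.ι.isoImage (f.iso.hom ''ᵁ f.source.ι ⁻¹ᵁ U)).hom) ≫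
      (f.target.ι ''ᵁ f.iso.hom ''ᵁ f.source.ι ⁻¹ᵁ U).ι = _
  have : (Scheme.Opens.isoOfLE hU').inv ≫ (f.source.ι ⁻¹ᵁ U).ι = X.homOfLE hU' := by
    rw [← cancel_mono f.source.ι]
    simp
  rw [← this]
  simp

/-- Restricting the target of a partial isomorphism amounts to restricting the source of its
inverse, so compatibility is first known for inverses. This carries it over to the maps themselves.
-/
theorem hom_eq_of_inv_eq {f' f : X.PartialIso Y} (e : f'.source ≤ f.source)
    (e' : f'.target ≤ f.target)
    (h : f'.iso.inv ≫ f'.source.ι = Y.homOfLE e' ≫ f.iso.inv ≫ f.source.ι) :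
    f'.iso.hom ≫ f'.target.ι = X.homOfLE e ≫ f.iso.hom ≫ f.target.ι := by
  have h3 : X.homOfLE e = f'.iso.hom ≫ Y.homOfLE e' ≫ f.iso.inv := by
    rw [← cancel_mono f.source.ι, Category.assoc, Category.assoc, ← h, Iso.hom_inv_id_assoc]
    simp
  rw [h3]
  simp

theorem exists_trans'_hom {W : Scheme.{u}} {f f' : X.PartialIso Y} {g g' : Y.PartialIso W}
    (e : f'.target = g'.source) (hf : f'.source ≤ f.source) (hg : g'.source ≤ g.source)
    (h₁ : f'.iso.hom ≫ f'.target.ι = X.homOfLE hf ≫ f.iso.hom ≫ f.target.ι)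
    (h₂ : g'.iso.hom ≫ g'.target.ι = Y.homOfLE hg ≫ g.iso.hom ≫ g.target.ι) :
    ∃ v : (f'.trans' g' e).source.toScheme ⟶ g.source.toScheme,
      v ≫ g.source.ι = X.homOfLE hf ≫ f.iso.hom ≫ f.target.ι ∧
      (f'.trans' g' e).iso.hom ≫ (f'.trans' g' e).target.ι = v ≫ g.iso.hom ≫ g.target.ι := by
  have h₃ : (f'.iso.hom ≫ (Y.isoOfEq e).hom ≫ Y.homOfLE hg) ≫ g.source.ι =
      X.homOfLE hf ≫ f.iso.hom ≫ f.target.ι := by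
    rw [← h₁]
    simp
  have h₄ : (f'.iso.hom ≫ (Y.isoOfEq e).hom ≫ g'.iso.hom) ≫ g'.target.ι =
      (f'.iso.hom ≫ (Y.isoOfEq e).hom ≫ Y.homOfLE hg) ≫ g.iso.hom ≫ g.target.ι := by
    simp only [Category.assoc]
    rw [h₂]
  exact ⟨_, h₃, h₄⟩

theorem exists_trans_hom {W : Scheme.{u}} (f : X.PartialIso Y) (g : Y.PartialIso W) :
    ∃ (e : (f.trans g).source ≤ f.source) (v : (f.trans g).source.toScheme ⟶ g.source.toScheme),
      v ≫ g.source.ι = X.homOfLE e ≫ f.iso.hom ≫ f.target.ι ∧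
      (f.trans g).iso.hom ≫ (f.trans g).target.ι = v ≫ g.iso.hom ≫ g.target.ι := by
  have hd := f.dense_target.inter_of_isOpen_right g.dense_source g.source.2
  let D : Y.Opens := f.target ⊓ g.source
  have e : (f.restrictTarget D hd inf_le_left).source ≤ f.source := by
    rintro _ ⟨x, -, rfl⟩
    exact x.2
  exact ⟨e, exists_trans'_hom rfl e inf_le_right
    (hom_eq_of_inv_eq e inf_le_left (restrictSource_hom f.symm D hd inf_le_left))
    (restrictSource_hom g D hd inf_le_right)⟩

/-- On the common domain `g.symm` followed by `g` cancels. This is why the coordinates on the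
quotient can be computed before or after passing through the fibred surface. -/
theorem coordHom_trans_symm_trans {S : Scheme.{u}} (f : X.PartialIso (Spec (.of A)))
    (g : S.PartialIso (Spec (.of A))) :
    ∃ e : ((f.trans g.symm).trans g).source ≤ f.source,
      coordHom ((f.trans g.symm).trans g) = (res e).comp (coordHom f) := by
  obtain ⟨e₁, v₁, h₁, h₁'⟩ : ∃ (e : (f.trans g.symm).source ≤ f.source)
      (v : (f.trans g.symm).source.toScheme ⟶ g.target.toScheme),
      v ≫ g.target.ι = X.homOfLE e ≫ f.iso.hom ≫ f.target.ι ∧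
      (f.trans g.symm).iso.hom ≫ (f.trans g.symm).target.ι = v ≫ g.iso.inv ≫ g.source.ι :=
    exists_trans_hom f g.symm
  obtain ⟨e₂, v₂, h₂, h₂'⟩ := exists_trans_hom (f.trans g.symm) g
  refine ⟨e₂.trans e₁, toSpec_injective _ ?_⟩
  rw [toSpec_coordHom, toSpec_res, toSpec_coordHom, h₂']
  have h3 : v₂ = X.homOfLE e₂ ≫ v₁ ≫ g.iso.inv := by
    rw [← cancel_mono g.source.ι, h₂, h₁']
    simp
  rw [h3, ← X.homOfLE_homOfLE e₂ e₁]
  simp only [Category.assoc]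
  rw [← h₁, Iso.inv_hom_id_assoc]

end Functions

end UlmerVoloch

end

noncomputable section

namespace UlmerVoloch

attribute [local instance] MvPolynomial.gradedAlgebra

/-! ### Smooth schemes over a field, and the generic point of the projective line -/

section Smooth

variable {X : Scheme.{u}} {k : Type u} [Field k]

theorem smooth_pullHom (s : X ⟶ Spec (.of k)) [Smooth s] {U : X.Opens} (hU : IsAffineOpen U) :
    (pullHom s U).Smooth := by
  have h1 := Smooth.smooth_appLE (f := s) (isAffineOpen_top (Spec (.of k))) hU
    (show U ≤ s ⁻¹ᵁ ⊤ from by rw [Scheme.Hom.preimage_top]; exact le_top)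
  have h2 := RingHom.Smooth.respectsIso.2 _ (Scheme.ΓSpecIso (.of k)).symm.commRingCatIsoToRingEquiv h1
  exact h2

/-- Sections over affine open sets are smooth algebras over `k`, hence reduced, and the stalks are
localizations of them. -/
theorem isReduced_of_smooth (s : X ⟶ Spec (.of k)) [Smooth s] : IsReduced X := by
  have h : ∀ U : X.Opens, IsAffineOpen U → _root_.IsReduced Γ(X, U) := by
    intro U hU
    let _ := (pullHom s U).toAlgebra
    have : Algebra.Smooth k Γ(X, U) := smooth_pullHom s hU
    exact Algebra.Smooth.isReduced_of_field k _
  refine @isReduced_of_isReduced_stalk X fun x => ?_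
  obtain ⟨U, hU, hx, -⟩ := exists_isAffineOpen_mem_and_subset (U := ⊤) (x := x) trivial
  have := h U hU
  let _ := (X.presheaf.germ U x hx).hom.toAlgebra
  have h1 : IsLocalization.AtPrime (X.presheaf.stalk x) (hU.primeIdealOf ⟨x, hx⟩).asIdeal :=
    hU.isLocalization_stalk ⟨x, hx⟩
  exact isReduced_localizationPreserves (hU.primeIdealOf ⟨x, hx⟩).asIdeal.primeCompl
    (X.presheaf.stalk x) this

theorem finiteType_pullHom (s : X ⟶ Spec (.of k)) [Smooth s] {U : X.Opens} (hU : IsAffineOpen U) :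
    (pullHom s U).FiniteType :=
  RingHom.FiniteType.of_finitePresentation (smooth_pullHom s hU).finitePresentation

end Smooth

section GenericPoint

variable (k : Type u) [Field k]

open Polynomial

/-- The constants in the coordinate ring of the chart of the projective line. -/
def chartC : k →+* ChartRing k :=
  (HomogeneousLocalization.fromZeroRingHom (MvPolynomial.homogeneousSubmodule (Fin (1 + 1)) k) _).comp
    (algebraMap k (MvPolynomial.homogeneousSubmodule (Fin (1 + 1)) k 0))

theorem chartToRatFunc_of_val (x : ChartRing k) (a : MvPolynomial (Fin (1 + 1)) k)
    (s : Submonoid.powers (MvPolynomial.X 1 : MvPolynomial (Fin (1 + 1)) k))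
    (hx : x.val = Localization.mk a s) :
    chartToRatFunc k x = MvPolynomial.aeval ![(RatFunc.X : RatFunc k), 1] a := by
  have h1 : chartToRatFunc k x = IsLocalization.Away.lift
      (S := Localization.Away (MvPolynomial.X 1 : MvPolynomial (Fin (1 + 1)) k))
      (MvPolynomial.X 1) (g := (MvPolynomial.aeval (R := k) ![(RatFunc.X : RatFunc k), 1]).toRingHom)
      (by simp) x.val := rfl
  obtain ⟨_, n, rfl⟩ := s
  rw [h1, hx, Localization.mk_eq_mk']
  refine (IsLocalization.lift_mk'_spec (v := MvPolynomial.aeval ![(RatFunc.X : RatFunc k), 1] a)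
    _ _ _).mpr ?_
  simp

theorem chartToRatFunc_mk (n : ℕ) (a : MvPolynomial (Fin (1 + 1)) k)
    (ha : a ∈ MvPolynomial.homogeneousSubmodule (Fin (1 + 1)) k (n • 1)) :
    chartToRatFunc k (HomogeneousLocalization.Away.mk _
      ((MvPolynomial.mem_homogeneousSubmodule _ _).mpr (MvPolynomial.isHomogeneous_X k 1)) n a ha) =
      MvPolynomial.aeval ![(RatFunc.X : RatFunc k), 1] a :=
  chartToRatFunc_of_val k _ a _ (HomogeneousLocalization.Away.val_mk _ n _ a ha)

theorem chartToRatFunc_chartC (c : k) : chartToRatFunc k (chartC k c) = algebraMap k _ c := by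
  rw [chartToRatFunc_of_val k (chartC k c) (algebraMap k _ c) 1 rfl, AlgHom.commutes]

variable {k} in
-- In a form of degree `n` the exponent of `X 0` determines that of `X 1`, so setting `X 1 = 1`
-- cannot merge two monomials.
theorem eq_zero_of_aeval_eq_zero {n : ℕ} {a : MvPolynomial (Fin (1 + 1)) k} (ha : a.IsHomogeneous n)
    (h : MvPolynomial.aeval ![(X : k[X]), 1] a = 0) : a = 0 := by
  ext s
  rw [MvPolynomial.coeff_zero]
  by_contra hs
  have h1 := congrArg (fun p => coeff p (s 0)) h
  simp only [MvPolynomial.aeval_def, MvPolynomial.eval₂_eq', finsetSum_coeff, coeff_zero] at h1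
  rw [Finset.sum_eq_single s] at h1
  · simp [Fin.prod_univ_two] at h1
    exact hs h1
  · intro t ht hts
    have h2 : t 0 + t 1 = n := by
      have := ha (MvPolynomial.mem_support_iff.mp ht)
      rwa [Finsupp.weight_apply, Finsupp.sum_fintype _ _ (by simp), Fin.sum_univ_two, Pi.one_apply,
        Pi.one_apply, smul_eq_mul, smul_eq_mul, mul_one, mul_one] at this
    have h3 : s 0 + s 1 = n := by
      have := ha hs
      rwa [Finsupp.weight_apply, Finsupp.sum_fintype _ _ (by simp), Fin.sum_univ_two, Pi.one_apply,
        Pi.one_apply, smul_eq_mul, smul_eq_mul, mul_one, mul_one] at this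
    have h4 : s 0 ≠ t 0 := by
      intro h4
      apply hts
      ext j
      fin_cases j
      · exact h4.symm
      · change t 1 = s 1
        omega
    simp [Fin.prod_univ_two, coeff_X_pow, h4]
  · intro hs'
    exact absurd (MvPolynomial.notMem_support_iff.mp hs') hs

theorem chartToRatFunc_injective : Function.Injective (chartToRatFunc k) := by
  rw [injective_iff_map_eq_zero]
  intro x hx
  obtain ⟨n, a, ha, rfl⟩ := HomogeneousLocalization.Away.mk_surjective _
    ((MvPolynomial.mem_homogeneousSubmodule _ _).mpr (MvPolynomial.isHomogeneous_X k 1)) x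
  rw [chartToRatFunc_mk] at hx
  have h0 : a = 0 := by
    refine eq_zero_of_aeval_eq_zero ((MvPolynomial.mem_homogeneousSubmodule _ _).mp ha) ?_
    apply IsFractionRing.injective k[X] (RatFunc k)
    rw [map_zero, ← hx, ← MvPolynomial.aeval_algebraMap_apply]
    congr 2
    ext j
    fin_cases j <;> simp
  subst h0
  apply HomogeneousLocalization.val_injective
  rw [HomogeneousLocalization.Away.val_mk, HomogeneousLocalization.val_zero, Localization.mk_zero]

theorem exists_chartToRatFunc_eq (p : k[X]) : ∃ c, chartToRatFunc k c = algebraMap _ _ p := by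
  have hT : ∃ c, chartToRatFunc k c = RatFunc.X := by
    refine ⟨HomogeneousLocalization.Away.mk _ ((MvPolynomial.mem_homogeneousSubmodule _ _).mpr
      (MvPolynomial.isHomogeneous_X k 1)) 1 (MvPolynomial.X 0)
      ((MvPolynomial.mem_homogeneousSubmodule _ _).mpr (MvPolynomial.isHomogeneous_X k 0)), ?_⟩
    rw [chartToRatFunc_mk]
    simp
  obtain ⟨c, hc⟩ := hT
  refine ⟨p.eval₂ (chartC k) c, ?_⟩
  have h1 : (chartToRatFunc k).comp (chartC k) = algebraMap k (RatFunc k) :=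
    RingHom.ext (chartToRatFunc_chartC k)
  rw [hom_eval₂, hc, ← RatFunc.algebraMap_X, h1, ← aeval_def, aeval_algebraMap_apply, aeval_X_left,
    AlgHom.id_apply]

/-- `k(t)` is the fraction field of the chart ring; the spectrum of a localization is a
preimmersion, and the chart is open. -/
theorem isPreimmersion_genericPointP1 : IsPreimmersion (genericPointP1 k) := by
  let _ := (chartToRatFunc k).toAlgebra
  have : IsFractionRing (ChartRing k) (RatFunc k) := by
    have hinj := chartToRatFunc_injective k
    have : IsDomain (ChartRing k) := hinj.isDomain
    have : FaithfulSMul (ChartRing k) (RatFunc k) :=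
      (faithfulSMul_iff_algebraMap_injective _ _).mpr hinj
    refine IsFractionRing.of_field _ _ fun z => ?_
    obtain ⟨p, hp⟩ := exists_chartToRatFunc_eq k z.num
    obtain ⟨q, hq⟩ := exists_chartToRatFunc_eq k z.denom
    refine ⟨p, q, ?_⟩
    change z = chartToRatFunc k p / chartToRatFunc k q
    rw [hp, hq, RatFunc.num_div_denom]
  have h1 : IsPreimmersion (Spec.map (CommRingCat.ofHom (chartToRatFunc k))) :=
    IsPreimmersion.of_isLocalization (R := ChartRing k) (S := RatFunc k) (nonZeroDivisors (ChartRing k))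
  rw [genericPointP1]
  infer_instance

theorem genericPointP1_str : genericPointP1 k ≫ ProjSpace.str 1 k = specStr k (RatFunc k) := by
  rw [genericPointP1, ProjSpace.str, Category.assoc, Proj.awayι_toSpecZero_assoc, ← Spec.map_comp,
    ← Spec.map_comp, ← CommRingCat.ofHom_comp, ← CommRingCat.ofHom_comp]
  congr 2
  exact RingHom.ext (chartToRatFunc_chartC k)

/-- A point specializing to one in the chart lies in the chart. There the generic point is the zero
ideal, and no other prime is contained in it. -/
theorem eq_genericPointP1_of_specializes (y : ProjSpace 1 k) (x : Spec (.of (RatFunc k)))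
    (h : y ⤳ genericPointP1 k x) : y = genericPointP1 k x := by
  let j := Proj.awayι (MvPolynomial.homogeneousSubmodule (Fin (1 + 1)) k) (MvPolynomial.X 1)
      (m := 1) ((MvPolynomial.mem_homogeneousSubmodule _ _).mpr (MvPolynomial.isHomogeneous_X k 1))
      one_pos
  let x' := Spec.map (CommRingCat.ofHom (chartToRatFunc k)) x
  have hx' : genericPointP1 k x = j x' := rfl
  rw [hx'] at h ⊢
  obtain ⟨y', rfl⟩ : y ∈ j.opensRange := h.mem_open j.opensRange.2 ⟨x', rfl⟩
  congr 1
  rw [j.isOpenEmbedding.isInducing.specializes_iff] at h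
  have h1 : x'.asIdeal = ⊥ := by
    have h2 : x.asIdeal = ⊥ :=
      Ideal.eq_bot_of_prime (K := RatFunc k) (h := PrimeSpectrum.isPrime x) _
    change Ideal.comap (chartToRatFunc k) x.asIdeal = ⊥
    rw [h2]
    exact (RingHom.injective_iff_ker_eq_bot _).mp (chartToRatFunc_injective k)
  have h3 : y'.asIdeal ≤ x'.asIdeal := (PrimeSpectrum.le_iff_specializes y' x').mpr h
  rw [h1, le_bot_iff] at h3
  exact PrimeSpectrum.ext (h3.trans h1.symm)

end GenericPoint

end UlmerVoloch

end

noncomputable section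

namespace UlmerVoloch

/-! ### Birational models of an integral scheme -/

section Birational

variable {S : Scheme.{u}} {k : Type u} [Field k]

/-- An integral domain, of finite type over `k`, whose field of fractions is the function field
of a smooth integral scheme is the coordinate ring of a birational model. -/
theorem exists_partialIso_of_functionField [IsIntegral S] (s : S ⟶ Spec (.of k)) [Smooth s]
    {R : Type u} [CommRing R] [Algebra k R] [Algebra.FiniteType k R]
    (ψ : R →+* S.functionField) (hinj : Function.Injective ψ)
    (hfrac : ∀ z, ∃ a b, ψ b ≠ 0 ∧ z * ψ b = ψ a)
    (hk : ∀ (U : S.Opens) (hU : genericPoint S ∈ U) (c : k),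
      ψ (algebraMap k R c) = S.presheaf.germ U (genericPoint S) hU (pullHom s U c)) :
    ∃ e : S.PartialIso (Spec (.of R)), e.IsOver s (specStr k R) ∧
      ∀ (h : genericPoint S ∈ e.source) (a : R),
        S.presheaf.germ e.source (genericPoint S) h (coordHom e a) = ψ a := by
  obtain ⟨U, hU, hη, -⟩ :=
    exists_isAffineOpen_mem_and_subset (U := ⊤) (x := genericPoint S) trivial
  have : Nonempty U := ⟨⟨_, hη⟩⟩
  let _ : Algebra k Γ(S, U) := (pullHom s U).toAlgebra
  let _ : Algebra R S.functionField := ψ.toAlgebra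
  let _ : Algebra k S.functionField := (ψ.comp (algebraMap k R)).toAlgebra
  have : IsScalarTower k R S.functionField := IsScalarTower.of_algebraMap_eq fun _ => rfl
  have : IsScalarTower k Γ(S, U) S.functionField := IsScalarTower.of_algebraMap_eq fun c => hk U hη c
  have : IsDomain R := hinj.isDomain
  have : FaithfulSMul R S.functionField := (faithfulSMul_iff_algebraMap_injective _ _).mpr hinj
  have : IsFractionRing R S.functionField := by
    refine IsFractionRing.of_field _ _ fun z => ?_
    obtain ⟨a, b, hb, h⟩ := hfrac z
    exact ⟨a, b, (eq_div_of_mul_eq hb h)⟩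
  have : IsFractionRing Γ(S, U) S.functionField := functionField_isFractionRing_of_isAffineOpen S U hU
  have : Algebra.FiniteType k Γ(S, U) := finiteType_pullHom s hU
  -- `Γ(S, U)` and `R` become the same subring of the function field after inverting `v` and `m`.
  -- The birational map identifies `D(v)` in `S` with `D(m)` in `Spec R`.
  obtain ⟨v, m, hv, hm, heq⟩ := exists_awaySubalgebra_eq k Γ(S, U) R S.functionField
  have hv' : algebraMap Γ(S, U) S.functionField v ≠ 0 := by
    rwa [Ne, map_eq_zero_iff _ (IsFractionRing.injective _ _)]
  have hm' : ψ m ≠ 0 := by rwa [Ne, map_eq_zero_iff _ hinj]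
  have hηv : genericPoint S ∈ S.basicOpen v := by
    rw [Scheme.mem_basicOpen S v _ hη]
    exact isUnit_iff_ne_zero.mpr hv'
  let γ : Γ(S, S.basicOpen v) →+* S.functionField := (S.presheaf.germ _ (genericPoint S) hηv).hom
  have hγ : Function.Injective γ := germ_injective_of_isIntegral S _ hηv
  have hγU : ∀ a : Γ(S, U), γ (res (S.basicOpen_le v) a) = algebraMap Γ(S, U) S.functionField a :=
    fun a => S.presheaf.germ_res_apply (homOfLE (S.basicOpen_le v)) _ hηv a
  have hloc : IsLocalization.Away v Γ(S, S.basicOpen v) := hU.isLocalization_basicOpen v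
  have hγv : IsUnit (res (S.basicOpen_le v) v) := IsLocalization.Away.algebraMap_isUnit (S := Γ(S, S.basicOpen v)) v
  -- Taking germs identifies the functions on `D(v)` with `Γ(S, U)[1 / v]`, and therefore with `R[1
  -- / m]`.
  have hrange : ∀ z, z ∈ γ.range ↔ z ∈ awaySubalgebra k (L := S.functionField) v := by
    intro z
    rw [mem_awaySubalgebra_iff hv']
    constructor
    · rintro ⟨b, rfl⟩
      obtain ⟨n, a, h⟩ := IsLocalization.Away.surj v b
      refine ⟨a, n, ?_⟩
      rw [← hγU, ← hγU, ← map_pow, ← map_mul]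
      exact congrArg γ h
    · rintro ⟨a, n, h⟩
      obtain ⟨w, hw⟩ := hγv.exists_right_inv
      refine ⟨res (S.basicOpen_le v) a * w ^ n, ?_⟩
      rw [map_mul, hγU, ← h, ← hγU v, map_pow, mul_assoc, ← mul_pow, ← map_mul, hw, map_one, one_pow,
        mul_one]
  have hmem : ∀ a, ψ a ∈ γ.range := fun a => by
    rw [hrange, heq]; exact algebraMap_mem_awaySubalgebra m a
  let φ : R →+* Γ(S, S.basicOpen v) :=
    ((RingEquiv.ofBijective γ.rangeRestrict
      ⟨fun a b h => hγ (congrArg Subtype.val h), γ.rangeRestrict_surjective⟩).symm.toRingHom).comp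
        (ψ.codRestrict γ.range hmem)
  have hφ : ∀ a, γ (φ a) = ψ a := fun a => congrArg Subtype.val
    (RingEquiv.apply_symm_apply (RingEquiv.ofBijective γ.rangeRestrict
      ⟨fun a b h => hγ (congrArg Subtype.val h), γ.rangeRestrict_surjective⟩) (ψ.codRestrict γ.range hmem a))
  have haway : IsAwayHom φ m := by
    rw [isAwayHom_iff]
    refine ⟨?_, fun b => ?_, fun a ha => ⟨0, ?_⟩⟩
    · obtain ⟨w, hw⟩ := (hrange (ψ m)⁻¹).mpr (heq ▸ inv_mem_awaySubalgebra (k := k) m)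
      refine IsUnit.of_mul_eq_one w (hγ ?_)
      rw [map_mul, hφ, hw, mul_inv_cancel₀ hm', map_one]
    · obtain ⟨a, n, h⟩ := (mem_awaySubalgebra_iff (k := k) hm').mp (heq ▸ (hrange (γ b)).mp ⟨b, rfl⟩)
      refine ⟨a, n, hγ ?_⟩
      rw [map_mul, map_pow, hφ, hφ]
      exact h
    · rw [pow_zero, one_mul]
      apply hinj
      rw [← hφ, ha, map_zero, map_zero]
  have hdense : Dense (S.basicOpen v : Set S) := (S.basicOpen v).2.dense ⟨_, hηv⟩
  have hdense' : Dense (PrimeSpectrum.basicOpen m : Set (PrimeSpectrum R)) := by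
    refine (PrimeSpectrum.basicOpen m).2.dense ⟨⊥, ?_⟩
    change m ∉ (⊥ : Ideal R)
    exact hm
  refine ⟨partialIsoOfAway (S.basicOpen v) hdense (hU.basicOpen v) φ m haway hdense', ?_, ?_⟩
  · rw [isOver_iff]
    intro c
    rw [coordHom_partialIsoOfAway]
    exact hγ ((hφ _).trans (hk _ hηv c))
  · intro h a
    rw [coordHom_partialIsoOfAway]
    exact hφ a

end Birational

end UlmerVoloch

end

noncomputable section

namespace UlmerVoloch

/-! ### Function fields read through a birational chart -/

section CoordInjective

variable {X : Scheme.{u}} {A : Type u} [CommRing A]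

/-- A nonzero `a` is not nilpotent, so `D(a)` is nonempty and meets the dense target of `j`. Its
preimage is the locus where the function induced by `a` is invertible, so this function is not zero.
-/
theorem coordHom_injective (j : X.PartialIso (Spec (.of A))) [_root_.IsReduced A] :
    Function.Injective (coordHom j) := by
  rw [injective_iff_map_eq_zero]
  intro a ha
  by_contra ha0
  have h1 : (basicSpec a : Set (Spec (.of A))).Nonempty := by
    by_contra h
    rw [Set.not_nonempty_iff_eq_empty] at h
    have h2 : PrimeSpectrum.basicOpen a = ⊥ := TopologicalSpace.Opens.ext h
    exact ha0 (isNilpotent_iff_eq_zero.mp ((PrimeSpectrum.basicOpen_eq_bot_iff a).mp h2))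
  obtain ⟨y, hy, hyt⟩ := j.dense_target.inter_open_nonempty _ (basicSpec a).2 h1
  obtain ⟨x, hx⟩ := j.iso.hom.surjective ⟨y, hyt⟩
  have h3 := toSpec_preimage_basicSpec j.source (coordHom j) a
  rw [toSpec_coordHom, ha, Scheme.basicOpen_zero] at h3
  have h4 : j.source.ι x ∈ j.source.ι ''ᵁ ((j.iso.hom ≫ j.target.ι) ⁻¹ᵁ basicSpec a) := by
    refine ⟨x, ?_, rfl⟩
    have h5 : (j.iso.hom ≫ j.target.ι) x = y := congrArg j.target.ι hx
    change (j.iso.hom ≫ j.target.ι) x ∈ basicSpec a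
    rw [h5]
    exact hy
  rw [h3] at h4
  exact h4

theorem exists_basicSpec_le (O : (Spec (.of A)).Opens) (hO : Dense (O : Set (Spec (.of A))))
    [Nontrivial A] : ∃ b : A, (basicSpec b : Set (Spec (.of A))).Nonempty ∧ basicSpec b ≤ O := by
  have : Nonempty (Spec (.of A)) := inferInstanceAs (Nonempty (PrimeSpectrum A))
  obtain ⟨y, hy⟩ := hO.nonempty
  obtain ⟨_, ⟨b, rfl⟩, hyb, hb⟩ := PrimeSpectrum.isTopologicalBasis_basic_opens.exists_subset_of_mem_open
    (show y ∈ O.carrier from hy) O.2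
  exact ⟨b, ⟨y, hyb⟩, hb⟩

theorem nonempty_of_partialIso (j : X.PartialIso (Spec (.of A))) [Nontrivial A] : Nonempty X := by
  have : Nonempty (Spec (.of A)) := inferInstanceAs (Nonempty (PrimeSpectrum A))
  obtain ⟨y, hy⟩ := j.dense_target.nonempty
  exact ⟨j.source.ι (j.iso.inv ⟨y, hy⟩)⟩

theorem genericPoint_mem_of_dense [IrreducibleSpace X] {U : X.Opens} (hU : Dense (U : Set X)) :
    genericPoint X ∈ U :=
  ((genericPoint_spec X).mem_open_set_iff U.2).mpr (by
    rw [Set.univ_inter]; exact hU.nonempty)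

/-- The function field of an integral scheme which is birational to `Spec A` is the field of
fractions of `A`. -/
theorem exists_germ_coordHom_eq [IsIntegral X] [_root_.IsReduced A] [Nontrivial A]
    (j : X.PartialIso (Spec (.of A)))
    (hη : genericPoint X ∈ j.source) (z : X.functionField) :
    ∃ a b : A, b ≠ 0 ∧ z * X.presheaf.germ j.source (genericPoint X) hη (coordHom j b) =
      X.presheaf.germ j.source (genericPoint X) hη (coordHom j a) := by
  obtain ⟨m, hm, hmj⟩ := exists_basicSpec_le j.target j.dense_target
  have hm0 : m ≠ 0 := by
    rintro rfl
    obtain ⟨y, hy⟩ := hm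
    exact hy (zero_mem _)
  obtain ⟨h1, h2⟩ := isAwayHom_coordHom j m hmj
  set W := X.basicOpen (coordHom j m) with hW
  have hinj : Function.Injective (X.presheaf.germ j.source (genericPoint X) hη) :=
    germ_injective_of_isIntegral X _ hη
  let g := (X.presheaf.germ j.source (genericPoint X) hη).hom.comp (coordHom j)
  have hg : Function.Injective g := hinj.comp (coordHom_injective j)
  have hηW : genericPoint X ∈ W := by
    rw [hW, Scheme.mem_basicOpen X _ _ hη]
    refine isUnit_iff_ne_zero.mpr fun h => hm0 (hg ?_)
    rw [map_zero]
    exact h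
  have : Nonempty W := ⟨⟨_, hηW⟩⟩
  have hfr : IsFractionRing Γ(X, W) X.functionField := functionField_isFractionRing_of_isAffineOpen X W h1
  obtain ⟨p, q, hq, hpq⟩ := IsFractionRing.div_surjective (A := Γ(X, W)) z
  obtain ⟨hmu, hs, -⟩ := (isAwayHom_iff _ _).mp h2
  obtain ⟨a, n, ha⟩ := hs p
  obtain ⟨b, l, hb⟩ := hs q
  let γ := (X.presheaf.germ W (genericPoint X) hηW).hom
  have hγ : Function.Injective γ := germ_injective_of_isIntegral X _ hηW
  have hγg : ∀ c, γ (res (X.basicOpen_le _) (coordHom j c)) = g c := fun c =>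
    X.presheaf.germ_res_apply (homOfLE (X.basicOpen_le _)) _ hηW _
  replace ha := congrArg γ ha
  replace hb := congrArg γ hb
  simp only [RingHom.comp_apply, map_mul, map_pow] at ha hb
  rw [hγg] at ha hb
  rw [hγg] at ha hb
  have hq0 : γ q ≠ 0 := by
    rw [Ne, map_eq_zero_iff _ hγ]
    exact nonZeroDivisors.ne_zero hq
  have hgm : g m ≠ 0 := by rwa [Ne, map_eq_zero_iff _ hg]
  have hz : z * γ q = γ p := by
    rw [← hpq]
    exact div_mul_cancel₀ _ hq0
  -- From `p m ^ n = a` and `q m ^ l = b`, the fraction `p / q` equals `a m ^ l / (b m ^ n)`.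
  refine ⟨a * m ^ l, b * m ^ n, ?_, ?_⟩
  · intro h
    have : g (b * m ^ n) = 0 := by rw [h, map_zero]
    rw [map_mul, map_pow, ← hb] at this
    exact mul_ne_zero (mul_ne_zero hq0 (pow_ne_zero _ hgm)) (pow_ne_zero _ hgm) this
  · change z * g (b * m ^ n) = g (a * m ^ l)
    rw [map_mul, map_mul, map_pow, map_pow, ← ha, ← hb, ← hz]
    ring

end CoordInjective

/-! ### The generic fibre contains the generic point -/

section GenericFibre

variable {k : Type u} [Field k] {X S : Scheme.{u}} {sX : X ⟶ Spec (.of (RatFunc k))}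
  {f : S ⟶ ProjSpace 1 k} {ι : X ⟶ S}

theorem isPreimmersion_of_isPullback (hι : IsPullback ι sX f (genericPointP1 k)) : IsPreimmersion ι :=
  MorphismProperty.of_isPullback hι.flip (isPreimmersion_genericPointP1 k)

/-- The generic point of `S` specializes to a point of the fibre, so its image in `ℙ¹` specializes
to the generic point there and must equal it. It therefore lifts to the fibre product. -/
theorem exists_eq_genericPoint [IrreducibleSpace S] [Nonempty X]
    (hι : IsPullback ι sX f (genericPointP1 k)) : ∃ ξ, ι ξ = genericPoint S := by
  obtain ⟨ξ₀⟩ := ‹Nonempty X›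
  have h1 : genericPoint S ⤳ ι ξ₀ := (genericPoint_spec S).specializes trivial
  have h2 : f (genericPoint S) ⤳ f (ι ξ₀) := h1.map f.continuous
  have h3 : f (ι ξ₀) = genericPointP1 k (sX ξ₀) := congrArg (fun g => g ξ₀) hι.w
  rw [h3] at h2
  obtain ⟨ξ, hξ, -⟩ := Scheme.exists_preimage_of_isPullback hι (genericPoint S) (sX ξ₀)
    (eq_genericPointP1_of_specializes k _ _ h2)
  exact ⟨ξ, hξ⟩

theorem isGenericPoint_of_isPreimmersion [IrreducibleSpace S] [IsPreimmersion ι] {ξ : X}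
    (hξ : ι ξ = genericPoint S) : IsGenericPoint ξ ⊤ := by
  rw [isGenericPoint_def, ι.isEmbedding.isInducing.closure_eq_preimage_closure_image,
    Set.image_singleton, hξ, (genericPoint_spec S).def]
  rfl

theorem irreducibleSpace_of_isPreimmersion [IrreducibleSpace S] [IsPreimmersion ι] {ξ : X}
    (hξ : ι ξ = genericPoint S) : IrreducibleSpace X := by
  have h : IsIrreducible (Set.univ : Set X) := by
    have := (isGenericPoint_of_isPreimmersion hξ).isIrreducible
    exact this
  have := (irreducibleSpace_def X).mpr h
  exact this

/-- Surjectivity holds for every preimmersion; injectivity holds because the stalk of `S` at its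
generic point is a field. -/
theorem stalkMap_bijective [IsIntegral S] [IsIntegral X] [IsPreimmersion ι]
    (hξ : ι (genericPoint X) = genericPoint S) :
    Function.Bijective (ι.stalkMap (genericPoint X)) := by
  refine ⟨?_, ι.stalkMap_surjective _⟩
  have h1 : IsField (S.presheaf.stalk (ι (genericPoint X))) := by
    rw [hξ]
    exact Field.toIsField S.functionField
  let _ := h1.toField
  exact (ι.stalkMap (genericPoint X)).hom.injective

end GenericFibre

end UlmerVoloch

end

noncomputable section

namespace UlmerVoloch

/-! ### Birational coordinates on the fibred surface -/

section SurfaceModel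

variable {k : Type u} [Field k]

theorem exists_partialIso_of_stalk {S : Scheme.{u}} [IsIntegral S] (s : S ⟶ Spec (.of k)) [Smooth s]
    {R : Type u} [CommRing R] [Algebra k R] [Algebra.FiniteType k R]
    (η : S) (hη : η = genericPoint S)
    (ψ : R →+* S.presheaf.stalk η) (hinj : Function.Injective ψ)
    (hfrac : ∀ z, ∃ a b, ψ b ≠ 0 ∧ z * ψ b = ψ a)
    (hk : ∀ (U : S.Opens) (hU : η ∈ U) (c : k),
      ψ (algebraMap k R c) = S.presheaf.germ U η hU (pullHom s U c)) :
    ∃ e : S.PartialIso (Spec (.of R)), e.IsOver s (specStr k R) ∧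
      ∀ (h : η ∈ e.source) (a : R), S.presheaf.germ e.source η h (coordHom e a) = ψ a := by
  subst hη
  exact exists_partialIso_of_functionField s ψ hinj hfrac hk

/-- The ring is reduced, so it embeds in the functions on a nonempty open subset of an integral
scheme. Irreducibility of the equation is thus inherited from the model. -/
theorem isDomain_familyRing_of_partialIso {h : Polynomial k} {r : ℕ} (hr : (r : k) ≠ 0)
    (h0 : h.coeff 0 ≠ 0)
    {A : Type u} [CommRing A] [IsDomain A] [Algebra k A] (a : A) {X : Scheme.{u}} [IsIntegral X]
    (j : X.PartialIso (Spec (.of (FamilyRing h r A a)))) : IsDomain (FamilyRing h r A a) := by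
  have : _root_.IsReduced (FamilyRing h r A a) := FamilyRing.isReduced hr h0
  have : Nonempty j.source := by
    obtain ⟨x, hx⟩ := j.dense_source.nonempty
    exact ⟨⟨x, hx⟩⟩
  exact (coordHom_injective j).isDomain

/-- Clearing polynomials in `t` from a fraction `a / b` shows that the surface ring and the generic
ring have the same fraction field. -/
theorem SurfaceRing.exists_mul_toGeneric_eq {h : Polynomial k} {r d : ℕ}
    [IsDomain (GenericRing h r d)] (a : GenericRing h r d) {b : GenericRing h r d} (hb : b ≠ 0) :
    ∃ a' b' : SurfaceRing h r d, b' ≠ 0 ∧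
      a * SurfaceRing.toGeneric h r d b' = b * SurfaceRing.toGeneric h r d a' := by
  obtain ⟨p, c, hp, hc⟩ := SurfaceRing.exists_toGeneric_eq a
  obtain ⟨q, c', hq, hc'⟩ := SurfaceRing.exists_toGeneric_eq b
  have hne : ∀ p : Polynomial k, p ≠ 0 →
      SurfaceRing.toGeneric h r d (algebraMap (Polynomial k) _ p) ≠ 0 := by
    intro p hp
    rw [SurfaceRing.toGeneric_algebraMap, IsScalarTower.algebraMap_apply (Polynomial k) (RatFunc k),
      Ne, map_eq_zero_iff _ (RingHom.injective _)]
    exact (map_ne_zero_iff _ (IsFractionRing.injective (Polynomial k) (RatFunc k))).mpr hp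
  refine ⟨c * algebraMap _ _ q, c' * algebraMap _ _ p, fun h0 => ?_, ?_⟩
  · have h1 := congrArg (SurfaceRing.toGeneric h r d) h0
    rw [map_mul, hc', map_zero] at h1
    exact mul_ne_zero (mul_ne_zero hb (hne q hq)) (hne p hp) h1
  · rw [map_mul, map_mul, hc, hc']
    ring

/-- The function field of `S` is that of its generic fibre, hence the fraction field of the surface
ring, and `exists_partialIso_of_functionField` applies. The coordinates on `S` and on `X` agree on
an open set because they agree as germs at the generic point. -/
theorem exists_partialIso_surfaceRing {h : Polynomial k} {r d : ℕ} (hr : (r : k) ≠ 0)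
    (h0 : h.coeff 0 ≠ 0)
    {X : Scheme.{u}} (sX : X ⟶ Spec (.of (RatFunc k))) [Smooth sX]
    (jX : X.PartialIso (Spec (.of (GenericRing h r d))))
    (hjX : jX.IsOver sX (specStr (RatFunc k) (GenericRing h r d)))
    {S : Scheme.{u}} [IrreducibleSpace S] (sS : S ⟶ Spec (.of k)) [Smooth sS]
    (f : S ⟶ ProjSpace 1 k) (hf : f ≫ ProjSpace.str 1 k = sS)
    (ι : X ⟶ S) (hι : IsPullback ι sX f (genericPointP1 k)) [Nonempty X] :
    IsDomain (SurfaceRing h r d) ∧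
    ∃ e : S.PartialIso (Spec (.of (SurfaceRing h r d))),
      e.IsOver sS (specStr k (SurfaceRing h r d)) ∧
      ∃ (V : X.Opens) (_ : Dense (V : Set X)) (hVe : V ≤ ι ⁻¹ᵁ e.source) (hVj : V ≤ jX.source),
        ∀ a, (ι.appLE e.source V hVe).hom (coordHom e a) =
          res hVj (coordHom jX (SurfaceRing.toGeneric h r d a)) := by
  have hr0 : r ≠ 0 := by rintro rfl; simp at hr
  have : IsReduced X := isReduced_of_smooth sX
  have : IsReduced S := isReduced_of_smooth sS
  have : IsIntegral S := isIntegral_of_irreducibleSpace_of_isReduced S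
  have : IsPreimmersion ι := isPreimmersion_of_isPullback hι
  obtain ⟨ξ, hξ⟩ := exists_eq_genericPoint hι
  have : IrreducibleSpace X := irreducibleSpace_of_isPreimmersion hξ
  have : IsIntegral X := isIntegral_of_irreducibleSpace_of_isReduced X
  obtain rfl : ξ = genericPoint X :=
    (isGenericPoint_of_isPreimmersion hξ).eq (genericPoint_spec X)
  have hdom : IsDomain (GenericRing h r d) := isDomain_familyRing_of_partialIso hr h0 _ jX
  have hinj := SurfaceRing.toGeneric_injective (h := h) (d := d) hr0
  refine ⟨hinj.isDomain, ?_⟩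
  have hηj : genericPoint X ∈ jX.source := genericPoint_mem_of_dense jX.dense_source
  let g := (X.presheaf.germ jX.source (genericPoint X) hηj).hom.comp (coordHom jX)
  have hg : Function.Injective g :=
    (germ_injective_of_isIntegral X _ hηj).comp (coordHom_injective jX)
  -- `σ` identifies the function field of `S` with that of `X`; `ψ` carries the surface ring, seen
  -- through the coordinates of `X`, back to `S`.
  let σ := RingEquiv.ofBijective (ι.stalkMap (genericPoint X)).hom (stalkMap_bijective hξ)
  let ψ : SurfaceRing h r d →+* S.presheaf.stalk (ι (genericPoint X)) :=
    (σ.symm.toRingHom.comp g).comp (SurfaceRing.toGeneric h r d)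
  have hψ : ∀ a, σ (ψ a) = g (SurfaceRing.toGeneric h r d a) := fun a => σ.apply_symm_apply _
  have hσ : ∀ (U : S.Opens) (hU : ι (genericPoint X) ∈ U) (s : Γ(S, U)),
      σ (S.presheaf.germ U _ hU s) = X.presheaf.germ (ι ⁻¹ᵁ U) (genericPoint X) hU (ι.app U s) :=
    fun U hU s => Scheme.Hom.germ_stalkMap_apply ι U _ hU s
  have hfrac : ∀ z, ∃ a b, ψ b ≠ 0 ∧ z * ψ b = ψ a := by
    intro z
    obtain ⟨a, b, hb, hab⟩ := exists_germ_coordHom_eq jX hηj (σ z)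
    obtain ⟨a', b', hb', h⟩ := SurfaceRing.exists_mul_toGeneric_eq a hb
    refine ⟨a', b', ?_, ?_⟩
    · intro h1
      refine hb' (hinj (hg ?_))
      rw [← hψ, h1, map_zero, map_zero, map_zero]
    · apply σ.injective
      rw [map_mul, hψ, hψ]
      have hgb : g b ≠ 0 := (map_ne_zero_iff g hg).mpr hb
      apply mul_left_cancel₀ hgb
      rw [← map_mul, ← h, map_mul, mul_left_comm, ← mul_assoc]
      exact congrArg (· * _) hab
  have hk : ∀ (U : S.Opens) (hU : ι (genericPoint X) ∈ U) (c : k),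
      ψ (algebraMap k _ c) = S.presheaf.germ U _ hU (pullHom sS U c) := by
    intro U hU c
    apply σ.injective
    rw [hψ, hσ]
    have h1 : SurfaceRing.toGeneric h r d (algebraMap k _ c) =
        algebraMap (RatFunc k) _ (algebraMap k (RatFunc k) c) := by
      rw [IsScalarTower.algebraMap_apply k (Polynomial k) (SurfaceRing h r d),
        SurfaceRing.toGeneric_algebraMap, ← IsScalarTower.algebraMap_apply k (Polynomial k) (RatFunc k)]
    have h2 : ι.app U (pullHom sS U c) = pullHom (ι ≫ sS) (ι ⁻¹ᵁ U) c := by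
      rw [← appLE_pullHom ι sS (le_refl (ι ⁻¹ᵁ U)), Scheme.Hom.appLE_eq_app]
    have h3 : ι ≫ sS = sX ≫ specStr k (RatFunc k) := by
      rw [← hf, ← Category.assoc, hι.w, Category.assoc, genericPointP1_str]
    rw [h2, h1, h3, pullHom_comp_specMap]
    change X.presheaf.germ jX.source (genericPoint X) hηj (coordHom jX _) = _
    rw [(isOver_iff jX sX).mp hjX, ← res_pullHom sX (le_top : jX.source ≤ ⊤),
      ← res_pullHom sX (le_top : ι ⁻¹ᵁ U ≤ ⊤)]
    exact (X.presheaf.germ_res_apply (homOfLE le_top) _ hηj _).trans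
      (X.presheaf.germ_res_apply (homOfLE le_top) _ hU _).symm
  obtain ⟨e, he, hcoord⟩ := exists_partialIso_of_stalk sS (ι (genericPoint X)) hξ ψ
    (fun a b hab => hinj (hg (by rw [← hψ, hab, hψ]))) hfrac hk
  · have hηe : ι (genericPoint X) ∈ e.source := hξ ▸ genericPoint_mem_of_dense e.dense_source
    refine ⟨e, he, ι ⁻¹ᵁ e.source ⊓ jX.source, ?_, inf_le_left, inf_le_right, fun a => ?_⟩
    · exact (ι ⁻¹ᵁ e.source ⊓ jX.source).2.dense ⟨genericPoint X, hηe, hηj⟩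
    · have hηV : genericPoint X ∈ ι ⁻¹ᵁ e.source ⊓ jX.source := ⟨hηe, hηj⟩
      apply germ_injective_of_isIntegral X _ hηV
      have h1 : X.presheaf.germ (ι ⁻¹ᵁ e.source ⊓ jX.source) (genericPoint X) hηV
          (res inf_le_right (coordHom jX (SurfaceRing.toGeneric h r d a))) =
          g (SurfaceRing.toGeneric h r d a) :=
        X.presheaf.germ_res_apply (homOfLE inf_le_right) _ hηV _
      have h2 : X.presheaf.germ (ι ⁻¹ᵁ e.source ⊓ jX.source) (genericPoint X) hηV
          ((ι.appLE e.source (ι ⁻¹ᵁ e.source ⊓ jX.source) inf_le_left).hom (coordHom e a)) =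
          X.presheaf.germ (ι ⁻¹ᵁ e.source) (genericPoint X) hηe (ι.app e.source (coordHom e a)) :=
        X.presheaf.germ_res_apply (homOfLE inf_le_left) _ hηV _
      rw [h1, h2, ← hσ, hcoord hηe, hψ]

end SurfaceModel

end UlmerVoloch

end

noncomputable section

namespace UlmerVoloch

/-! ### Functions on fibre products over a field -/

section Pushout

open TensorProduct

theorem exists_equiv_of_isPushout {k A A' B : Type u} [CommRing k] [CommRing A] [CommRing A']
    [CommRing B] [Algebra k A] [Algebra k A'] {f : A →+* B} {f' : A' →+* B}
    (h : IsPushout (CommRingCat.ofHom (algebraMap k A)) (CommRingCat.ofHom (algebraMap k A'))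
      (CommRingCat.ofHom f) (CommRingCat.ofHom f')) :
    ∃ e : A ⊗[k] A' ≃+* B, ∀ a a', e (a ⊗ₜ a') = f a * f' a' := by
  let i := (CommRingCat.isPushout_tensorProduct k A A').isoIsPushout _ _ h
  have hl : ∀ a : A, i.hom.hom (a ⊗ₜ 1) = f a := fun a =>
    congrArg (fun φ => φ.hom a)
      ((CommRingCat.isPushout_tensorProduct k A A').inl_isoIsPushout_hom _ _ h)
  have hr : ∀ a : A', i.hom.hom (1 ⊗ₜ a) = f' a := fun a =>
    congrArg (fun φ => φ.hom a)
      ((CommRingCat.isPushout_tensorProduct k A A').inr_isoIsPushout_hom _ _ h)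
  refine ⟨i.commRingCatIsoToRingEquiv, fun a a' => ?_⟩
  rw [← hl, ← hr, ← map_mul, Algebra.TensorProduct.tmul_mul_tmul, one_mul, mul_one]
  rfl

/-- A linear retraction of a field extension, extended to the base changes of two algebras. -/
theorem exists_descent {k K A A' : Type u} [Field k] [Field K] [CommRing A]
    [CommRing A'] [Algebra k K] [Algebra k A] {f : A →+* A'} {f' : K →+* A'}
    (hA : IsPushout (CommRingCat.ofHom (algebraMap k A)) (CommRingCat.ofHom (algebraMap k K))
      (CommRingCat.ofHom f) (CommRingCat.ofHom f')) (α : A') :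
    ∃ a : A, ∀ {B B' : Type u} [CommRing B] [CommRing B'] [Algebra k B] (g : B →+* B') (g' : K →+* B')
      (_ : IsPushout (CommRingCat.ofHom (algebraMap k B)) (CommRingCat.ofHom (algebraMap k K))
        (CommRingCat.ofHom g) (CommRingCat.ofHom g')) (p : A →ₐ[k] B) (p' : A' →+* B')
      (_ : ∀ a, p' (f a) = g (p a)) (_ : ∀ x, p' (f' x) = g' x) (β : B), p' α = g β → p a = β := by
  -- The element `a` is the image of `α` under `id ⊗ ρ`, where `ρ : K → k` is a `k`-linear
  -- retraction. This map is only linear, but it is natural in the algebra and sends `β ⊗ 1` to `β`.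
  -- As `a` is chosen before `B`, one `a` serves all members of an open covering.
  obtain ⟨ρ, hρ⟩ := (Algebra.linearMap k K).exists_leftInverse_of_injective
    (LinearMap.ker_eq_bot.mpr (algebraMap k K).injective)
  have hρ1 : ρ 1 = 1 := by simpa using LinearMap.congr_fun hρ 1
  obtain ⟨e, he⟩ := exists_equiv_of_isPushout hA
  obtain ⟨τ, rfl⟩ := e.surjective α
  refine ⟨TensorProduct.rid k A (ρ.lTensor A τ), fun {B B'} _ _ _ g g' hB p p' hp hp' β hβ => ?_⟩
  obtain ⟨e', he'⟩ := exists_equiv_of_isPushout hB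
  have h1 : ∀ τ, p' (e τ) = e' (p.toLinearMap.rTensor K τ) := by
    intro τ
    induction τ with
    | zero => simp
    | add x y hx hy => rw [map_add, map_add, map_add, map_add, hx, hy]
    | tmul x y => rw [LinearMap.rTensor_tmul, he, he', map_mul, hp, hp']; rfl
  have h2 : ∀ τ, p (TensorProduct.rid k A (ρ.lTensor A τ)) =
      TensorProduct.rid k B (ρ.lTensor B (p.toLinearMap.rTensor K τ)) := by
    intro τ
    induction τ with
    | zero => simp
    | add x y hx hy => simp only [map_add, hx, hy]
    | tmul x y => simp
  have h3 : e' (β ⊗ₜ 1) = g β := by rw [he', map_one, mul_one]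
  rw [h1, ← h3] at hβ
  rw [h2, e'.injective hβ, LinearMap.lTensor_tmul, hρ1]
  simp

theorem injective_of_isPushout {k K A A' : Type u} [Field k] [Field K] [CommRing A]
    [CommRing A'] [Algebra k K] [Algebra k A] {f : A →+* A'} {f' : K →+* A'}
    (hA : IsPushout (CommRingCat.ofHom (algebraMap k A)) (CommRingCat.ofHom (algebraMap k K))
      (CommRingCat.ofHom f) (CommRingCat.ofHom f')) : Function.Injective f := by
  obtain ⟨e, he⟩ := exists_equiv_of_isPushout hA
  have h : ∀ a, f a = e (a ⊗ₜ 1) := fun a => by rw [he, map_one, mul_one]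
  intro a b hab
  rw [h, h] at hab
  exact Algebra.TensorProduct.includeLeft_injective (R := k) (S := k) (A := A) (B := K)
    (algebraMap k K).injective (e.injective hab)

variable {k : Type u} [Field k] {X Y T : Scheme.{u}} {iX : X ⟶ Spec (.of k)}

/-- The functions on a product of affine open sets of schemes over a field. -/
theorem isPushout_sections {f : T ⟶ Spec (.of k)} {g : Y ⟶ X} {iY : Y ⟶ T}
    (H : IsPullback g iY iX f) {U : X.Opens} {U' : T.Opens} (hU : IsAffineOpen U)
    (hU' : IsAffineOpen U') {UY : Y.Opens} (hUY : UY = g ⁻¹ᵁ U ⊓ iY ⁻¹ᵁ U') :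
    IsPushout (pullCat iX U) (pullCat f U') (g.appLE U UY (hUY.le.trans inf_le_left))
      (iY.appLE U' UY (hUY.le.trans inf_le_right)) := by
  have e1 : U' ≤ f ⁻¹ᵁ ⊤ := by rw [Scheme.Hom.preimage_top]; exact le_top
  have e2 : U ≤ iX ⁻¹ᵁ ⊤ := by rw [Scheme.Hom.preimage_top]; exact le_top
  have h1 := (isIso_pushoutSection_iff H e1 e2 hUY).mp
    (isIso_pushoutSection_of_isAffineOpen H e1 e2 hUY (isAffineOpen_top _) hU' hU)
  exact h1.of_iso (Scheme.ΓSpecIso (.of k)) (.refl _) (.refl _) (.refl _)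
    (by simp [pullCat]) (by simp [pullCat]) (by simp) (by simp)

/-- The functions on an affine open set after an extension of the base field. -/
theorem isPushout_baseChange {K : Type u} [Field K] [Algebra k K] {g : Y ⟶ X}
    {iY : Y ⟶ Spec (.of K)} (H : IsPullback g iY iX (specStr k K)) {U : X.Opens}
    (hU : IsAffineOpen U) :
    IsPushout (CommRingCat.ofHom (pullHom iX U)) (CommRingCat.ofHom (algebraMap k K))
      (CommRingCat.ofHom (g.app U).hom) (CommRingCat.ofHom (pullHom iY (g ⁻¹ᵁ U))) := by
  have h1 := isPushout_sections H hU (isAffineOpen_top (Spec (.of K)))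
    (UY := g ⁻¹ᵁ U) (by simp)
  refine h1.of_iso (.refl _) (.refl _) (Scheme.ΓSpecIso (.of K)) (.refl _) (by simp [pullHom]) ?_ ?_ ?_
  · rw [pullCat_top, Category.assoc, Scheme.ΓSpecIso_naturality]
    simp
  · simp [Scheme.Hom.appLE_eq_app]
  · simp [pullHom, pullCat]

end Pushout

end UlmerVoloch

end

noncomputable section

namespace UlmerVoloch

/-! ### The functions `x = z₁ ^ d`, `y = w₁ w₂`, `t = z₁ z₂` on a product of two affine curves -/

section ProductRing

open Polynomial TensorProduct

variable {k : Type u} [Field k] {h : k[X]} {r d : ℕ} {B N : Type u} [CommRing B] [CommRing N]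
  {κ : CurveRing h r d →+* B} {p₁ p₂ : B →+* N}

variable (κ p₁ p₂) in
/-- `θ` is the homomorphism `x = z₁ ^ d`, `y = w₁ w₂`, `t = z₁ z₂`. -/
structure IsProductHom (θ : SurfaceRing h r d →+* N) : Prop where
  map_x : θ (FamilyRing.x h r _ _) = p₁ (κ (CurveRing.z h r d)) ^ d
  map_y : θ (FamilyRing.y h r _ _) = p₁ (κ (CurveRing.w h r d)) * p₂ (κ (CurveRing.w h r d))
  map_t : θ (SurfaceRing.t h r d) = p₁ (κ (CurveRing.z h r d)) * p₂ (κ (CurveRing.z h r d))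
  map_const : ∀ c, θ (algebraMap k _ c) = p₁ (κ (algebraMap k _ c))

theorem map_aeval {A A' : Type*} [CommRing A] [CommRing A'] [Algebra k A] (f : A →+* A') (a : A)
    (q : k[X]) : f (aeval a q) = q.eval₂ (f.comp (algebraMap k A)) (f a) := by
  rw [aeval_def, hom_eval₂]

/-- Under the substitution `t ^ d / x` becomes `z₂ ^ d`, so the product of the two curve equations
`wᵢ ^ r = h(zᵢ ^ d)` is the equation of the surface. -/
theorem exists_isProductHom [Algebra k B] (hκ : ∀ c, κ (algebraMap k _ c) = algebraMap k B c)
    (hp : ∀ c, p₁ (algebraMap k B c) = p₂ (algebraMap k B c))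
    (hz : IsUnit (p₁ (κ (CurveRing.z h r d)))) : ∃ θ, IsProductHom κ p₁ p₂ θ := by
  obtain ⟨v, hv⟩ := (hz.pow d).exists_right_inv
  let i : k →+* N := (p₁.comp κ).comp (algebraMap k _)
  have hi₂ : (p₂.comp κ).comp (algebraMap k _) = i := by
    ext c
    simp only [RingHom.comp_apply, hκ, hp, i]
  let I : k[X] →+* N := eval₂RingHom i (p₁ (κ (CurveRing.z h r d)) * p₂ (κ (CurveRing.z h r d)))
  have hI : I.comp (algebraMap k k[X]) = i := by
    ext c; simp [I]
  have hIX : I X = p₁ (κ (CurveRing.z h r d)) * p₂ (κ (CurveRing.z h r d)) := by simp [I]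
  have hw₁ := congrArg (p₁.comp κ) (CurveRing.w_pow (h := h) (r := r) (d := d))
  have hw₂ := congrArg (p₂.comp κ) (CurveRing.w_pow (h := h) (r := r) (d := d))
  rw [map_aeval, map_pow, map_pow] at hw₁ hw₂
  rw [hi₂] at hw₂
  refine ⟨FamilyRing.lift I (p₁ (κ (CurveRing.z h r d)) ^ d)
    (p₁ (κ (CurveRing.w h r d)) * p₂ (κ (CurveRing.w h r d))) v hv ?_, ?_, ?_, ?_, fun c => ?_⟩
  · have h1 : I (X ^ d) * v = p₂ (κ (CurveRing.z h r d)) ^ d := by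
      rw [map_pow, hIX, mul_pow, mul_assoc, mul_comm _ v, ← mul_assoc, hv, one_mul]
    rw [hI, h1, mul_pow]
    exact congrArg₂ (· * ·) hw₁ hw₂
  · exact FamilyRing.lift_x
  · exact FamilyRing.lift_y
  · exact FamilyRing.lift_algebraMap _ |>.trans hIX
  · rw [IsScalarTower.algebraMap_apply k k[X], FamilyRing.lift_algebraMap]
    exact congrArg (fun f => f c) hI

variable {θ : SurfaceRing h r d →+* N}

namespace IsProductHom

theorem map_aeval_x (hθ : IsProductHom κ p₁ p₂ θ) (q : k[X]) :
    θ (aeval (FamilyRing.x h r _ _) q) = p₁ (κ (aeval (CurveRing.z h r d ^ d) q)) := by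
  have h2 := map_aeval (p₁.comp κ) (CurveRing.z h r d ^ d) q
  rw [RingHom.comp_apply] at h2
  have h3 : θ.comp (algebraMap k (SurfaceRing h r d)) = (p₁.comp κ).comp (algebraMap k _) :=
    RingHom.ext hθ.map_const
  rw [h2, map_aeval, hθ.map_x, h3, RingHom.map_pow (p₁.comp κ), RingHom.comp_apply]

theorem map_xinv (hθ : IsProductHom κ p₁ p₂ θ) :
    p₁ (κ (CurveRing.z h r d)) ^ d * θ (FamilyRing.xinv h r _ _) = 1 := by
  rw [← hθ.map_x, ← map_mul, FamilyRing.x_mul_xinv, map_one]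

theorem map_t_pow_mul_xinv (hθ : IsProductHom κ p₁ p₂ θ) :
    θ (SurfaceRing.t h r d ^ d * FamilyRing.xinv h r _ _) = p₂ (κ (CurveRing.z h r d)) ^ d := by
  rw [map_mul, map_pow, hθ.map_t, mul_pow, mul_right_comm, hθ.map_xinv, one_mul]

theorem map_aeval_t_pow_mul_xinv (hθ : IsProductHom κ p₁ p₂ θ)
    [Algebra k B] (hκ : ∀ c, κ (algebraMap k _ c) = algebraMap k B c)
    (hp : ∀ c, p₁ (algebraMap k B c) = p₂ (algebraMap k B c)) (q : k[X]) :
    θ (aeval (SurfaceRing.t h r d ^ d * FamilyRing.xinv h r _ _) q) =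
      p₂ (κ (aeval (CurveRing.z h r d ^ d) q)) := by
  have h2 := map_aeval (p₂.comp κ) (CurveRing.z h r d ^ d) q
  rw [RingHom.comp_apply] at h2
  have h3 : θ.comp (algebraMap k (SurfaceRing h r d)) = (p₂.comp κ).comp (algebraMap k _) := by
    refine RingHom.ext fun c => ?_
    exact (hθ.map_const c).trans (by rw [hκ, hp, RingHom.comp_apply, RingHom.comp_apply, hκ])
  rw [h2, map_aeval, hθ.map_t_pow_mul_xinv, h3, RingHom.map_pow (p₂.comp κ), RingHom.comp_apply]

/-- The polynomial functions of `x`, `t` on the product. -/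
theorem map_ofPoly_mem_nonZeroDivisors (hθ : IsProductHom κ p₁ p₂ θ) (hd : d ≠ 0)
    [Algebra k B] (hκ : ∀ c, κ (algebraMap k _ c) = algebraMap k B c)
    (hN : IsPushout (CommRingCat.ofHom (algebraMap k B)) (CommRingCat.ofHom (algebraMap k B))
      (CommRingCat.ofHom p₁) (CommRingCat.ofHom p₂))
    (hz : ∀ q : k[X], q ≠ 0 → aeval (κ (CurveRing.z h r d)) q ∈ nonZeroDivisors B)
    {p : k[X][X]} (hp : p ≠ 0) : θ (SurfaceRing.ofPoly h r d p) ∈ nonZeroDivisors N := by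
  obtain ⟨e, he⟩ := exists_equiv_of_isPushout hN
  have h1 := eval₂_tmul_mem_nonZeroDivisors (κ (CurveRing.z h r d)) (κ (CurveRing.z h r d)) hz hz
    (substMonomial k d p) ((map_ne_zero_iff _ (substMonomial_injective hd)).mpr hp)
  have h2 : (θ.comp (SurfaceRing.ofPoly h r d)) = (e.toRingHom.comp (eval₂RingHom
      ((Algebra.TensorProduct.includeLeft : B →ₐ[k] B ⊗[k] B).comp
        (aeval (κ (CurveRing.z h r d)))).toRingHom (1 ⊗ₜ κ (CurveRing.z h r d)))).comp
      (substMonomial k d) := by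
    refine Polynomial.ringHom_ext' (Polynomial.ringHom_ext (fun c => ?_) ?_) ?_
    · have : algebraMap k[X] (SurfaceRing h r d) (C c) = algebraMap k _ c := by
        rw [IsScalarTower.algebraMap_apply k k[X] (SurfaceRing h r d)]; rfl
      simp [SurfaceRing.ofPoly, substMonomial, this, hθ.map_const, hκ, he]
    · have := hθ.map_t
      rw [SurfaceRing.t] at this
      simp [SurfaceRing.ofPoly, substMonomial, this, he]
    · simp only [SurfaceRing.ofPoly, substMonomial, hθ.map_x, RingHom.comp_apply,
        coe_eval₂RingHom, eval₂_X, RingEquiv.toRingHom_eq_coe, RingHom.coe_coe]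
      rw [eval₂_C]
      simp [he]
  have h3 := congrArg (fun f => f p) h2
  simp only [RingHom.comp_apply] at h3
  rw [h3, mem_nonZeroDivisors_iff_right]
  intro n hn
  obtain ⟨n', rfl⟩ := e.surjective n
  rw [← map_zero e] at hn ⊢
  congr 1
  refine (mem_nonZeroDivisors_iff_right.mp h1) n' (e.injective ?_)
  rw [map_mul]
  exact hn

/-- `f` divides a nonzero polynomial in `x` and `t`, whose image is a nonzerodivisor; its factors
are then nonzerodivisors too. -/
theorem map_mem_nonZeroDivisors (hθ : IsProductHom κ p₁ p₂ θ) (hd : d ≠ 0) (hr : r ≠ 0)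
    [IsDomain (SurfaceRing h r d)]
    [Algebra k B] (hκ : ∀ c, κ (algebraMap k _ c) = algebraMap k B c)
    (hN : IsPushout (CommRingCat.ofHom (algebraMap k B)) (CommRingCat.ofHom (algebraMap k B))
      (CommRingCat.ofHom p₁) (CommRingCat.ofHom p₂))
    (hz : ∀ q : k[X], q ≠ 0 → aeval (κ (CurveRing.z h r d)) q ∈ nonZeroDivisors B)
    {f : SurfaceRing h r d} (hf : f ≠ 0) : θ f ∈ nonZeroDivisors N := by
  obtain ⟨p, hp, g, hg⟩ := SurfaceRing.exists_dvd_ofPoly hr f hf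
  have h1 := hθ.map_ofPoly_mem_nonZeroDivisors hd hκ hN hz hp
  rw [hg, map_mul] at h1
  exact (mul_mem_nonZeroDivisors.mp h1).1

end IsProductHom

theorem mem_nonZeroDivisors_of_isAwayHom {A A' : Type u} [CommRing A] [CommRing A'] {φ : A →+* A'}
    {m : A} (hφ : IsAwayHom φ m) {v : A} (hv : v ∈ nonZeroDivisors A) : φ v ∈ nonZeroDivisors A' := by
  let _ := φ.toAlgebra
  have : IsLocalization.Away m A' := hφ
  exact IsLocalization.map_nonZeroDivisors_le (Submonoid.powers m) A' ⟨v, hv, rfl⟩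

/-- The subalgebra generated by roots of two elements of the base ring. -/
theorem exists_eq_sum_of_mem_adjoin {R : Type*} [CommRing R] [Algebra R N] {z w : N} {x y : R}
    (hd : d ≠ 0) (hr : r ≠ 0)
    (hz : z ^ d = algebraMap R N x) (hw : w ^ r = algebraMap R N y) {n : N}
    (hn : n ∈ Algebra.adjoin R {z, w}) : ∃ t : Fin d → Fin r → R,
      n = ∑ i, ∑ j, algebraMap R N (t i j) * (z ^ (i : ℕ) * w ^ (j : ℕ)) := by
  classical
  rw [← Subalgebra.mem_toSubmodule, Algebra.adjoin_eq_span] at hn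
  induction hn using Submodule.span_induction with
  | zero => exact ⟨0, by simp⟩
  | add a b _ _ ha hb =>
    obtain ⟨s, rfl⟩ := ha
    obtain ⟨t, rfl⟩ := hb
    exact ⟨s + t, by simp only [Pi.add_apply, map_add, add_mul, Finset.sum_add_distrib]⟩
  | smul c a _ ha =>
    obtain ⟨s, rfl⟩ := ha
    exact ⟨fun i j => c * s i j, by
      simp only [Algebra.smul_def, map_mul, Finset.mul_sum, mul_assoc]⟩
  | mem a ha =>
    obtain ⟨m, n, rfl⟩ := (Submonoid.mem_closure_pair _ _ _).mp ha
    let i₀ : Fin d := ⟨m % d, Nat.mod_lt _ (Nat.pos_of_ne_zero hd)⟩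
    let j₀ : Fin r := ⟨n % r, Nat.mod_lt _ (Nat.pos_of_ne_zero hr)⟩
    refine ⟨fun i j => if i = i₀ then if j = j₀ then x ^ (m / d) * y ^ (n / r) else 0 else 0, ?_⟩
    rw [Finset.sum_eq_single i₀ (fun i _ hi => by simp [hi]) (by simp),
      Finset.sum_eq_single j₀ (fun j _ hj => by simp [hj]) (by simp)]
    beta_reduce
    rw [if_pos rfl, if_pos rfl, map_mul, map_pow, map_pow, ← hz, ← hw, ← pow_mul, ← pow_mul]
    calc z ^ m * w ^ n = z ^ (d * (m / d) + m % d) * w ^ (r * (n / r) + n % r) := by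
          rw [Nat.div_add_mod, Nat.div_add_mod]
      _ = _ := by rw [pow_add, pow_add]; ring

theorem exists_eq_sum_of_mem_closure {R : Type*} [CommRing R] (f : R →+* N) {z w : N} {x y : R}
    (hd : d ≠ 0) (hr : r ≠ 0) (hz : z ^ d = f x) (hw : w ^ r = f y) {n : N}
    (hn : n ∈ Subring.closure (Set.range f ∪ {z, w})) : ∃ t : Fin d → Fin r → R,
      n = ∑ i, ∑ j, f (t i j) * (z ^ (i : ℕ) * w ^ (j : ℕ)) := by
  let _ := f.toAlgebra
  refine exists_eq_sum_of_mem_adjoin hd hr hz hw ?_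
  have h1 : Subring.closure (Set.range f ∪ {z, w}) ≤ (Algebra.adjoin R {z, w}).toSubring := by
    rw [Subring.closure_le, Set.union_subset_iff]
    refine ⟨?_, Algebra.subset_adjoin⟩
    rintro _ ⟨s, rfl⟩
    exact (Algebra.adjoin R {z, w}).algebraMap_mem s
  exact h1 hn

/-- The elements of a ring which lie in a subring after multiplication by a power of `c`. -/
def awaySubring (E : Subring N) {c : N} (hc : c ∈ E) : Subring N where
  carrier := {n | ∃ M, c ^ M * n ∈ E}
  zero_mem' := ⟨0, by simp⟩
  one_mem' := ⟨0, by simp⟩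
  add_mem' := by
    rintro m n ⟨M, hM⟩ ⟨M', hM'⟩
    refine ⟨M + M', ?_⟩
    have h1 := E.add_mem (E.mul_mem (pow_mem hc M') hM) (E.mul_mem (pow_mem hc M) hM')
    convert h1 using 1
    ring
  mul_mem' := by
    rintro m n ⟨M, hM⟩ ⟨M', hM'⟩
    refine ⟨M + M', ?_⟩
    have h1 := E.mul_mem hM hM'
    convert h1 using 1
    ring
  neg_mem' := by
    rintro m ⟨M, hM⟩
    exact ⟨M, by rw [mul_neg]; exact E.neg_mem hM⟩

theorem le_awaySubring (E : Subring N) {c : N} (hc : c ∈ E) : E ≤ awaySubring E hc :=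
  fun n hn => ⟨0, by simpa using hn⟩

theorem mem_awaySubring_of_mul (E : Subring N) {c : N} (hc : c ∈ E) {n : N} {M : ℕ}
    (h : c ^ M * n ∈ awaySubring E hc) : n ∈ awaySubring E hc := by
  obtain ⟨M', h'⟩ := h
  exact ⟨M' + M, by rwa [pow_add, mul_assoc]⟩

theorem map_mem_of_generators {f : CurveRing h r d →+* N} {E : Subring N}
    (hk : ∀ c, f (algebraMap k _ c) ∈ E) (hz : f (CurveRing.z h r d) ∈ E)
    (hw : f (CurveRing.w h r d) ∈ E) (s : CurveRing h r d) : f s ∈ E := by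
  induction s using CurveRing.induction with
  | hk c => exact hk c
  | hz => exact hz
  | hw => exact hw
  | hadd a b ha hb => rw [map_add]; exact E.add_mem ha hb
  | hmul a b ha hb => rw [map_mul]; exact E.mul_mem ha hb

/-- A subring which contains the coordinates of the two factors generates the ring of functions on
the product, after inverting one function. -/
theorem mem_awaySubring_of_generators [Algebra k B]
    (hκ : ∀ c, κ (algebraMap k _ c) = algebraMap k B c)
    (hN : IsPushout (CommRingCat.ofHom (algebraMap k B)) (CommRingCat.ofHom (algebraMap k B))
      (CommRingCat.ofHom p₁) (CommRingCat.ofHom p₂))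
    {m : CurveRing h r d} (haway : IsAwayHom κ m) (E : Subring N) (h₁ : p₁ (κ m) ∈ E)
    (h₂ : p₂ (κ m) ∈ E) (hk : ∀ c, p₁ (κ (algebraMap k _ c)) ∈ E)
    (hz₁ : p₁ (κ (CurveRing.z h r d)) ∈ E) (hw₁ : p₁ (κ (CurveRing.w h r d)) ∈ E)
    (hz₂ : p₂ (κ (CurveRing.z h r d)) ∈ E)
    (hw₂ : p₁ (κ m) * p₂ (κ m) * p₂ (κ (CurveRing.w h r d)) ∈ E) (n : N) :
    n ∈ awaySubring E (E.mul_mem h₁ h₂) := by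
  have hle := le_awaySubring E (E.mul_mem h₁ h₂)
  obtain ⟨-, hsurj, -⟩ := (isAwayHom_iff _ _).mp haway
  have hp₁ : ∀ s, p₁.comp κ s ∈ E := map_mem_of_generators hk hz₁ hw₁
  have hp₂ : ∀ s, p₂.comp κ s ∈ awaySubring E (E.mul_mem h₁ h₂) := by
    refine map_mem_of_generators (fun c => hle ?_) (hle hz₂) ⟨1, by rwa [pow_one]⟩
    have h3 : p₁ (algebraMap k B c) = p₂ (algebraMap k B c) := congrArg (fun f => f.hom c) hN.w
    rw [RingHom.comp_apply, hκ, ← h3, ← hκ]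
    exact hk c
  have hb₁ : ∀ b, p₁ b ∈ awaySubring E (E.mul_mem h₁ h₂) := by
    intro b
    obtain ⟨s, n, hs⟩ := hsurj b
    apply mem_awaySubring_of_mul (M := n)
    have h1 : (p₁ (κ m) * p₂ (κ m)) ^ n * p₁ b = p₂ (κ m) ^ n * p₁ (κ s) := by
      rw [← hs, map_mul, map_pow]
      ring
    rw [h1]
    exact hle (E.mul_mem (pow_mem h₂ _) (hp₁ s))
  have hb₂ : ∀ b, p₂ b ∈ awaySubring E (E.mul_mem h₁ h₂) := by
    intro b
    obtain ⟨s, n, hs⟩ := hsurj b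
    apply mem_awaySubring_of_mul (M := n)
    have h1 : (p₁ (κ m) * p₂ (κ m)) ^ n * p₂ b = p₁ (κ m) ^ n * p₂ (κ s) := by
      rw [← hs, map_mul, map_pow]
      ring
    rw [h1]
    exact Subring.mul_mem _ (hle (pow_mem h₁ _)) (hp₂ s)
  obtain ⟨e, he⟩ := exists_equiv_of_isPushout hN
  obtain ⟨τ, rfl⟩ := e.surjective n
  induction τ with
  | zero => rw [map_zero]; exact Subring.zero_mem _
  | add x y hx hy => rw [map_add]; exact Subring.add_mem _ hx hy
  | tmul x y => rw [he]; exact Subring.mul_mem _ (hb₁ x) (hb₂ y)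

/-- Solve `t = z₁ z₂` for `z₂`, using `z₁⁻¹ = x⁻¹ z₁ ^ (d - 1)`. -/
theorem IsProductHom.map_z₂ (hθ : IsProductHom κ p₁ p₂ θ) (hd : d ≠ 0) :
    p₂ (κ (CurveRing.z h r d)) = θ (SurfaceRing.t h r d * FamilyRing.xinv h r _ _) *
      p₁ (κ (CurveRing.z h r d)) ^ (d - 1) := by
  rw [map_mul, hθ.map_t]
  calc _ = p₂ (κ (CurveRing.z h r d)) *
        (p₁ (κ (CurveRing.z h r d)) ^ d * θ (FamilyRing.xinv h r _ _)) := by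
        rw [hθ.map_xinv, mul_one]
    _ = p₂ (κ (CurveRing.z h r d)) *
        (p₁ (κ (CurveRing.z h r d)) ^ (d - 1 + 1) * θ (FamilyRing.xinv h r _ _)) := by
        rw [Nat.sub_add_cancel (Nat.pos_of_ne_zero hd)]
    _ = _ := by ring

theorem IsProductHom.w₁_pow (hθ : IsProductHom κ p₁ p₂ θ) :
    p₁ (κ (CurveRing.w h r d)) ^ r = θ (aeval (FamilyRing.x h r _ _) h) := by
  rw [hθ.map_aeval_x, ← map_pow, ← map_pow, CurveRing.w_pow]

/-- Multiply `y = w₁ w₂` by `w₁ ^ (r - 1)` and use `w₁ ^ r = h(x)`. The factor `b` allows for a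
multiple of `h`, since the polynomial inverted on the chart is one. -/
theorem IsProductHom.mul_w₂ (hθ : IsProductHom κ p₁ p₂ θ) (hr : r ≠ 0) (b : k[X]) :
    θ (aeval (FamilyRing.x h r _ _) (h * b)) * p₂ (κ (CurveRing.w h r d)) =
      θ (FamilyRing.y h r _ _) * θ (aeval (FamilyRing.x h r _ _) b) *
        p₁ (κ (CurveRing.w h r d)) ^ (r - 1) := by
  have h2 : θ (aeval (FamilyRing.x h r _ _) (h * b)) =
      p₁ (κ (CurveRing.w h r d)) ^ r * θ (aeval (FamilyRing.x h r _ _) b) := by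
    rw [hθ.w₁_pow, ← map_mul, ← map_mul]
  rw [h2, hθ.map_y]
  calc _ = p₁ (κ (CurveRing.w h r d)) ^ (r - 1 + 1) * θ (aeval (FamilyRing.x h r _ _) b) *
        p₂ (κ (CurveRing.w h r d)) := by
        rw [Nat.sub_add_cancel (Nat.pos_of_ne_zero hr)]
    _ = _ := by ring

/-- After inverting one function, the ring of functions on the product is generated by the
monomials in `z₁` and `w₁` over the functions of `x`, `y`, `t`. -/
theorem IsProductHom.exists_mul_eq_sum (hθ : IsProductHom κ p₁ p₂ θ) (hd : d ≠ 0) (hr : r ≠ 0)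
    [Algebra k B] (hκ : ∀ c, κ (algebraMap k _ c) = algebraMap k B c)
    (hN : IsPushout (CommRingCat.ofHom (algebraMap k B)) (CommRingCat.ofHom (algebraMap k B))
      (CommRingCat.ofHom p₁) (CommRingCat.ofHom p₂))
    {a : k[X]} (hh : h ∣ a) (haway : IsAwayHom κ (aeval (CurveRing.z h r d ^ d) a)) :
    ∃ c, IsUnit (θ c) ∧ ∀ n, ∃ (M : ℕ) (t : Fin d → Fin r → SurfaceRing h r d),
      θ c ^ M * n = ∑ i, ∑ j, θ (t i j) *
        (p₁ (κ (CurveRing.z h r d)) ^ (i : ℕ) * p₁ (κ (CurveRing.w h r d)) ^ (j : ℕ)) := by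
  have hp : ∀ c, p₁ (algebraMap k B c) = p₂ (algebraMap k B c) := fun c =>
    congrArg (fun f => f.hom c) hN.w
  obtain ⟨hu, -, -⟩ := (isAwayHom_iff _ _).mp haway
  obtain ⟨c₁, hc₁⟩ : ∃ c, θ c = p₁ (κ (aeval (CurveRing.z h r d ^ d) a)) :=
    ⟨_, hθ.map_aeval_x a⟩
  obtain ⟨c₂, hc₂⟩ : ∃ c, θ c = p₂ (κ (aeval (CurveRing.z h r d ^ d) a)) :=
    ⟨_, hθ.map_aeval_t_pow_mul_xinv hκ hp a⟩
  -- The subring generated by `z₁`, `w₁` and the functions of `x`, `y`, `t`. It contains `z₂`, and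
  -- it contains `w₂` after multiplication by the function to be inverted, because `h ∣ a`.
  let E := Subring.closure (Set.range θ ∪ {p₁ (κ (CurveRing.z h r d)), p₁ (κ (CurveRing.w h r d))})
  have hθE : ∀ s, θ s ∈ E := fun s => Subring.subset_closure (Or.inl ⟨s, rfl⟩)
  have hzE : p₁ (κ (CurveRing.z h r d)) ∈ E := Subring.subset_closure (Or.inr (Or.inl rfl))
  have hwE : p₁ (κ (CurveRing.w h r d)) ∈ E := Subring.subset_closure (Or.inr (Or.inr rfl))
  have h₁ : p₁ (κ (aeval (CurveRing.z h r d ^ d) a)) ∈ E := hc₁ ▸ hθE _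
  have h₂ : p₂ (κ (aeval (CurveRing.z h r d ^ d) a)) ∈ E := hc₂ ▸ hθE _
  have hw₂ : p₁ (κ (aeval (CurveRing.z h r d ^ d) a)) * p₂ (κ (aeval (CurveRing.z h r d ^ d) a)) *
      p₂ (κ (CurveRing.w h r d)) ∈ E := by
    obtain ⟨b, rfl⟩ := hh
    rw [mul_right_comm, ← hθ.map_aeval_x, hθ.mul_w₂ hr]
    exact E.mul_mem (E.mul_mem (E.mul_mem (hθE _) (hθE _))
      (pow_mem hwE _)) h₂
  have hz₂ : p₂ (κ (CurveRing.z h r d)) ∈ E := by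
    rw [hθ.map_z₂ hd]
    exact E.mul_mem (hθE _) (pow_mem hzE _)
  have hk : ∀ c, p₁ (κ (algebraMap k _ c)) ∈ E := fun c => by
    rw [← hθ.map_const]; exact hθE _
  -- This is `a(x) a(t ^ d / x)`, the product of the two functions inverted on the factors, hence a
  -- unit.
  refine ⟨c₁ * c₂, ?_, fun n => ?_⟩
  · rw [map_mul, hc₁, hc₂]
    exact (hu.map p₁).mul (hu.map p₂)
  · obtain ⟨M, hM⟩ := mem_awaySubring_of_generators hκ hN haway E h₁ h₂ hk hzE hwE hz₂ hw₂ n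
    rw [map_mul, hc₁, hc₂]
    exact ⟨M, exists_eq_sum_of_mem_closure θ hd hr hθ.map_x.symm hθ.w₁_pow hM⟩

end ProductRing

end UlmerVoloch

end

noncomputable section

namespace UlmerVoloch

/-! ### Averaging over roots of unity -/

section Average

/-- Orthogonality of characters: for `i ≠ j` below `n`, the character `ξ ↦ ξ ^ i ξ⁻¹ ^ j` is
nontrivial at a primitive root. Such a root exists because `n` is invertible in `K`. -/
theorem sum_rootsOfUnity_pow {K : Type*} [Field K] [IsAlgClosed K] {n : ℕ} (hn : (n : K) ≠ 0)
    [Fintype (rootsOfUnity n K)] {i j : ℕ} (hi : i < n) (hj : j < n) :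
    ∑ ξ : rootsOfUnity n K, ((ξ : Kˣ) : K) ^ i * (((ξ⁻¹ : rootsOfUnity n K) : Kˣ) : K) ^ j =
      if i = j then (n : K) else 0 := by
  have : NeZero (n : K) := ⟨hn⟩
  have : NeZero n := ⟨by rintro rfl; simp at hn⟩
  split_ifs with hij
  · subst hij
    have h1 : ∀ ξ : rootsOfUnity n K,
        ((ξ : Kˣ) : K) ^ i * (((ξ⁻¹ : rootsOfUnity n K) : Kˣ) : K) ^ i = 1 := by
      intro ξ
      rw [← mul_pow, ← Units.val_mul, ← Subgroup.coe_mul, mul_inv_cancel]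
      simp
    rw [Finset.sum_congr rfl fun ξ _ => h1 ξ, Finset.sum_const, Finset.card_univ,
      ← Nat.card_eq_fintype_card, HasEnoughRootsOfUnity.natCard_rootsOfUnity K n, nsmul_eq_mul, mul_one]
  · let f : rootsOfUnity n K →* K :=
      { toFun := fun ξ => ((ξ : Kˣ) : K) ^ i * (((ξ⁻¹ : rootsOfUnity n K) : Kˣ) : K) ^ j
        map_one' := by simp
        map_mul' := fun a b => by
          simp only [mul_inv, Subgroup.coe_mul, Units.val_mul, mul_pow]
          ring }
    refine sum_hom_units_eq_zero f fun hf => hij ?_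
    obtain ⟨ζ, hζ⟩ := HasEnoughRootsOfUnity.exists_primitiveRoot K n
    have h1 : f hζ.toRootsOfUnity = 1 := by rw [hf]; rfl
    have h2 : ζ ^ i * (ζ⁻¹) ^ j = 1 := by
      have h3 : (((hζ.toRootsOfUnity⁻¹ : rootsOfUnity n K) : Kˣ) : K) = ζ⁻¹ := by
        rw [Subgroup.coe_inv, Units.val_inv_eq_inv_val]
        rfl
      rw [← h3]
      exact h1
    refine hζ.pow_inj hi hj ?_
    rw [inv_pow, mul_inv_eq_one₀ (pow_ne_zero _ (hζ.ne_zero (NeZero.ne n)))] at h2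
    exact h2

variable {K N : Type*} [Field K] [IsAlgClosed K] [CommRing N] {r d : ℕ}

/-- Averaging over `μ_r × μ_d` extracts one coefficient of an expression in monomials. -/
theorem sum_twist_eq (hr : (r : K) ≠ 0) (hd : (d : K) ≠ 0)
    [Fintype (rootsOfUnity r K)] [Fintype (rootsOfUnity d K)] (j : K →+* N)
    (σ : rootsOfUnity r K × rootsOfUnity d K → N →+* N) {z w : N}
    (hz : ∀ g, σ g z = j ((g.2 : Kˣ) : K) * z) (hw : ∀ g, σ g w = j ((g.1 : Kˣ) : K) * w)
    (t : Fin d → Fin r → N) (ht : ∀ g a b, σ g (t a b) = t a b) (a₀ : Fin d) (b₀ : Fin r) :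
    ∑ g, j ((((g.2⁻¹ : rootsOfUnity d K) : Kˣ) : K) ^ (a₀ : ℕ) *
        (((g.1⁻¹ : rootsOfUnity r K) : Kˣ) : K) ^ (b₀ : ℕ)) *
      σ g (∑ a, ∑ b, t a b * (z ^ (a : ℕ) * w ^ (b : ℕ))) =
    j (d * r) * (t a₀ b₀ * (z ^ (a₀ : ℕ) * w ^ (b₀ : ℕ))) := by
  classical
  have h1 : ∀ g, j ((((g.2⁻¹ : rootsOfUnity d K) : Kˣ) : K) ^ (a₀ : ℕ) *
        (((g.1⁻¹ : rootsOfUnity r K) : Kˣ) : K) ^ (b₀ : ℕ)) *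
      σ g (∑ a, ∑ b, t a b * (z ^ (a : ℕ) * w ^ (b : ℕ))) =
      ∑ a : Fin d, ∑ b : Fin r, j ((((g.1 : Kˣ) : K) ^ (b : ℕ) *
          (((g.1⁻¹ : rootsOfUnity r K) : Kˣ) : K) ^ (b₀ : ℕ)) *
        ((((g.2 : Kˣ) : K) ^ (a : ℕ) * (((g.2⁻¹ : rootsOfUnity d K) : Kˣ) : K) ^ (a₀ : ℕ)))) *
          (t a b * (z ^ (a : ℕ) * w ^ (b : ℕ))) := by
    intro g
    simp only [map_sum, Finset.mul_sum, map_mul, map_pow, ht, hz, hw]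
    refine Finset.sum_congr rfl fun a _ => Finset.sum_congr rfl fun b _ => ?_
    ring
  rw [Finset.sum_congr rfl fun g _ => h1 g, Finset.sum_comm]
  have h2 : ∀ a : Fin d, ∑ g : rootsOfUnity r K × rootsOfUnity d K,
      ∑ b : Fin r, j ((((g.1 : Kˣ) : K) ^ (b : ℕ) *
          (((g.1⁻¹ : rootsOfUnity r K) : Kˣ) : K) ^ (b₀ : ℕ)) *
        ((((g.2 : Kˣ) : K) ^ (a : ℕ) * (((g.2⁻¹ : rootsOfUnity d K) : Kˣ) : K) ^ (a₀ : ℕ)))) *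
          (t a b * (z ^ (a : ℕ) * w ^ (b : ℕ))) =
      ∑ b : Fin r, j ((if (b : ℕ) = b₀ then (r : K) else 0) * (if (a : ℕ) = a₀ then (d : K) else 0)) *
        (t a b * (z ^ (a : ℕ) * w ^ (b : ℕ))) := by
    intro a
    rw [Finset.sum_comm]
    refine Finset.sum_congr rfl fun b _ => ?_
    rw [← Finset.sum_mul, ← map_sum, ← sum_rootsOfUnity_pow hr b.2 b₀.2,
      ← sum_rootsOfUnity_pow hd a.2 a₀.2, Finset.sum_mul_sum, Fintype.sum_prod_type]
  rw [Finset.sum_congr rfl fun a _ => h2 a, Finset.sum_eq_single a₀ (fun a _ ha => ?_) (by simp),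
    Finset.sum_eq_single b₀ (fun b _ hb => ?_) (by simp), if_pos rfl, if_pos rfl, mul_comm (r : K)]
  · rw [if_neg (fun h => hb (Fin.ext h)), zero_mul, map_zero, zero_mul]
  · refine Finset.sum_eq_zero fun b _ => ?_
    rw [if_neg (fun h => ha (Fin.ext h)), mul_zero, map_zero, zero_mul]

end Average

end UlmerVoloch

end

noncomputable section

namespace UlmerVoloch

/-! ### Morphisms to separated schemes -/

section Separated

variable {A A' D : Type u} [CommRing A] [CommRing A'] [CommRing D]

theorem IsAwayHom.exists_lift {φ : A →+* A'} {m : A} (h : IsAwayHom φ m) (τ : A →+* D)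
    (hm : IsUnit (τ m)) : ∃ τ' : A' →+* D, ∀ a, τ' (φ a) = τ a := by
  let _ := φ.toAlgebra
  have : IsLocalization.Away m A' := h
  exact ⟨IsLocalization.Away.lift m hm, fun a => IsLocalization.Away.lift_eq m hm a⟩

theorem IsAwayHom.hom_ext {φ : A →+* A'} {m : A} (h : IsAwayHom φ m) {f g : A' →+* D}
    (hfg : f.comp φ = g.comp φ) : f = g := by
  let _ := φ.toAlgebra
  have : IsLocalization.Away m A' := h
  exact IsLocalization.ringHom_ext (Submonoid.powers m) hfg

theorem isDominant_homOfLE {X : Scheme.{u}} {W V : X.Opens} (hW : Dense (W : Set X)) (h : W ≤ V) :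
    IsDominant (X.homOfLE h) := by
  refine ⟨?_⟩
  rw [DenseRange, dense_iff_inter_open]
  intro O hO hne
  obtain ⟨x, hx⟩ := hne
  have h1 : IsOpen (V.ι '' O) := V.ι.isOpenEmbedding.isOpenMap O hO
  obtain ⟨_, ⟨y, hy, rfl⟩, hyW⟩ := hW.inter_open_nonempty _ h1 ⟨_, x, hx, rfl⟩
  refine ⟨y, hy, ⟨_, hyW⟩, ?_⟩
  apply V.ι.injective
  exact congrArg (fun f => f ⟨_, hyW⟩) (X.homOfLE_ι h)

variable {k : Type u} [Field k] {X C : Scheme.{u}} (sC : C ⟶ Spec (.of k))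

/-- A morphism to a separated scheme which is, generically, given by functions on an affine open
set which extend to an open set `V`, maps `V` to this affine open set. -/
theorem exists_le_preimage_of_isSeparated [IsReduced X] [IsSeparated sC] (F : X ⟶ C) {U : C.Opens}
    (hU : IsAffineOpen U) {V W : X.Opens} (hWV : W ≤ V) (hWF : W ≤ F ⁻¹ᵁ U)
    (hW : Dense (W : Set X)) (τ : Γ(C, U) →+* Γ(X, V))
    (hτk : ∀ c, τ (pullHom sC U c) = pullHom (F ≫ sC) V c)
    (hτ : ∀ s, (F.appLE U W hWF).hom s = res hWV (τ s)) :
    ∃ h : V ≤ F ⁻¹ᵁ U, ∀ s, (F.appLE U V h).hom s = τ s := by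
  -- As `U` is affine, `τ` defines a morphism `T` from `V` to `U`. It agrees with `F` on the dense
  -- set `W`, and then on all of `V` because `X` is reduced and `C` is separated.
  obtain ⟨T, hT⟩ : ∃ T : V.toScheme ⟶ U.toScheme,
      T ≫ U.toSpecΓ = V.toSpecΓ ≫ Spec.map (CommRingCat.ofHom τ) := by
    refine ⟨V.toSpecΓ ≫ Spec.map (CommRingCat.ofHom τ) ≫ hU.isoSpec.inv, ?_⟩
    rw [← hU.isoSpec_hom]
    simp
  have : IsReduced V.toScheme := isReduced_of_isOpenImmersion V.ι
  have hdom := isDominant_homOfLE hW hWV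
  have heq : T ≫ U.ι = V.ι ≫ F := by
    refine ext_of_isDominant_of_isSeparated sC ?_ (X.homOfLE hWV) ?_
    · rw [Category.assoc, Category.assoc, ← toSpec_pullHom sC U, toSpec, ← Category.assoc, hT,
        Category.assoc, ← Spec.map_comp, ← CommRingCat.ofHom_comp, ← toSpec_pullHom (F ≫ sC) V]
      exact congrArg (toSpec V) (RingHom.ext hτk)
    · rw [Scheme.homOfLE_ι_assoc, ← Scheme.Hom.resLE_comp_ι F hWF, ← Category.assoc]
      congr 1
      rw [← cancel_mono hU.isoSpec.hom, hU.isoSpec_hom, Category.assoc, hT,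
        ← Scheme.Opens.toSpecΓ_SpecMap_appLE]
      have h1 : F.appLE U W hWF = CommRingCat.ofHom ((res hWV).comp τ) := by
        ext s
        exact hτ s
      rw [h1]
      exact (toSpec_res hWV τ).symm
  have hle : V ≤ F ⁻¹ᵁ U := by
    intro x hx
    have h1 := congrArg (fun f => f ⟨x, hx⟩) heq
    change F x ∈ U
    change U.ι (T ⟨x, hx⟩) = F x at h1
    rw [← h1]
    exact (T ⟨x, hx⟩).2
  refine ⟨hle, fun s => ?_⟩
  have h2 : F.resLE U V hle = T := by
    rw [← cancel_mono U.ι, heq, Scheme.Hom.resLE_comp_ι]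
  have h3 : toSpec V (F.appLE U V hle).hom = toSpec V τ := by
    have h4 := Scheme.Opens.toSpecΓ_SpecMap_appLE F U V hle
    rw [h2, hT] at h4
    exact h4
  exact congrArg (fun f => f s) (toSpec_injective V h3)

end Separated

/-! ### The geometric square of the curve and the action on its charts -/

section Action

variable {k : Type u} [Field k] {C : Scheme.{u}} (sC : C ⟶ Spec (.of k))

/-- Pasting of pullback squares; this is what makes descent from `k̄` to `k` available on the
square. -/
theorem isPullback_geomSqProj : IsPullback (geomSqProj sC)
    (pullback.fst (geom sC).hom (geom sC).hom ≫ (geom sC).hom) (sqStr sC) (closureStr k) := by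
  have h1 : IsPullback (pullback.fst sC (closureStr k)) (geom sC).hom sC (closureStr k) :=
    IsPullback.of_hasPullback _ _
  have h2 : IsPullback (pullback.snd (geom sC).hom (geom sC).hom ≫ pullback.fst sC (closureStr k))
      (pullback.fst (geom sC).hom (geom sC).hom) sC ((geom sC).hom ≫ closureStr k) :=
    (IsPullback.of_hasPullback (geom sC).hom (geom sC).hom).flip.paste_horiz h1
  have h3 : (geom sC).hom ≫ closureStr k = pullback.fst sC (closureStr k) ≫ sC := h1.w.symm
  rw [h3] at h2
  have h4 : geomSqProj sC ≫ pullback.snd sC sC =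
      pullback.snd (geom sC).hom (geom sC).hom ≫ pullback.fst sC (closureStr k) := pullback.lift_snd _ _ _
  have h5 : geomSqProj sC ≫ pullback.fst sC sC =
      pullback.fst (geom sC).hom (geom sC).hom ≫ pullback.fst sC (closureStr k) := pullback.lift_fst _ _ _
  rw [← h4] at h2
  have h6 := IsPullback.of_right h2 h5 (IsPullback.of_hasPullback sC sC).flip
  exact h6.paste_vert h1

instance : Subsingleton (Spec (.of k)) := inferInstanceAs (Subsingleton (PrimeSpectrum k))

theorem dense_preimage {X Y : Scheme.{u}} (f : X ⟶ Y) [UniversallyOpen f] {U : Y.Opens}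
    (hU : Dense (U : Set Y)) : Dense ((f ⁻¹ᵁ U : X.Opens) : Set X) :=
  hU.preimage f.isOpenMap

theorem dense_inf {X : Scheme.{u}} {U V : X.Opens} (hU : Dense (U : Set X)) (hV : Dense (V : Set X)) :
    Dense ((U ⊓ V : X.Opens) : Set X) := by
  rw [TopologicalSpace.Opens.coe_inf]
  exact hU.inter_of_isOpen_left hV U.2

theorem IsSmoothProjective.isSeparated {n : ℕ} {sC : C ⟶ Spec (.of k)}
    (h : IsSmoothProjective n sC) : IsSeparated sC := by
  obtain ⟨N, i, hi, rfl⟩ := h.projective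
  have : IsSeparated (ProjSpace.str N k) := by
    rw [ProjSpace.str]
    infer_instance
  infer_instance

variable {h : Polynomial k} {r d : ℕ}

/-- The projection `C_k̄ ⟶ C`. -/
abbrev geomFst : (geom sC).left ⟶ C := pullback.fst sC (closureStr k)

/-- The action of `μ_r × μ_d` on the functions on an affine open set given by an inequality
`a(z ^ d) ≠ 0`. -/
theorem le_preimage_of_isMuAction [Smooth sC] [IsSeparated sC]
    {jC : C.PartialIso (Spec (.of (CurveRing h r d)))}
    (hjC : jC.IsOver sC (specStr k (CurveRing h r d))) {ρ : MuGroup k r d →* Aut (geom sC)}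
    (hρ : IsMuAction sC jC ρ) {U : C.Opens} (hU : IsAffineOpen U) (hUd : Dense (U : Set C))
    (hUj : U ≤ jC.source) {a : Polynomial k}
    (haway : IsAwayHom ((res hUj).comp (coordHom jC))
      (Polynomial.aeval (CurveRing.z h r d ^ d) a)) (g : MuGroup k r d) :
    ∃ e : geomFst sC ⁻¹ᵁ U ≤
        ((ρ g).hom.left ≫ geomFst sC) ⁻¹ᵁ U,
      (((ρ g).hom.left ≫ geomFst sC).appLE U (geomFst sC ⁻¹ᵁ U) e).hom
          (res hUj (coordHom jC (CurveRing.z h r d))) =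
        pullHom (geom sC).hom (geomFst sC ⁻¹ᵁ U) ((g.2 : (AlgebraicClosure k)ˣ) : AlgebraicClosure k) *
          ((geomFst sC).app U).hom (res hUj (coordHom jC (CurveRing.z h r d))) ∧
      (((ρ g).hom.left ≫ geomFst sC).appLE U (geomFst sC ⁻¹ᵁ U) e).hom
          (res hUj (coordHom jC (CurveRing.w h r d))) =
        pullHom (geom sC).hom (geomFst sC ⁻¹ᵁ U) ((g.1 : (AlgebraicClosure k)ˣ) : AlgebraicClosure k) *
          ((geomFst sC).app U).hom (res hUj (coordHom jC (CurveRing.w h r d))) := by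
  obtain ⟨W, hW, h₁, h₂, hz, hw⟩ := hρ g
  set gC : (geom sC).left ⟶ C := geomFst sC with hgC
  set F : (geom sC).left ⟶ C := (ρ g).hom.left ≫ gC with hF
  set κ := (res hUj).comp (coordHom jC) with hκ
  have hκk : ∀ c, κ (algebraMap k _ c) = pullHom sC U c := fun c => by
    rw [hκ, RingHom.comp_apply, (isOver_iff jC sC).mp hjC, res_pullHom]
  have : Smooth (geom sC).hom := inferInstanceAs (Smooth (pullback.snd sC (closureStr k)))
  have hred : IsReduced (geom sC).left := isReduced_of_smooth (geom sC).hom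
  have : UniversallyOpen gC := inferInstanceAs (UniversallyOpen (pullback.fst sC (closureStr k)))
  have hFs : F ≫ sC = (geom sC).hom ≫ closureStr k := by
    have h1 : gC ≫ sC = (geom sC).hom ≫ closureStr k := pullback.condition
    have h2 : (ρ g).hom.left ≫ (geom sC).hom = (geom sC).hom := Over.w _
    rw [hF, Category.assoc, h1, ← Category.assoc, h2]
  have hgs : gC ≫ sC = (geom sC).hom ≫ closureStr k := pullback.condition
  let J := pullHom (geom sC).hom (gC ⁻¹ᵁ U)
  let G : CurveRing h r d →+* Γ((geom sC).left, gC ⁻¹ᵁ U) := (gC.app U).hom.comp κ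
  let i : k →+* Γ((geom sC).left, gC ⁻¹ᵁ U) := J.comp (algebraMap k (AlgebraicClosure k))
  have hGk : G.comp (algebraMap k _) = i := by
    ext c
    have h3 : (gC.app U).hom (pullHom sC U c) = pullHom (gC ≫ sC) (gC ⁻¹ᵁ U) c := by
      rw [← appLE_pullHom gC sC (le_refl (gC ⁻¹ᵁ U)), Scheme.Hom.appLE_eq_app]
    change (gC.app U).hom (κ _) = _
    rw [hκk, h3, hgs, pullHom_comp_specMap]
    rfl
  have hGa : ∀ q : Polynomial k, G (Polynomial.aeval (CurveRing.z h r d ^ d) q) =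
      q.eval₂ i (G (CurveRing.z h r d) ^ d) := fun q => by
    rw [map_aeval, hGk, map_pow]
  let ζ := J ((g.1 : (AlgebraicClosure k)ˣ) : AlgebraicClosure k)
  let ξ := J ((g.2 : (AlgebraicClosure k)ˣ) : AlgebraicClosure k)
  have hζ : ζ ^ r = 1 := by
    have h3 : (((g.1 : (AlgebraicClosure k)ˣ) : AlgebraicClosure k)) ^ r = 1 := 
      (mem_rootsOfUnity' _ _).mp g.1.2
    rw [← map_pow, h3, map_one]
  have hξ : ξ ^ d = 1 := by
    have h3 : (((g.2 : (AlgebraicClosure k)ˣ) : AlgebraicClosure k)) ^ d = 1 := 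
      (mem_rootsOfUnity' _ _).mp g.2.2
    rw [← map_pow, h3, map_one]
  have hξz : (ξ * G (CurveRing.z h r d)) ^ d = G (CurveRing.z h r d) ^ d := by
    rw [mul_pow, hξ, one_mul]
  -- The substitution `z ↦ ξ z`, `w ↦ ζ w` respects the curve equation because `ζ ^ r = ξ ^ d = 1`.
  -- It fixes `a(z ^ d)`, so it extends to the localization, which is the ring of the chart.
  let τ₀ : CurveRing h r d →+* Γ((geom sC).left, gC ⁻¹ᵁ U) :=
    CurveRing.lift i (ξ * G (CurveRing.z h r d)) (ζ * G (CurveRing.w h r d)) (by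
      rw [hξz, mul_pow, hζ, one_mul, ← map_pow, CurveRing.w_pow, hGa])
  have hτ₀z : τ₀ (CurveRing.z h r d) = ξ * G (CurveRing.z h r d) := CurveRing.lift_z
  have hτ₀w : τ₀ (CurveRing.w h r d) = ζ * G (CurveRing.w h r d) := CurveRing.lift_w
  have hτ₀k : ∀ c, τ₀ (algebraMap k _ c) = i c := fun c => CurveRing.lift_algebraMap c
  have hτ₀a : τ₀ (Polynomial.aeval (CurveRing.z h r d ^ d) a) =
      G (Polynomial.aeval (CurveRing.z h r d ^ d) a) := by
    have h3 : τ₀.comp (algebraMap k _) = i := RingHom.ext hτ₀k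
    rw [hGa, map_aeval, h3, map_pow, hτ₀z, hξz]
  obtain ⟨τ, hτ⟩ := haway.exists_lift τ₀ (by
    rw [hτ₀a]
    exact ((isAwayHom_iff _ _).mp haway).1.map (gC.app U).hom)
  have hFU : UniversallyOpen F := by
    have h3 : IsIso (ρ g).hom := Iso.isIso_hom (ρ g)
    have : IsIso (ρ g).hom.left := inferInstanceAs (IsIso ((Over.forget _).map (ρ g).hom))
    rw [hF]
    infer_instance
  have hWU : W ⊓ (gC ⁻¹ᵁ U ⊓ F ⁻¹ᵁ U) ≤ gC ⁻¹ᵁ U := inf_le_right.trans inf_le_left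
  have hWF : W ⊓ (gC ⁻¹ᵁ U ⊓ F ⁻¹ᵁ U) ≤ F ⁻¹ᵁ U := inf_le_right.trans inf_le_right
  have hWW : W ⊓ (gC ⁻¹ᵁ U ⊓ F ⁻¹ᵁ U) ≤ W := inf_le_left
  have hτk : ∀ c, τ (pullHom sC U c) = pullHom (F ≫ sC) (gC ⁻¹ᵁ U) c := by
    intro c
    rw [← hκk, hτ, hτ₀k, hFs, pullHom_comp_specMap]
    rfl
  have hGres : ∀ s (V : (geom sC).left.Opens) (hV : V ≤ gC ⁻¹ᵁ U),
      res hV (G s) = (gC.appLE jC.source V (hV.trans (gC.preimage_mono hUj))).hom (coordHom jC s) := by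
    intro s V hV
    change res hV ((gC.app U).hom (res hUj (coordHom jC s))) = _
    rw [← Scheme.Hom.appLE_eq_app, res_appLE, appLE_res]
  -- On a dense open set the automorphism is given by this substitution; separatedness then shows
  -- that it preserves the whole chart.
  have hring : (F.appLE U _ hWF).hom.comp κ = ((res hWU).comp τ).comp κ := by
    refine CurveRing.ringHom_ext (fun c => ?_) ?_ ?_
    · change (F.appLE U _ hWF).hom (κ _) = res hWU (τ (κ _))
      rw [hκk, hτk, res_pullHom, appLE_pullHom]
    · change (F.appLE U _ hWF).hom (res hUj _) = res hWU (τ (κ _))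
      rw [hτ, hτ₀z, map_mul, hGres, appLE_res, res_pullHom, ← res_appLE F h₂ hWW]
      refine (congrArg (res hWW) hz).trans ?_
      rw [map_mul, pullFun_eq, res_pullHom, coord_eq, res_appLE]
      rfl
    · change (F.appLE U _ hWF).hom (res hUj _) = res hWU (τ (κ _))
      rw [hτ, hτ₀w, map_mul, hGres, appLE_res, res_pullHom, ← res_appLE F h₂ hWW]
      refine (congrArg (res hWW) hw).trans ?_
      rw [map_mul, pullFun_eq, res_pullHom, coord_eq, res_appLE]
      rfl
  obtain ⟨e, he⟩ := exists_le_preimage_of_isSeparated sC F hU hWU hWF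
    (dense_inf hW (dense_inf (dense_preimage gC hUd) (dense_preimage F hUd))) τ hτk
    (fun s => congrArg (fun f => f s) (haway.hom_ext hring))
  exact ⟨e, (he _).trans ((hτ _).trans hτ₀z), (he _).trans ((hτ _).trans hτ₀w)⟩

end Action

end UlmerVoloch

end

noncomputable section

namespace UlmerVoloch

/-! ### Quotients by a finite group after an extension of the base field -/

section Quotient

variable {k K : Type u} [Field k] [Field K] [Algebra k K] {G : Type*}
  {Y Yb Q Qb : Scheme.{u}}

/-- `π : Y ⟶ Q` is a morphism over `k` which becomes, over `K`, the quotient by the action `σ`. -/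
structure IsGeometricQuotient (sY : Y ⟶ Spec (.of k)) (sYb : Yb ⟶ Spec (.of K)) (gY : Yb ⟶ Y)
    (sQ : Q ⟶ Spec (.of k)) (sQb : Qb ⟶ Spec (.of K)) (gQ : Qb ⟶ Q) (π : Y ⟶ Q) (πb : Yb ⟶ Qb)
    (σ : G → (Yb ⟶ Yb)) : Prop where
  isPullback_source : IsPullback gY sYb sY (specStr k K)
  isPullback_target : IsPullback gQ sQb sQ (specStr k K)
  comm : gY ≫ π = πb ≫ gQ
  isOver : π ≫ sQ = sY
  isOver' : πb ≫ sQb = sYb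
  quotient : IsQuotient σ πb

namespace IsGeometricQuotient

variable {sY : Y ⟶ Spec (.of k)} {sYb : Yb ⟶ Spec (.of K)} {gY : Yb ⟶ Y}
    {sQ : Q ⟶ Spec (.of k)} {sQb : Qb ⟶ Spec (.of K)} {gQ : Qb ⟶ Q} {π : Y ⟶ Q} {πb : Yb ⟶ Qb}
    {σ : G → (Yb ⟶ Yb)} (H : IsGeometricQuotient sY sYb gY sQ sQb gQ π πb σ)

include H

theorem preimage_le (U : Q.Opens) : πb ⁻¹ᵁ gQ ⁻¹ᵁ U ≤ gY ⁻¹ᵁ π ⁻¹ᵁ U := by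
  have h := congrArg (fun f => f ⁻¹ᵁ U) H.comm
  exact h.ge

theorem le_preimage (U : Q.Opens) : gY ⁻¹ᵁ π ⁻¹ᵁ U ≤ πb ⁻¹ᵁ gQ ⁻¹ᵁ U := by
  have h := congrArg (fun f => f ⁻¹ᵁ U) H.comm
  exact h.le

/-- Functions on `Q` inject into functions on its base change to `K`, where pull-back to the source
is injective by the definition of a quotient. -/
theorem app_injective {U : Q.Opens} (hU : IsAffineOpen U) : Function.Injective (π.app U).hom := by
  have h1 : Function.Injective (gQ.app U).hom := by
    let _ : Algebra k Γ(Q, U) := (pullHom sQ U).toAlgebra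
    exact injective_of_isPushout (isPushout_baseChange H.isPullback_target hU)
  have h2 := H.quotient.injective (gQ ⁻¹ᵁ U)
  intro a b hab
  refine h1 (h2 ?_)
  have h3 : ∀ a, (πb.app (gQ ⁻¹ᵁ U)).hom ((gQ.app U).hom a) =
      (gY.appLE (π ⁻¹ᵁ U) (πb ⁻¹ᵁ gQ ⁻¹ᵁ U) (H.preimage_le U)).hom ((π.app U).hom a) := by
    intro a
    rw [← Scheme.Hom.appLE_eq_app, ← Scheme.Hom.appLE_eq_app, ← Scheme.Hom.appLE_eq_app, appLE_appLE,
      appLE_appLE]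
    exact (appLE_congr_hom H.comm _ a).symm
  rw [h3, h3, hab]

/-- Invariant functions descend to the quotient. -/
theorem exists_app_eq {U : Q.Opens} (hU : IsAffineOpen U) (β : Γ(Y, π ⁻¹ᵁ U))
    (hβ : ∀ g, ∃ e : πb ⁻¹ᵁ gQ ⁻¹ᵁ U ≤ σ g ⁻¹ᵁ (πb ⁻¹ᵁ gQ ⁻¹ᵁ U),
      ((σ g).appLE _ _ e).hom ((gY.appLE (π ⁻¹ᵁ U) (πb ⁻¹ᵁ gQ ⁻¹ᵁ U) (H.preimage_le U)).hom β) =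
        (gY.appLE (π ⁻¹ᵁ U) (πb ⁻¹ᵁ gQ ⁻¹ᵁ U) (H.preimage_le U)).hom β) :
    ∃ α, (π.app U).hom α = β := by
  obtain ⟨α, hα⟩ := H.quotient.surjective (gQ ⁻¹ᵁ U) _ hβ
  let _ : Algebra k Γ(Q, U) := (pullHom sQ U).toAlgebra
  -- The descended function `α` lives over `K`; the retraction gives a candidate `a` over `k`. That
  -- its pull-back is `β` is checked on the affine open subsets `E` of `π ⁻¹ᵁ U`, all with this same
  -- `a`.
  obtain ⟨a, ha⟩ := exists_descent (isPushout_baseChange H.isPullback_target hU) α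
  refine ⟨a, Y.IsSheaf.section_ext fun y hy => ?_⟩
  obtain ⟨E, hE, hyE, hEU⟩ := exists_isAffineOpen_mem_and_subset (U := π ⁻¹ᵁ U) (x := y) hy
  have hEU : E ≤ π ⁻¹ᵁ U := hEU
  refine ⟨E, hEU, hyE, ?_⟩
  change res hEU _ = res hEU _
  let _ : Algebra k Γ(Y, E) := (pullHom sY E).toAlgebra
  have hle : gY ⁻¹ᵁ E ≤ πb ⁻¹ᵁ gQ ⁻¹ᵁ U := (gY.preimage_mono hEU).trans (H.le_preimage U)
  let p : Γ(Q, U) →ₐ[k] Γ(Y, E) := ⟨(π.appLE U E hEU).hom, fun c => by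
    change (π.appLE U E hEU).hom (pullHom sQ U c) = pullHom sY E c
    rw [appLE_pullHom]
    congr 2
    exact H.isOver⟩
  have h1 := ha _ _ (isPushout_baseChange H.isPullback_source hE) p
    (πb.appLE (gQ ⁻¹ᵁ U) (gY ⁻¹ᵁ E) hle).hom (fun a => ?_) (fun x => ?_) (res hEU β) ?_
  · rw [← h1]
    rw [← Scheme.Hom.appLE_eq_app, res_appLE]
    rfl
  · change (πb.appLE (gQ ⁻¹ᵁ U) (gY ⁻¹ᵁ E) hle).hom ((gQ.app U).hom a) =
      (gY.app E).hom ((π.appLE U E hEU).hom a)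
    rw [← Scheme.Hom.appLE_eq_app, ← Scheme.Hom.appLE_eq_app, appLE_appLE, appLE_appLE]
    exact (appLE_congr_hom H.comm _ a).symm
  · rw [appLE_pullHom]
    congr 2
    exact H.isOver'
  · have h2 := congrArg (res hle) hα
    rw [← Scheme.Hom.appLE_eq_app, res_appLE, res_appLE] at h2
    rw [h2, ← Scheme.Hom.appLE_eq_app, appLE_res]

end IsGeometricQuotient

end Quotient

end UlmerVoloch

end

noncomputable section

namespace UlmerVoloch

/-! ### Integrality over the quotient and small saturated open sets -/

section Quotient

variable {k K : Type u} [Field k] [Field K] [Algebra k K] {G : Type*}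
  {Y Yb Q Qb : Scheme.{u}}

theorem surjective_of_isPullback_specStr {X Xb : Scheme.{u}} {g : Xb ⟶ X} {sb : Xb ⟶ Spec (.of K)}
    {s : X ⟶ Spec (.of k)} (H : IsPullback g sb s (specStr k K)) : Surjective g := by
  have : Surjective (specStr k K) :=
    ⟨fun x => ⟨(⊥ : PrimeSpectrum K), Subsingleton.elim _ _⟩⟩
  exact MorphismProperty.of_isPullback (P := @Surjective) H.flip this

theorem isIntegralHom_of_isPullback_specStr [Algebra.IsIntegral k K] {X Xb : Scheme.{u}} {g : Xb ⟶ X}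
    {sb : Xb ⟶ Spec (.of K)} {s : X ⟶ Spec (.of k)} (H : IsPullback g sb s (specStr k K)) :
    IsIntegralHom g := by
  have : IsIntegralHom (specStr k K) :=
    IsIntegralHom.SpecMap_iff.mpr (algebraMap_isIntegral_iff.mpr inferInstance)
  exact MorphismProperty.of_isPullback (P := @IsIntegralHom) H.flip this

theorem app_comp_injective_of_isPullback_specStr {X Xb : Scheme.{u}} {g : Xb ⟶ X}
    {sb : Xb ⟶ Spec (.of K)} {s : X ⟶ Spec (.of k)} (H : IsPullback g sb s (specStr k K))
    {U : X.Opens} (hU : IsAffineOpen U) : Function.Injective (g.app U).hom := by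
  let _ : Algebra k Γ(X, U) := (pullHom s U).toAlgebra
  exact injective_of_isPushout (isPushout_baseChange H hU)

namespace IsGeometricQuotient

variable {sY : Y ⟶ Spec (.of k)} {sYb : Yb ⟶ Spec (.of K)} {gY : Yb ⟶ Y}
    {sQ : Q ⟶ Spec (.of k)} {sQb : Qb ⟶ Spec (.of K)} {gQ : Qb ⟶ Q} {π : Y ⟶ Q} {πb : Yb ⟶ Qb}
    {σ : G → (Yb ⟶ Yb)} (H : IsGeometricQuotient sY sYb gY sQ sQb gQ π πb σ)

include H

/-- Functions upstairs are integral over the invariants of a finite group, and the base change from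
`Q` is integral because `K` is algebraic over `k`. -/
theorem isIntegral_app [Algebra.IsIntegral k K] [Group G] [Finite G] (h1 : σ 1 = 𝟙 Yb)
    (hmul : ∀ g g', σ g ≫ σ g' = σ (g * g')) {U : Q.Opens} (hU : IsAffineOpen U) :
    ((πb.app (gQ ⁻¹ᵁ U)).hom.comp (gQ.app U).hom).IsIntegral := by
  have := isIntegralHom_of_isPullback_specStr H.isPullback_target
  refine RingHom.IsIntegral.trans _ _ (gQ.isIntegral_app U hU) ?_
  have he : ∀ g, πb ⁻¹ᵁ gQ ⁻¹ᵁ U ≤ σ g ⁻¹ᵁ πb ⁻¹ᵁ gQ ⁻¹ᵁ U := fun g =>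
    (congrArg (fun f => f ⁻¹ᵁ gQ ⁻¹ᵁ U) (H.quotient.invariant g)).ge
  refine isIntegral_of_finite_group _ (fun g => ((σ g).appLE _ _ (he g)).hom) (fun b => ?_)
    (fun g g' b => ?_) (fun b hb => ?_)
  · refine (appLE_congr_hom h1 (he 1) b).trans ?_
    rw [Scheme.Hom.appLE, Scheme.Hom.id_app]
    exact congrArg (fun f => f.hom b) ((Category.id_comp _).trans (Yb.presheaf.map_id _))
  · refine (appLE_appLE (σ g) (σ g') _ _ b).trans ?_
    exact appLE_congr_hom (hmul g g') _ b
  · exact H.quotient.surjective _ b (fun g => ⟨he g, hb g⟩)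

theorem isAffineOpen_preimage [Algebra.IsIntegral k K] {U : Q.Opens} (hU : IsAffineOpen U) :
    IsAffineOpen (πb ⁻¹ᵁ gQ ⁻¹ᵁ U) := by
  have := isIntegralHom_of_isPullback_specStr H.isPullback_target
  have := H.quotient.affine
  exact (hU.preimage gQ).preimage πb

/-- Small open sets of the quotient have their preimage in a given dense open set. -/
theorem exists_preimage_le [Algebra.IsIntegral k K] [Group G] [Finite G] [IsReduced Yb]
    [IsLocallyNoetherian Yb] (h1 : σ 1 = 𝟙 Yb)
    (hmul : ∀ g g', σ g ≫ σ g' = σ (g * g')) {V : Y.Opens}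
    (hV : Dense ((gY ⁻¹ᵁ V : Yb.Opens) : Set Yb)) {O : Q.Opens} (hO : (O : Set Q).Nonempty) :
    ∃ Ω : Q.Opens, IsAffineOpen Ω ∧ (Ω : Set Q).Nonempty ∧ Ω ≤ O ∧ π ⁻¹ᵁ Ω ≤ V := by
  obtain ⟨x, hx⟩ := hO
  obtain ⟨U, hU, hxU, hUO⟩ := exists_isAffineOpen_mem_and_subset (U := O) (x := x) hx
  have hD := H.isAffineOpen_preimage hU
  set D := πb ⁻¹ᵁ gQ ⁻¹ᵁ U with hDdef
  have : IsNoetherianRing Γ(Yb, D) := IsLocallyNoetherian.component_noetherian ⟨D, hD⟩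
  -- `D(b)` lies in the preimage of `V` but need not be stable under the group. Being integral, the
  -- nonzerodivisor `b` divides a nonzero function `s` from the quotient, and `D(s)` is saturated.
  obtain ⟨b, hb, hbV⟩ := PrimeSpectrum.exists_basicOpen_le_of_dense (hD.fromSpec ⁻¹ᵁ gY ⁻¹ᵁ V)
    (dense_preimage hD.fromSpec hV)
  have hbV' : Yb.basicOpen b ≤ gY ⁻¹ᵁ V := by
    rw [← hD.fromSpec_image_basicOpen]
    rintro _ ⟨y, hy, rfl⟩
    exact hbV hy
  set F : Γ(Q, U) →+* Γ(Yb, D) := (πb.app (gQ ⁻¹ᵁ U)).hom.comp (gQ.app U).hom with hF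
  have hFinj : Function.Injective F :=
    (H.quotient.injective _).comp (app_comp_injective_of_isPullback_specStr H.isPullback_target hU)
  have hFint : F.IsIntegral := H.isIntegral_app h1 hmul hU
  have hFb : ∀ s, Yb.basicOpen (F s) = πb ⁻¹ᵁ gQ ⁻¹ᵁ Q.basicOpen s := fun s => by
    rw [Scheme.preimage_basicOpen, Scheme.preimage_basicOpen]
    rfl
  obtain ⟨s, hs, c, hc⟩ : ∃ s, s ≠ 0 ∧ b ∣ F s := by
    have : Nonempty U := ⟨⟨x, hxU⟩⟩
    have : Nontrivial Γ(Q, U) := inferInstance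
    let _ : Algebra Γ(Q, U) Γ(Yb, D) := F.toAlgebra
    have h2 : IsIntegral Γ(Q, U) b := hFint b
    exact h2.isAlgebraic.exists_nonzero_dvd hb
  refine ⟨Q.basicOpen s, hU.basicOpen s, ?_, (Q.basicOpen_le s).trans hUO, ?_⟩
  · by_contra hne
    have h3 : Q.basicOpen s = ⊥ := by
      ext1
      exact Set.not_nonempty_iff_eq_empty.mp hne
    apply hs
    apply hFinj
    rw [map_zero]
    rw [← basicOpen_eq_bot_iff, hFb, h3]
    rfl
  · intro y hy
    have := surjective_of_isPullback_specStr H.isPullback_source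
    obtain ⟨y, rfl⟩ := gY.surjective y
    have h4 : y ∈ πb ⁻¹ᵁ gQ ⁻¹ᵁ Q.basicOpen s := H.le_preimage _ hy
    rw [← hFb, hc, Scheme.basicOpen_mul] at h4
    exact hbV' h4.1

end IsGeometricQuotient

end Quotient

end UlmerVoloch

end

noncomputable section

namespace UlmerVoloch

/-! ### Descent of ring homomorphisms and properties of basic open sets -/

section General

theorem exists_ringHom_comp_eq {A B S : Type*} [CommRing A] [CommRing B] [CommRing S] {i : A →+* B}
    (hi : Function.Injective i) {θ : S →+* B} (h : ∀ s, ∃ a, i a = θ s) :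
    ∃ φ : S →+* A, ∀ s, i (φ s) = θ s := by
  choose φ hφ using h
  refine ⟨⟨⟨⟨φ, ?_⟩, ?_⟩, ?_, ?_⟩, hφ⟩
  · exact hi (by rw [hφ, map_one, map_one])
  · exact fun a b => hi (by simp only [map_mul, hφ])
  · exact hi (by simp only [hφ, map_zero])
  · exact fun a b => hi (by simp only [map_add, hφ])

theorem exists_mul_pow_eq_res {X : Scheme.{u}} {V O : X.Opens} (hV : IsAffineOpen V) (n : Γ(X, V))
    (hO : O = X.basicOpen n) (hOV : O ≤ V) (β : Γ(X, O)) :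
    ∃ (M : ℕ) (n' : Γ(X, V)), β * res hOV n ^ M = res hOV n' := by
  subst hO
  have := hV.isLocalization_basicOpen n
  obtain ⟨M, n', h⟩ := IsLocalization.Away.surj n β
  exact ⟨M, n', h⟩

theorem eq_zero_of_res_eq_zero {X : Scheme.{u}} {V O : X.Opens} (hV : IsAffineOpen V) {n : Γ(X, V)}
    (hn : n ∈ nonZeroDivisors Γ(X, V)) (hO : O = X.basicOpen n) (hOV : O ≤ V) {b : Γ(X, V)}
    (hb : res hOV b = 0) : b = 0 := by
  subst hO
  have := hV.isLocalization_basicOpen n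
  obtain ⟨⟨_, M, rfl⟩, h⟩ := (IsLocalization.map_eq_zero_iff (Submonoid.powers n)
    Γ(X, X.basicOpen n) b).mp hb
  exact (mul_left_mem_nonZeroDivisors_eq_zero_iff (pow_mem hn M)).mp h

/-- If `D(b)` is nonempty then `b ≠ 0`, so `b * n ≠ 0`, and on a reduced scheme `D(b * n)` is
nonempty. -/
theorem dense_basicOpen {X : Scheme.{u}} [IsReduced X] {V : X.Opens} (hV : IsAffineOpen V)
    (hVd : Dense (V : Set X)) {n : Γ(X, V)} (hn : n ∈ nonZeroDivisors Γ(X, V)) :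
    Dense (X.basicOpen n : Set X) := by
  rw [dense_iff_inter_open]
  intro P hP hne
  obtain ⟨x, hxP, hxV⟩ := hVd.inter_open_nonempty P hP hne
  obtain ⟨b, hbP, hxb⟩ := hV.exists_basicOpen_le (V := ⟨P, hP⟩) ⟨x, hxP⟩ hxV
  have h1 : X.basicOpen (b * n) ≠ ⊥ := by
    rw [Ne, basicOpen_eq_bot_iff, mul_right_mem_nonZeroDivisors_eq_zero_iff hn,
      ← basicOpen_eq_bot_iff]
    intro h
    rw [h] at hxb
    exact hxb
  rw [Scheme.basicOpen_mul] at h1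
  by_contra h2
  apply h1
  ext1
  refine Set.not_nonempty_iff_eq_empty.mp ?_
  rintro ⟨y, hy1, hy2⟩
  exact h2 ⟨y, hbP hy1, hy2⟩

/-- The functions vanishing at `x` form an ideal, the preimage of the maximal ideal of the stalk. -/
theorem sum_notMem_basicOpen {X : Scheme.{u}} {V : X.Opens} {x : X} (hx : x ∈ V) {I : Type*}
    {s : Finset I} {f : I → Γ(X, V)} (hf : ∀ i ∈ s, x ∉ X.basicOpen (f i)) :
    x ∉ X.basicOpen (∑ i ∈ s, f i) := by
  have h : ∀ b, x ∉ X.basicOpen b ↔ b ∈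
      (IsLocalRing.maximalIdeal (X.presheaf.stalk x)).comap (X.presheaf.germ V x hx).hom := by
    intro b
    rw [Scheme.mem_basicOpen X b x hx, Ideal.mem_comap, IsLocalRing.mem_maximalIdeal, mem_nonunits_iff]
  rw [h]
  exact Ideal.sum_mem _ fun i hi => (h _).mp (hf i hi)

end General

/-! ### Charts on which the group acts through characters -/

section Quotient

variable {k K : Type u} [Field k] [Field K] {r d : ℕ}
  {Y Yb Q Qb : Scheme.{u}} {S : Type u} [CommRing S] [Algebra k S]

/-- The functions in the image of `θ` on the affine open set `V` are invariant under the action `σ`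
of `μ_r × μ_d`, which acts on `z`, `w` by `ξ`, `ζ`, and every function on `V` is, up to multiplication
by an invertible one, a combination of monomials in `z`, `w` with coefficients in the image of `θ`. -/
structure IsTwistedChart (sY : Y ⟶ Spec (.of k)) (sYb : Yb ⟶ Spec (.of K)) (gY : Yb ⟶ Y)
    (σ : rootsOfUnity r K × rootsOfUnity d K → (Yb ⟶ Yb)) (V : Y.Opens) (θ : S →+* Γ(Y, V))
    (z w : Γ(Y, V)) (c : S) : Prop where
  isAffineOpen : IsAffineOpen V
  dense : Dense ((gY ⁻¹ᵁ V : Yb.Opens) : Set Yb)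
  dense' : Dense (V : Set Y)
  le : ∀ g, gY ⁻¹ᵁ V ≤ (σ g ≫ gY) ⁻¹ᵁ V
  map_const : ∀ a, θ (algebraMap k S a) = pullHom sY V a
  invariant : ∀ g s, ((σ g ≫ gY).appLE V _ (le g)).hom (θ s) = (gY.appLE V _ le_rfl).hom (θ s)
  map_z : ∀ g, ((σ g ≫ gY).appLE V _ (le g)).hom z =
    pullHom sYb _ ((g.2 : Kˣ) : K) * (gY.appLE V _ le_rfl).hom z
  map_w : ∀ g, ((σ g ≫ gY).appLE V _ (le g)).hom w =
    pullHom sYb _ ((g.1 : Kˣ) : K) * (gY.appLE V _ le_rfl).hom w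
  isUnit_z : IsUnit z
  isUnit_w : IsUnit w
  nonZeroDivisors : ∀ {f}, f ≠ 0 → θ f ∈ nonZeroDivisors Γ(Y, V)
  isUnit : IsUnit (θ c)
  exists_eq_sum : ∀ n, ∃ (M : ℕ) (t : Fin d → Fin r → S),
    θ c ^ M * n = ∑ i, ∑ j, θ (t i j) * (z ^ (i : ℕ) * w ^ (j : ℕ))

theorem IsGeometricQuotient.appLE_app_invariant [Algebra k K] {G : Type*}
    {sY : Y ⟶ Spec (.of k)} {sYb : Yb ⟶ Spec (.of K)} {gY : Yb ⟶ Y}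
    {sQ : Q ⟶ Spec (.of k)} {sQb : Qb ⟶ Spec (.of K)} {gQ : Qb ⟶ Q} {π : Y ⟶ Q} {πb : Yb ⟶ Qb}
    {σ : G → (Yb ⟶ Yb)}
    (H : IsGeometricQuotient sY sYb gY sQ sQb gQ π πb σ) (g) {U : Q.Opens} {O : Yb.Opens}
    (hO : O ≤ gY ⁻¹ᵁ π ⁻¹ᵁ U) (e : O ≤ σ g ⁻¹ᵁ O) (b : Γ(Q, U)) :
    ((σ g).appLE O O e).hom ((gY.appLE (π ⁻¹ᵁ U) O hO).hom ((π.app U).hom b)) =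
      (gY.appLE (π ⁻¹ᵁ U) O hO).hom ((π.app U).hom b) := by
  have h1 : (gY.appLE (π ⁻¹ᵁ U) O hO).hom ((π.app U).hom b) = ((gY ≫ π).appLE U O hO).hom b := by
    rw [← Scheme.Hom.appLE_eq_app]
    exact appLE_appLE gY π _ hO b
  have h2 : σ g ≫ gY ≫ π = gY ≫ π := by
    rw [H.comm, ← Category.assoc, H.quotient.invariant]
  rw [h1]
  exact (appLE_appLE (σ g) (gY ≫ π) hO e b).trans (appLE_congr_hom h2 _ b)

namespace IsTwistedChart

variable {sY : Y ⟶ Spec (.of k)} {sYb : Yb ⟶ Spec (.of K)} {gY : Yb ⟶ Y}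
    {σ : rootsOfUnity r K × rootsOfUnity d K → (Yb ⟶ Yb)}
    {V : Y.Opens} {θ : S →+* Γ(Y, V)} {z w : Γ(Y, V)} {c : S}
    (hV : IsTwistedChart sY sYb gY σ V θ z w c)

include hV

theorem appLE_z (g) {O : Yb.Opens} (hO : O ≤ gY ⁻¹ᵁ V) (e : O ≤ σ g ⁻¹ᵁ O) :
    ((σ g).appLE O O e).hom ((gY.appLE V O hO).hom z) =
      pullHom sYb O ((g.2 : Kˣ) : K) * (gY.appLE V O hO).hom z := by
  rw [appLE_appLE, ← res_appLE (σ g ≫ gY) (hV.le g) hO, hV.map_z, map_mul, res_pullHom, res_appLE]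

theorem appLE_w (g) {O : Yb.Opens} (hO : O ≤ gY ⁻¹ᵁ V) (e : O ≤ σ g ⁻¹ᵁ O) :
    ((σ g).appLE O O e).hom ((gY.appLE V O hO).hom w) =
      pullHom sYb O ((g.1 : Kˣ) : K) * (gY.appLE V O hO).hom w := by
  rw [appLE_appLE, ← res_appLE (σ g ≫ gY) (hV.le g) hO, hV.map_w, map_mul, res_pullHom, res_appLE]

theorem appLE_invariant (g s) {O : Yb.Opens} (hO : O ≤ gY ⁻¹ᵁ V) (e : O ≤ σ g ⁻¹ᵁ O) :
    ((σ g).appLE O O e).hom ((gY.appLE V O hO).hom (θ s)) = (gY.appLE V O hO).hom (θ s) := by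
  rw [appLE_appLE, ← res_appLE (σ g ≫ gY) (hV.le g) hO, hV.invariant, res_appLE]

end IsTwistedChart

end Quotient

end UlmerVoloch

end

noncomputable section

namespace UlmerVoloch

/-! ### Invariant functions on a twisted chart -/

section Quotient

variable {k K : Type u} [Field k] [Field K] [Algebra k K] {r d : ℕ}
  {Y Yb Q Qb : Scheme.{u}} {S : Type u} [CommRing S] [Algebra k S]
  {sY : Y ⟶ Spec (.of k)} {sYb : Yb ⟶ Spec (.of K)} {gY : Yb ⟶ Y}
  {sQ : Q ⟶ Spec (.of k)} {sQb : Qb ⟶ Spec (.of K)} {gQ : Qb ⟶ Q} {π : Y ⟶ Q} {πb : Yb ⟶ Qb}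

theorem IsGeometricQuotient.le_preimage_preimage {G : Type*} {σ : G → (Yb ⟶ Yb)}
    (H : IsGeometricQuotient sY sYb gY sQ sQb gQ π πb σ) (U : Q.Opens) (g : G) :
    πb ⁻¹ᵁ gQ ⁻¹ᵁ U ≤ σ g ⁻¹ᵁ πb ⁻¹ᵁ gQ ⁻¹ᵁ U :=
  (congrArg (fun f => f ⁻¹ᵁ gQ ⁻¹ᵁ U) (H.quotient.invariant g)).ge

theorem IsGeometricQuotient.le_preimage_preimage' {G : Type*} {σ : G → (Yb ⟶ Yb)}
    (H : IsGeometricQuotient sY sYb gY sQ sQb gQ π πb σ) (U : Q.Opens) (g : G) :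
    gY ⁻¹ᵁ π ⁻¹ᵁ U ≤ σ g ⁻¹ᵁ gY ⁻¹ᵁ π ⁻¹ᵁ U :=
  ((H.le_preimage U).trans (H.le_preimage_preimage U g)).trans ((σ g).preimage_mono (H.preimage_le U))

/-- Functions on `U` form a nonzero ring which injects into the functions on the preimage. -/
theorem IsGeometricQuotient.nonempty_preimage {G : Type*} {σ : G → (Yb ⟶ Yb)}
    (H : IsGeometricQuotient sY sYb gY sQ sQb gQ π πb σ) {U : Q.Opens} (hU : IsAffineOpen U)
    (hne : (U : Set Q).Nonempty) : ((π ⁻¹ᵁ U : Y.Opens) : Set Y).Nonempty := by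
  obtain ⟨x, hx⟩ := hne
  have : Nonempty U := ⟨⟨x, hx⟩⟩
  have h1 : Nontrivial Γ(Y, π ⁻¹ᵁ U) := (H.app_injective hU).nontrivial
  by_contra h2
  have h3 : π ⁻¹ᵁ U = ⊥ := by
    ext1
    exact Set.not_nonempty_iff_eq_empty.mp h2
  rw [h3] at h1
  exact not_subsingleton Γ(Y, ⊥) inferInstance

variable {σ : rootsOfUnity r K × rootsOfUnity d K → (Yb ⟶ Yb)}
  (H : IsGeometricQuotient sY sYb gY sQ sQb gQ π πb σ)
  {V : Y.Opens} {θ : S →+* Γ(Y, V)} {z w : Γ(Y, V)} {c : S}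

namespace IsTwistedChart

/-- The functions `θ s` are invariant, so on an open set saturated for `π` they come from the
quotient. -/
theorem exists_descent (hV : IsTwistedChart sY sYb gY σ V θ z w c)
    (H : IsGeometricQuotient sY sYb gY sQ sQb gQ π πb σ) {Ω : Q.Opens}
    (hΩ : IsAffineOpen Ω) (hΩV : π ⁻¹ᵁ Ω ≤ V) :
    ∃ φ : S →+* Γ(Q, Ω), ∀ s, (π.app Ω).hom (φ s) = res hΩV (θ s) := by
  refine exists_ringHom_comp_eq (i := (π.app Ω).hom) (θ := (res hΩV).comp θ) (H.app_injective hΩ)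
    fun s => H.exists_app_eq hΩ _ fun g => ⟨H.le_preimage_preimage Ω g, ?_⟩
  rw [RingHom.comp_apply, appLE_res]
  exact hV.appLE_invariant g s _ _

/-- Take a function `n` on `V` with nonempty `D(n)` inside the saturated set, and expand it in the
monomials. Up to units, each `θ (t i j)` is a combination of translates of `n`, which vanish
wherever the saturated set is left; so every `D(θ (t i j))` lies in it. As `n ≠ 0`, some `t i j` is
nonzero. -/
theorem exists_basicOpen_le [IsAlgClosed K] (hr : (r : K) ≠ 0) (hd : (d : K) ≠ 0)
    (hV : IsTwistedChart sY sYb gY σ V θ z w c)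
    (H : IsGeometricQuotient sY sYb gY sQ sQb gQ π πb σ) {Ω : Q.Opens}
    (hΩ : IsAffineOpen Ω) (hne : (Ω : Set Q).Nonempty) (hΩV : π ⁻¹ᵁ Ω ≤ V) :
    ∃ f, f ≠ 0 ∧ Y.basicOpen (θ f) ≤ π ⁻¹ᵁ Ω := by
  have : NeZero r := ⟨by rintro rfl; simp at hr⟩
  have : NeZero d := ⟨by rintro rfl; simp at hd⟩
  let _ := Fintype.ofFinite (rootsOfUnity r K)
  let _ := Fintype.ofFinite (rootsOfUnity d K)
  obtain ⟨y, hy⟩ := H.nonempty_preimage hΩ hne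
  obtain ⟨n, hn, hyn⟩ := hV.isAffineOpen.exists_basicOpen_le ⟨y, hy⟩ (hΩV hy)
  obtain ⟨M, t, ht⟩ := hV.exists_eq_sum n
  suffices h : ∀ i j, Y.basicOpen (θ (t i j)) ≤ π ⁻¹ᵁ Ω by
    by_contra! h1
    have h2 : ∀ i j, t i j = 0 := fun i j => by
      by_contra h3
      exact h1 _ h3 (h i j)
    have h3 : θ c ^ M * n = 0 := by
      rw [ht]
      refine Finset.sum_eq_zero fun i _ => Finset.sum_eq_zero fun j _ => ?_
      rw [h2, map_zero, zero_mul]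
    have h4 : n = 0 := (hV.isUnit.pow M).mul_right_eq_zero.mp h3
    rw [h4, Scheme.basicOpen_zero] at hyn
    exact hyn
  intro i j y' hy'
  by_contra hyΩ
  have := surjective_of_isPullback_specStr H.isPullback_source
  obtain ⟨x, rfl⟩ := gY.surjective y'
  let P := (gY.appLE V (gY ⁻¹ᵁ V) le_rfl).hom
  let J := pullHom sYb (gY ⁻¹ᵁ V)
  let τ := fun g => ((σ g).appLE (gY ⁻¹ᵁ V) (gY ⁻¹ᵁ V) (hV.le g)).hom
  have hx : x ∈ gY ⁻¹ᵁ V := Y.basicOpen_le (θ (t i j)) hy'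
  have hP : ∀ b, Yb.basicOpen (P b) = gY ⁻¹ᵁ V ⊓ gY ⁻¹ᵁ Y.basicOpen b := fun b =>
    Scheme.basicOpen_appLE _ _ _ _ _
  -- Averaging against a character turns the translates of `θ c ^ M * n` into `d r` times the single
  -- term with indices `i`, `j`.
  have key := sum_twist_eq hr hd J τ (z := P z) (w := P w) (fun g => hV.appLE_z g le_rfl (hV.le g))
    (fun g => hV.appLE_w g le_rfl (hV.le g)) (fun a b => P (θ (t a b)))
    (fun g a b => hV.appLE_invariant g _ le_rfl (hV.le g)) i j
  have hsum : ∑ a, ∑ b, P (θ (t a b)) * (P z ^ (a : ℕ) * P w ^ (b : ℕ)) = P (θ c ^ M * n) := by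
    rw [ht]
    simp only [map_sum, map_mul, map_pow]
  rw [hsum] at key
  have h1 : x ∈ Yb.basicOpen (J (d * r) * (P (θ (t i j)) * (P z ^ (i : ℕ) * P w ^ (j : ℕ)))) := by
    have hu1 : IsUnit (J (d * r)) := (IsUnit.mk0 _ (mul_ne_zero hd hr)).map J
    have hu2 : IsUnit (P z ^ (i : ℕ) * P w ^ (j : ℕ)) :=
      ((hV.isUnit_z.map P).pow _).mul ((hV.isUnit_w.map P).pow _)
    rw [Scheme.basicOpen_mul, Scheme.basicOpen_mul, Scheme.basicOpen_of_isUnit _ hu1,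
      Scheme.basicOpen_of_isUnit _ hu2, hP]
    exact ⟨hx, ⟨hx, hy'⟩, hx⟩
  rw [← key] at h1
  refine sum_notMem_basicOpen hx (fun g _ h2 => hyΩ ?_) h1
  rw [Scheme.basicOpen_mul] at h2
  have h3 : x ∈ Yb.basicOpen (τ g (P (θ c ^ M * n))) := h2.2
  have h4 : Yb.basicOpen (τ g (P (θ c ^ M * n))) =
      gY ⁻¹ᵁ V ⊓ σ g ⁻¹ᵁ Yb.basicOpen (P (θ c ^ M * n)) := Scheme.basicOpen_appLE _ _ _ _ _
  rw [h4, hP, Scheme.basicOpen_mul] at h3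
  have h5 : σ g x ∈ gY ⁻¹ᵁ π ⁻¹ᵁ Ω := hn h3.2.2.2
  have h6 : x ∈ σ g ⁻¹ᵁ πb ⁻¹ᵁ gQ ⁻¹ᵁ Ω := H.le_preimage _ h5
  have h7 : σ g ⁻¹ᵁ πb ⁻¹ᵁ gQ ⁻¹ᵁ Ω = πb ⁻¹ᵁ gQ ⁻¹ᵁ Ω :=
    congrArg (fun f => f ⁻¹ᵁ gQ ⁻¹ᵁ Ω) (H.quotient.invariant g)
  rw [h7] at h6
  exact H.preimage_le _ h6

/-- On a small enough open set of the quotient every function is, upstairs, invariant. Expanded in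
the monomials it keeps only its constant term, which lies in the image of `S` once `m` is inverted.
-/
theorem exists_isAwayHom [IsAlgClosed K] [IsDomain S] (hr : (r : K) ≠ 0) (hd : (d : K) ≠ 0)
    (hV : IsTwistedChart sY sYb gY σ V θ z w c)
    (H : IsGeometricQuotient sY sYb gY sQ sQb gQ π πb σ) [Nonempty Y] {Ω : Q.Opens}
    (hΩ : IsAffineOpen Ω) (hΩV : π ⁻¹ᵁ Ω ≤ V) {f : S} (hf : f ≠ 0)
    (hfΩ : Y.basicOpen (θ f) ≤ π ⁻¹ᵁ Ω) :
    ∃ (Ω' : Q.Opens) (_ : IsAffineOpen Ω') (_ : Ω' ≤ Ω) (hV' : π ⁻¹ᵁ Ω' ≤ V) (φ : S →+* Γ(Q, Ω'))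
      (m : S), m ≠ 0 ∧ π ⁻¹ᵁ Ω' = Y.basicOpen (θ m) ∧ IsAwayHom φ m ∧
      ∀ s, (π.app Ω').hom (φ s) = res hV' (θ s) := by
  have : NeZero r := ⟨by rintro rfl; simp at hr⟩
  have : NeZero d := ⟨by rintro rfl; simp at hd⟩
  let _ := Fintype.ofFinite (rootsOfUnity r K)
  let _ := Fintype.ofFinite (rootsOfUnity d K)
  have hVne : Nonempty V := by
    obtain ⟨y, hy⟩ := hV.dense'.nonempty
    exact ⟨⟨y, hy⟩⟩
  have : Nontrivial Γ(Y, V) := inferInstance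
  have hc : c ≠ 0 := by
    rintro rfl
    exact not_isUnit_zero (map_zero θ ▸ hV.isUnit)
  have hm : f * c ≠ 0 := mul_ne_zero hf hc
  obtain ⟨φ, hφ⟩ := hV.exists_descent H hΩ hΩV
  -- Inverting `f` puts `D(θ m)` inside the saturated set, making it the full preimage of a basic
  -- open set of the quotient. Inverting `c` removes the denominators of the expansion.
  obtain ⟨m, hmdef⟩ : ∃ m, m = f * c := ⟨_, rfl⟩
  rw [← hmdef] at hm
  set Ω' := Q.basicOpen (φ m) with hΩ'
  have hle : Ω' ≤ Ω := Q.basicOpen_le _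
  have hle' : π ⁻¹ᵁ Ω' ≤ π ⁻¹ᵁ Ω := π.preimage_mono hle
  have hV' : π ⁻¹ᵁ Ω' ≤ V := hle'.trans hΩV
  have hΩ'a : IsAffineOpen Ω' := hΩ.basicOpen _
  have hpre : π ⁻¹ᵁ Ω' = Y.basicOpen (θ m) := by
    have h1 : Y.basicOpen (θ m) ≤ π ⁻¹ᵁ Ω := by
      rw [hmdef, map_mul, Scheme.basicOpen_mul]
      exact inf_le_left.trans hfΩ
    rw [hΩ', Scheme.preimage_basicOpen]
    refine (congrArg Y.basicOpen (hφ m)).trans ?_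
    refine (Y.basicOpen_res (θ m) (homOfLE hΩV).op).trans ?_
    exact inf_eq_right.mpr h1
  have hφ' : ∀ s, (π.app Ω').hom (res hle (φ s)) = res hV' (θ s) := fun s => by
    rw [← Scheme.Hom.appLE_eq_app, appLE_res, ← res_res hΩV hle', ← hφ, ← Scheme.Hom.appLE_eq_app,
      res_appLE]
  refine ⟨Ω', hΩ'a, hle, hV', (res hle).comp φ, m, hm, hpre, (isAwayHom_iff _ _).mpr ⟨?_, fun b => ?_,
    fun a ha => ⟨0, ?_⟩⟩, hφ'⟩
  · exact RingedSpace.isUnit_res_basicOpen _ (φ m)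
  · obtain ⟨N, n, hn⟩ := exists_mul_pow_eq_res hV.isAffineOpen (θ m) hpre hV' ((π.app Ω').hom b)
    obtain ⟨M, t, ht⟩ := hV.exists_eq_sum n
    have hinj := app_comp_injective_of_isPullback_specStr H.isPullback_source
      (show IsAffineOpen (π ⁻¹ᵁ Ω') from hpre ▸ hV.isAffineOpen.basicOpen _)
    let O := gY ⁻¹ᵁ π ⁻¹ᵁ Ω'
    have hOV : O ≤ gY ⁻¹ᵁ V := gY.preimage_mono hV'
    have he : ∀ g, O ≤ σ g ⁻¹ᵁ O := H.le_preimage_preimage' Ω'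
    let P := (gY.appLE V O hOV).hom
    let J := pullHom sYb O
    let τ := fun g => ((σ g).appLE O O (he g)).hom
    let β := (gY.appLE (π ⁻¹ᵁ Ω') O le_rfl).hom ((π.app Ω').hom b)
    have hPres : ∀ s, (gY.appLE (π ⁻¹ᵁ Ω') O le_rfl).hom (res hV' s) = P s := fun s =>
      appLE_res _ _ _ _
    have hβ : P (θ c) ^ M * (β * P (θ m) ^ N) =
        ∑ i, ∑ j, P (θ (t i j)) * (P z ^ (i : ℕ) * P w ^ (j : ℕ)) := by
      have h1 : β * P (θ m) ^ N = P n := by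
        rw [← hPres (θ m), ← hPres n, ← hn, map_mul, map_pow]
      rw [h1, ← map_pow, ← map_mul, ht]
      simp only [map_sum, map_mul, map_pow]
    have hτβ : ∀ g, τ g β = β := fun g => H.appLE_app_invariant g le_rfl (he g) b
    have hτθ : ∀ g s, τ g (P (θ s)) = P (θ s) := fun g s => hV.appLE_invariant g s hOV (he g)
    -- The expanded function `x` is itself invariant. Moving it to the other side changes the `(0,
    -- 0)` coefficient to `t 0 0 - x` and makes the sum zero, so averaging yields `t 0 0 = x`.
    let x := P (θ c) ^ M * (β * P (θ m) ^ N)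
    let t' : Fin d → Fin r → Γ(Yb, O) := fun i j =>
      P (θ (t i j)) - if i = 0 ∧ j = 0 then x else 0
    have key := sum_twist_eq hr hd J τ (z := P z) (w := P w) (fun g => hV.appLE_z g hOV (he g))
      (fun g => hV.appLE_w g hOV (he g)) t' (fun g i j => by
        simp only [t', map_sub, hτθ]
        split_ifs
        · simp only [x, map_mul, map_pow, hτβ, hτθ]
        · simp only [map_zero]) 0 0
    have h0 : ∑ i, ∑ j, t' i j * (P z ^ (i : ℕ) * P w ^ (j : ℕ)) = 0 := by
      have h1 : ∑ i : Fin d, ∑ j : Fin r, (if i = 0 ∧ j = 0 then x else 0) *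
          (P z ^ (i : ℕ) * P w ^ (j : ℕ)) = x := by
        rw [Finset.sum_eq_single 0, Finset.sum_eq_single 0]
        · simp
        · intro j _ hj
          rw [if_neg (fun h => hj h.2), zero_mul]
        · simp
        · intro i _ hi
          refine Finset.sum_eq_zero fun j _ => ?_
          rw [if_neg (fun h => hi h.1), zero_mul]
        · simp
      simp only [t', sub_mul, Finset.sum_sub_distrib]
      rw [h1, ← hβ, sub_self]
    have h1 : t' 0 0 = 0 := by
      have hu : IsUnit (J (d * r)) := (IsUnit.mk0 _ (mul_ne_zero hd hr)).map J
      rw [h0] at key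
      simp only [map_zero, mul_zero, Finset.sum_const_zero, Fin.val_zero, pow_zero, mul_one] at key
      exact hu.mul_right_eq_zero.mp key.symm
    have h2 : P (θ (t 0 0)) = x := by
      simp only [t', and_self, if_true] at h1
      exact sub_eq_zero.mp h1
    have h3 : (π.app Ω').hom (res hle (φ (c ^ M * m ^ N)) * b) = (π.app Ω').hom (res hle (φ (t 0 0))) := by
      apply hinj
      rw [map_mul, hφ', hφ', ← Scheme.Hom.appLE_eq_app, map_mul]
      refine (congrArg (· * β) (hPres _)).trans (Eq.trans ?_ (hPres _).symm)
      rw [h2]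
      simp only [x, map_mul, map_pow]
      ring
    have h4 := H.app_injective hΩ'a h3
    -- From `c ^ M m ^ N b = t 0 0` and `m = f c`, multiplying by `f ^ M` turns the factor `c ^ M`
    -- into `m ^ M`.
    refine ⟨f ^ M * t 0 0, N + M, ?_⟩
    let ψ := (res hle).comp φ
    change b * ψ m ^ (N + M) = ψ (f ^ M * t 0 0)
    have h5 : ψ (c ^ M * m ^ N) * b = ψ (t 0 0) := h4
    rw [map_mul ψ (f ^ M), ← h5, map_mul ψ (c ^ M), map_pow ψ c, map_pow ψ f, map_pow ψ m, pow_add,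
      show ψ m ^ M = ψ f ^ M * ψ c ^ M by rw [hmdef, map_mul, mul_pow]]
    ring
  -- The kernel is zero: `θ a` vanishes on `D(θ m)` with `θ m` a nonzerodivisor, hence `θ a = 0`,
  -- whereas `θ a` is a nonzerodivisor if `a ≠ 0`.
  · rw [pow_zero, one_mul]
    by_contra ha'
    refine nonZeroDivisors.ne_zero (hV.nonZeroDivisors ha') ?_
    refine eq_zero_of_res_eq_zero hV.isAffineOpen (hV.nonZeroDivisors hm) hpre hV' ?_
    rw [← hφ']
    exact (congrArg _ ha).trans (map_zero _)

end IsTwistedChart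

end Quotient

end UlmerVoloch

end

noncomputable section

namespace UlmerVoloch

/-! ### The affine birational model of the quotient -/

section Quotient

variable {k K : Type u} [Field k] [Field K] [Algebra k K] {r d : ℕ}
  {Y Yb Q Qb : Scheme.{u}} {S : Type u} [CommRing S] [Algebra k S]
  {sY : Y ⟶ Spec (.of k)} {sYb : Yb ⟶ Spec (.of K)} {gY : Yb ⟶ Y}
  {sQ : Q ⟶ Spec (.of k)} {sQb : Qb ⟶ Spec (.of K)} {gQ : Qb ⟶ Q} {π : Y ⟶ Q} {πb : Yb ⟶ Qb}
  {σ : rootsOfUnity r K × rootsOfUnity d K → (Yb ⟶ Yb)}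
  {V : Y.Opens} {θ : S →+* Γ(Y, V)} {z w : Γ(Y, V)} {c : S}

namespace IsTwistedChart

/-- The preimage of a nonempty open set contains `D(θ f)` for some `f ≠ 0`, and this is dense
because `θ f` is a nonzerodivisor. -/
theorem dense_preimage [IsAlgClosed K] [Algebra.IsIntegral k K] (hr : (r : K) ≠ 0) (hd : (d : K) ≠ 0)
    (hV : IsTwistedChart sY sYb gY σ V θ z w c)
    (H : IsGeometricQuotient sY sYb gY sQ sQb gQ π πb σ) (h1 : σ 1 = 𝟙 Yb)
    (hmul : ∀ g g', σ g ≫ σ g' = σ (g * g')) [IsReduced Y] [IsReduced Yb] [IsLocallyNoetherian Yb]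
    {O : Q.Opens} (hO : (O : Set Q).Nonempty) : Dense ((π ⁻¹ᵁ O : Y.Opens) : Set Y) := by
  have : NeZero r := ⟨by rintro rfl; simp at hr⟩
  have : NeZero d := ⟨by rintro rfl; simp at hd⟩
  obtain ⟨Ω, hΩ, hne, hΩO, hΩV⟩ := H.exists_preimage_le h1 hmul hV.dense hO
  obtain ⟨f, hf, hfΩ⟩ := hV.exists_basicOpen_le hr hd H hΩ hne hΩV
  exact (dense_basicOpen hV.isAffineOpen hV.dense' (hV.nonZeroDivisors hf)).mono
    (hfΩ.trans (π.preimage_mono hΩO))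

/-- The quotient is birational to the affine scheme of the invariant functions. -/
theorem exists_partialIso [IsAlgClosed K] [Algebra.IsIntegral k K] [IsDomain S] (hr : (r : K) ≠ 0)
    (hd : (d : K) ≠ 0) (hV : IsTwistedChart sY sYb gY σ V θ z w c)
    (H : IsGeometricQuotient sY sYb gY sQ sQb gQ π πb σ) (h1 : σ 1 = 𝟙 Yb)
    (hmul : ∀ g g', σ g ≫ σ g' = σ (g * g')) [IsReduced Y] [IsReduced Yb] [IsLocallyNoetherian Yb]
    [Nonempty Y] :
    ∃ (e : Q.PartialIso (Spec (.of S))) (hV' : π ⁻¹ᵁ e.source ≤ V), e.IsOver sQ (specStr k S) ∧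
      ∀ s, (π.app e.source).hom (coordHom e s) = res hV' (θ s) := by
  have : NeZero r := ⟨by rintro rfl; simp at hr⟩
  have : NeZero d := ⟨by rintro rfl; simp at hd⟩
  have hQ : ((⊤ : Q.Opens) : Set Q).Nonempty := ⟨π (Classical.arbitrary Y), trivial⟩
  obtain ⟨Ω, hΩ, hne, -, hΩV⟩ := H.exists_preimage_le h1 hmul hV.dense hQ
  obtain ⟨f, hf, hfΩ⟩ := hV.exists_basicOpen_le hr hd H hΩ hne hΩV
  obtain ⟨Ω', hΩ', -, hV', φ, m, hm, hpre, haway, hφ⟩ := hV.exists_isAwayHom hr hd H hΩ hΩV hf hfΩ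
  have hd' : Dense ((π ⁻¹ᵁ Ω' : Y.Opens) : Set Y) := by
    rw [hpre]
    exact dense_basicOpen hV.isAffineOpen hV.dense' (hV.nonZeroDivisors hm)
  -- Any nonempty open subset of `Q` has dense, hence nonempty, preimage, which meets the dense
  -- preimage of `Ω'`.
  have hdense : Dense (Ω' : Set Q) := by
    rw [dense_iff_inter_open]
    intro P hP hPne
    obtain ⟨y, hy, hy'⟩ := hd'.inter_open_nonempty _ (π ⁻¹ᵁ (⟨P, hP⟩ : Q.Opens)).2
      (dense_preimage hr hd hV H h1 hmul (O := ⟨P, hP⟩) hPne).nonempty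
    exact ⟨π y, hy, hy'⟩
  have hdense' : Dense (PrimeSpectrum.basicOpen m : Set (PrimeSpectrum S)) := by
    refine (PrimeSpectrum.basicOpen m).2.dense ⟨⊥, ?_⟩
    simpa using hm
  let e := partialIsoOfAway Ω' hdense hΩ' φ m haway hdense'
  have hcoord : coordHom e = φ := coordHom_partialIsoOfAway
  refine ⟨e, hV', (isOver_iff e sQ).mpr fun a => ?_, fun s => ?_⟩
  · rw [hcoord]
    apply H.app_injective hΩ'
    refine (hφ _).trans ?_
    rw [hV.map_const, res_pullHom]
    have h2 : (π.app Ω').hom (pullHom sQ Ω' a) = pullHom (π ≫ sQ) (π ⁻¹ᵁ Ω') a := by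
      rw [← appLE_pullHom π sQ (le_refl (π ⁻¹ᵁ Ω')), Scheme.Hom.appLE_eq_app]
    exact (h2.trans (congrArg (fun f => pullHom f (π ⁻¹ᵁ Ω') a) H.isOver)).symm
  · rw [hcoord]
    exact hφ s

end IsTwistedChart

end Quotient

end UlmerVoloch

end

noncomputable section

namespace UlmerVoloch

/-! ### Affine charts on the curve and on its square -/

section CurveChart

/-- If `D(g)` misses `D(a)`, then `g * a` is nilpotent, and so is `g` because `a` is a
nonzerodivisor. -/
theorem dense_basicOpen_of_mem_nonZeroDivisors {A : Type*} [CommRing A] {a : A}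
    (ha : a ∈ nonZeroDivisors A) : Dense (PrimeSpectrum.basicOpen a : Set (PrimeSpectrum A)) := by
  rw [PrimeSpectrum.isTopologicalBasis_basic_opens.dense_iff]
  rintro _ ⟨g, rfl⟩ hne
  by_contra h
  have h1 : PrimeSpectrum.basicOpen (g * a) = ⊥ := by
    rw [PrimeSpectrum.basicOpen_mul]
    ext1
    exact Set.not_nonempty_iff_eq_empty.mp h
  rw [PrimeSpectrum.basicOpen_eq_bot_iff] at h1
  obtain ⟨n, hn⟩ := h1
  rw [mul_pow, mul_right_mem_nonZeroDivisors_eq_zero_iff (pow_mem ha n)] at hn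
  have h2 := (PrimeSpectrum.basicOpen_eq_bot_iff g).mpr ⟨n, hn⟩
  beta_reduce at hne
  rw [h2] at hne
  exact Set.not_nonempty_empty hne

variable {k : Type u} [Field k] {h : Polynomial k} {r d : ℕ} {C : Scheme.{u}}

/-- The curve contains an affine open set given by an inequality `a(z ^ d) ≠ 0`. -/
theorem exists_curveChart (hr : (r : k) ≠ 0) (hd : d ≠ 0) (hh : h ≠ 0)
    (j : C.PartialIso (Spec (.of (CurveRing h r d)))) :
    ∃ (a : Polynomial k) (U : C.Opens) (_ : IsAffineOpen U) (_ : Dense (U : Set C))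
      (hUj : U ≤ j.source), h ∣ a ∧ Polynomial.X ∣ a ∧
      IsAwayHom ((res hUj).comp (coordHom j)) (Polynomial.aeval (CurveRing.z h r d ^ d) a) := by
  have hr0 : r ≠ 0 := by rintro rfl; simp at hr
  have : _root_.IsReduced (CurveRing h r d) := CurveRing.isReduced hr hh d hd
  obtain ⟨b, hb, hbj⟩ := PrimeSpectrum.exists_basicOpen_le_of_dense
    (⟨j.target.carrier, j.target.2⟩ : TopologicalSpace.Opens (PrimeSpectrum (CurveRing h r d)))
    j.dense_target
  -- The curve ring is integral over `k[z ^ d]`, so the nonzerodivisor `b` divides a nonzero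
  -- polynomial in `z ^ d`. Such a polynomial is invariant under the group, unlike `b`.
  obtain ⟨a₀, ha₀, hba⟩ : ∃ a₀ : Polynomial k, a₀ ≠ 0 ∧
      b ∣ Polynomial.aeval (CurveRing.z h r d ^ d) a₀ := by
    let F := ((Polynomial.aeval (CurveRing.z h r d ^ d) : Polynomial k →ₐ[k] _) :
      Polynomial k →+* CurveRing h r d)
    have hF : F.IsIntegral := CurveRing.isIntegral_aeval_z_pow hr0 d hd
    let _ : Algebra (Polynomial k) (CurveRing h r d) := F.toAlgebra
    have h2 : IsIntegral (Polynomial k) b := hF b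
    exact h2.isAlgebraic.exists_nonzero_dvd hb
  -- The factors `X` and `h` make `z` and `w` invertible on the chart, since `h(z ^ d) = w ^ r`.
  let a := a₀ * Polynomial.X * h
  have ha : a ≠ 0 := mul_ne_zero (mul_ne_zero ha₀ Polynomial.X_ne_zero) hh
  have hba' : b ∣ Polynomial.aeval (CurveRing.z h r d ^ d) a :=
    hba.trans (map_dvd _ ((Dvd.intro _ rfl).trans (Dvd.intro _ rfl)))
  have hle : basicSpec (Polynomial.aeval (CurveRing.z h r d ^ d) a) ≤ j.target := by
    obtain ⟨b', hb'⟩ := hba'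
    rw [hb']
    exact (PrimeSpectrum.basicOpen_mul_le_left b b').trans hbj
  obtain ⟨h1, h2⟩ := isAwayHom_coordHom j _ hle
  refine ⟨a, _, h1, ?_, C.basicOpen_le _, Dvd.intro_left _ rfl,
    (Dvd.intro_left _ rfl).trans (Dvd.intro _ rfl), h2⟩
  have hnz : Polynomial.aeval (CurveRing.z h r d ^ d) a ∈ nonZeroDivisors (CurveRing h r d) := by
    have h3 : Polynomial.aeval (CurveRing.z h r d ^ d) a =
        Polynomial.aeval (CurveRing.z h r d) (Polynomial.expand k d a) := by
      rw [Polynomial.expand_aeval]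
    rw [h3]
    exact CurveRing.aeval_z_mem_nonZeroDivisors hr0 d
      ((Polynomial.expand_ne_zero (Nat.pos_of_ne_zero hd)).mpr ha)
  rw [← toSpec_preimage_basicSpec]
  have : IsOpenImmersion (toSpec j.source (coordHom j)) := by
    rw [toSpec_coordHom]
    infer_instance
  have h4 := dense_preimage (toSpec j.source (coordHom j))
    (U := basicSpec (Polynomial.aeval (CurveRing.z h r d ^ d) a))
    (dense_basicOpen_of_mem_nonZeroDivisors hnz)
  have h5 : DenseRange j.source.ι := by
    rw [DenseRange, Scheme.Opens.range_ι]
    exact j.dense_source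
  exact h5.dense_image j.source.ι.continuous h4

theorem isAffineOpen_preimage_inf {S X Y : Scheme.{u}} [IsAffine S] (f : X ⟶ S) (g : Y ⟶ S)
    {U : X.Opens} {U' : Y.Opens} (hU : IsAffineOpen U) (hU' : IsAffineOpen U') :
    IsAffineOpen (pullback.fst f g ⁻¹ᵁ U ⊓ pullback.snd f g ⁻¹ᵁ U') := by
  have : IsAffine U := hU
  have : IsAffine U' := hU'
  let F := pullback.map (U.ι ≫ f) (U'.ι ≫ g) f g U.ι U'.ι (𝟙 S) (by simp) (by simp)
  have h1 : F.opensRange = pullback.fst f g ⁻¹ᵁ U ⊓ pullback.snd f g ⁻¹ᵁ U' := by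
    ext1
    rw [Scheme.Hom.coe_opensRange, Scheme.Pullback.range_map]
    simp
  rw [← h1]
  exact isAffineOpen_opensRange F

end CurveChart

end UlmerVoloch

end

noncomputable section

namespace UlmerVoloch

/-! ### The anti-diagonal action on the square of the curve -/

section AntiDiagonal

variable {k : Type u} [Field k] {C : Scheme.{u}} (sC : C ⟶ Spec (.of k)) {G : Type*}

section

variable [Group G] (ρ : G →* Aut (geom sC))

theorem antiDiag_fst (g : G) : antiDiag sC ρ g ≫ pullback.fst (geom sC).hom (geom sC).hom =
    pullback.fst (geom sC).hom (geom sC).hom ≫ (ρ g).hom.left := pullback.lift_fst _ _ _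

theorem antiDiag_snd (g : G) : antiDiag sC ρ g ≫ pullback.snd (geom sC).hom (geom sC).hom =
    pullback.snd (geom sC).hom (geom sC).hom ≫ (ρ g⁻¹).hom.left := pullback.lift_snd _ _ _

theorem antiDiag_one : antiDiag sC ρ 1 = 𝟙 _ := by
  have h1 : (ρ 1).hom.left = 𝟙 _ := by rw [map_one]; rfl
  refine pullback.hom_ext ?_ ?_
  · rw [antiDiag_fst, h1, Category.comp_id, Category.id_comp]
  · rw [antiDiag_snd, inv_one, h1, Category.comp_id, Category.id_comp]

end

/-- Commutativity of `G` absorbs both the reversed order of composition in `Aut` and the reversal of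
products by inversion on the second factor. -/
theorem antiDiag_comp [CommGroup G] (ρ : G →* Aut (geom sC)) (g g' : G) :
    antiDiag sC ρ g ≫ antiDiag sC ρ g' = antiDiag sC ρ (g * g') := by
  have h1 : ∀ g g', (ρ g).hom.left ≫ (ρ g').hom.left = (ρ (g * g')).hom.left := fun g g' => by
    rw [mul_comm, map_mul]
    rfl
  refine pullback.hom_ext ?_ ?_
  · rw [Category.assoc, antiDiag_fst, ← Category.assoc, antiDiag_fst, Category.assoc, h1, antiDiag_fst]
  · rw [Category.assoc, antiDiag_snd, ← Category.assoc, antiDiag_snd, Category.assoc, h1, antiDiag_snd,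
      mul_inv]

theorem IsAntiDiagQuotient.isGeometricQuotient [Group G] {ρ : G →* Aut (geom sC)} {Q : Scheme.{u}}
    {sQ : Q ⟶ Spec (.of k)} {π : pullback sC sC ⟶ Q} (hπ : IsAntiDiagQuotient sC ρ sQ π) :
    IsGeometricQuotient (sqStr sC) (pullback.fst (geom sC).hom (geom sC).hom ≫ (geom sC).hom)
      (geomSqProj sC) sQ (pullback.snd sQ (closureStr k)) (pullback.fst sQ (closureStr k)) π
      (geomSqMap sC sQ π hπ.isOver) (antiDiag sC ρ) where
  isPullback_source := isPullback_geomSqProj sC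
  isPullback_target := IsPullback.of_hasPullback _ _
  comm := (pullback.lift_fst _ _ _).symm
  isOver := hπ.isOver
  isOver' := pullback.lift_snd _ _ _
  quotient := hπ.quotient

variable {h : Polynomial k} {r d : ℕ}

theorem geomSqProj_fst : geomSqProj sC ≫ pullback.fst sC sC =
    pullback.fst (geom sC).hom (geom sC).hom ≫ geomFst sC := pullback.lift_fst _ _ _

theorem geomSqProj_snd : geomSqProj sC ≫ pullback.snd sC sC =
    pullback.snd (geom sC).hom (geom sC).hom ≫ geomFst sC := pullback.lift_snd _ _ _

theorem antiDiag_geomSqProj_fst [Group G] (ρ : G →* Aut (geom sC)) (g : G) :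
    (antiDiag sC ρ g ≫ geomSqProj sC) ≫ pullback.fst sC sC =
      pullback.fst (geom sC).hom (geom sC).hom ≫ (ρ g).hom.left ≫ geomFst sC := by
  rw [Category.assoc, geomSqProj_fst, ← Category.assoc, antiDiag_fst, Category.assoc]

theorem antiDiag_geomSqProj_snd [Group G] (ρ : G →* Aut (geom sC)) (g : G) :
    (antiDiag sC ρ g ≫ geomSqProj sC) ≫ pullback.snd sC sC =
      pullback.snd (geom sC).hom (geom sC).hom ≫ (ρ g⁻¹).hom.left ≫ geomFst sC := by
  rw [Category.assoc, geomSqProj_snd, ← Category.assoc, antiDiag_snd, Category.assoc]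

theorem antiDiag_geomSqProj_sqStr [Group G] (ρ : G →* Aut (geom sC)) (g : G) :
    (antiDiag sC ρ g ≫ geomSqProj sC) ≫ sqStr sC = geomSqProj sC ≫ sqStr sC := by
  have h1 : geomFst sC ≫ sC = (geom sC).hom ≫ closureStr k := pullback.condition
  have h2 : (ρ g).hom.left ≫ (geom sC).hom = (geom sC).hom := Over.w _
  rw [sqStr, ← Category.assoc, ← Category.assoc, antiDiag_geomSqProj_fst, geomSqProj_fst, Category.assoc,
    Category.assoc, Category.assoc, h1, ← Category.assoc (ρ g).hom.left, h2]

/-- This pulls back along a projection `q` the fact that a function on the curve is an eigenfunction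
of an automorphism, so it serves for both factors. -/
theorem appLE_appLE_eq_mul {K : Type u} [Field K] {Y Yb D : Scheme.{u}} {sD : D ⟶ Spec (.of K)} {m : D ⟶ C}
    {l : D ⟶ D} {gY : Yb ⟶ Y} {τ : Yb ⟶ Yb} {p : Y ⟶ C} {q : Yb ⟶ D} (h1 : gY ≫ p = q ≫ m)
    (h2 : (τ ≫ gY) ≫ p = q ≫ l ≫ m) {U : C.Opens} {V : Y.Opens} (hV : V ≤ p ⁻¹ᵁ U)
    {e : m ⁻¹ᵁ U ≤ (l ≫ m) ⁻¹ᵁ U} {s : Γ(C, U)} {ξ : K}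
    (hs : ((l ≫ m).appLE U _ e).hom s = pullHom sD _ ξ * (m.app U).hom s)
    (hle : gY ⁻¹ᵁ V ≤ (τ ≫ gY) ⁻¹ᵁ V) :
    ((τ ≫ gY).appLE V (gY ⁻¹ᵁ V) hle).hom ((p.appLE U V hV).hom s) =
      pullHom (q ≫ sD) (gY ⁻¹ᵁ V) ξ * (gY.appLE V (gY ⁻¹ᵁ V) le_rfl).hom ((p.appLE U V hV).hom s) := by
  have h3 : gY ⁻¹ᵁ V ≤ q ⁻¹ᵁ m ⁻¹ᵁ U :=
    (gY.preimage_mono hV).trans (congrArg (fun f => f ⁻¹ᵁ U) h1).le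
  have h4 := congrArg (q.appLE _ _ h3).hom hs
  rw [map_mul, appLE_pullHom, ← Scheme.Hom.appLE_eq_app, appLE_appLE, appLE_appLE] at h4
  rw [appLE_appLE, appLE_appLE, appLE_congr_hom h2, appLE_congr_hom h1]
  exact h4

theorem preimage_le_preimage {Y Yb D : Scheme.{u}} {m : D ⟶ C} {l : D ⟶ D} {gY : Yb ⟶ Y} {τ : Yb ⟶ Yb}
    {p : Y ⟶ C} {q : Yb ⟶ D} (h1 : gY ≫ p = q ≫ m) (h2 : (τ ≫ gY) ≫ p = q ≫ l ≫ m) {U : C.Opens}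
    (e : m ⁻¹ᵁ U ≤ (l ≫ m) ⁻¹ᵁ U) : gY ⁻¹ᵁ p ⁻¹ᵁ U ≤ (τ ≫ gY) ⁻¹ᵁ p ⁻¹ᵁ U :=
  ((congrArg (fun f => f ⁻¹ᵁ U) h1).le.trans (q.preimage_mono e)).trans
    (congrArg (fun f => f ⁻¹ᵁ U) h2).ge

theorem SurfaceRing.ringHom_ext {h : Polynomial k} {r d : ℕ} {D : Type*} [CommRing D]
    {f g : SurfaceRing h r d →+* D} (hk : ∀ c, f (algebraMap k _ c) = g (algebraMap k _ c))
    (hx : f (FamilyRing.x h r _ _) = g (FamilyRing.x h r _ _))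
    (hy : f (FamilyRing.y h r _ _) = g (FamilyRing.y h r _ _))
    (ht : f (SurfaceRing.t h r d) = g (SurfaceRing.t h r d)) : f = g := by
  refine FamilyRing.ringHom_ext (fun c => ?_) hx hy
  have h1 : f.comp (algebraMap (Polynomial k) _) = g.comp (algebraMap (Polynomial k) _) :=
    Polynomial.ringHom_ext (fun c => hk c) ht
  exact congrArg (fun f => f c) h1

/-- The square of an open set. -/
abbrev sqOpen (U : C.Opens) : (pullback sC sC).Opens :=
  pullback.fst sC sC ⁻¹ᵁ U ⊓ pullback.snd sC sC ⁻¹ᵁ U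

/-- The chart is `U × U` with `z = z₁` and `w = w₁`, units because `X ∣ a` and `h ∣ a`. It is stable
because each factor is, by `le_preimage_of_isMuAction` for `g` and `g⁻¹`, and the functions of `x`,
`y`, `t` are invariant. -/
theorem exists_isTwistedChart [Smooth sC] [IsSeparated sC]
    (hr : (r : k) ≠ 0) (hd : (d : k) ≠ 0) [IsDomain (SurfaceRing h r d)]
    {jC : C.PartialIso (Spec (.of (CurveRing h r d)))}
    (hjC : jC.IsOver sC (specStr k (CurveRing h r d))) {ρ : MuGroup k r d →* Aut (geom sC)}
    (hρ : IsMuAction sC jC ρ) {U : C.Opens} (hU : IsAffineOpen U) (hUd : Dense (U : Set C))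
    (hUj : U ≤ jC.source) {a : Polynomial k} (hha : h ∣ a) (hXa : Polynomial.X ∣ a)
    (haway : IsAwayHom ((res hUj).comp (coordHom jC))
      (Polynomial.aeval (CurveRing.z h r d ^ d) a)) :
    ∃ (θ : SurfaceRing h r d →+* Γ(pullback sC sC, sqOpen sC U)) (z w : Γ(pullback sC sC, sqOpen sC U))
      (c : SurfaceRing h r d),
      IsProductHom ((res hUj).comp (coordHom jC))
        ((pullback.fst sC sC).appLE U (sqOpen sC U) inf_le_left).hom
        ((pullback.snd sC sC).appLE U (sqOpen sC U) inf_le_right).hom θ ∧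
      IsTwistedChart (sqStr sC) (pullback.fst (geom sC).hom (geom sC).hom ≫ (geom sC).hom)
        (geomSqProj sC) (antiDiag sC ρ) (sqOpen sC U) θ z w c := by
  have hr0 : r ≠ 0 := by rintro rfl; simp at hr
  have hd0 : d ≠ 0 := by rintro rfl; simp at hd
  obtain ⟨κ, hκ⟩ : ∃ κ, κ = (res hUj).comp (coordHom jC) := ⟨_, rfl⟩
  rw [← hκ] at haway ⊢
  obtain ⟨p₁, hp₁⟩ : ∃ p₁, p₁ = ((pullback.fst sC sC).appLE U (sqOpen sC U) inf_le_left).hom :=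
    ⟨_, rfl⟩
  obtain ⟨p₂, hp₂⟩ : ∃ p₂, p₂ = ((pullback.snd sC sC).appLE U (sqOpen sC U) inf_le_right).hom :=
    ⟨_, rfl⟩
  rw [← hp₁, ← hp₂]
  let _ : Algebra k Γ(C, U) := (pullHom sC U).toAlgebra
  have hκk : ∀ c, κ (algebraMap k _ c) = algebraMap k Γ(C, U) c := fun c => by
    rw [hκ, RingHom.comp_apply, (isOver_iff jC sC).mp hjC, res_pullHom]
    rfl
  have hp₁k : ∀ c, p₁ (algebraMap k Γ(C, U) c) = pullHom (sqStr sC) (sqOpen sC U) c := fun c => by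
    rw [hp₁]
    exact appLE_pullHom _ _ _ c
  have hp₂k : ∀ c, p₂ (algebraMap k Γ(C, U) c) = pullHom (sqStr sC) (sqOpen sC U) c := fun c => by
    rw [hp₂, sqStr, pullback.condition]
    exact appLE_pullHom _ _ _ c
  have hN : IsPushout (CommRingCat.ofHom (algebraMap k Γ(C, U)))
      (CommRingCat.ofHom (algebraMap k Γ(C, U))) (CommRingCat.ofHom p₁) (CommRingCat.ofHom p₂) := by
    rw [hp₁, hp₂]
    exact isPushout_sections (IsPullback.of_hasPullback sC sC) hU hU rfl
  have hunit := ((isAwayHom_iff _ _).mp haway).1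
  have huz : IsUnit (κ (CurveRing.z h r d)) := by
    have h1 := map_dvd κ (map_dvd (Polynomial.aeval (CurveRing.z h r d ^ d)) hXa)
    rw [Polynomial.aeval_X, map_pow] at h1
    exact (isUnit_pow_iff hd0).mp (isUnit_of_dvd_unit h1 hunit)
  have huw : IsUnit (κ (CurveRing.w h r d)) := by
    have h1 := map_dvd κ (map_dvd (Polynomial.aeval (CurveRing.z h r d ^ d)) hha)
    rw [← CurveRing.w_pow, map_pow] at h1
    exact (isUnit_pow_iff hr0).mp (isUnit_of_dvd_unit h1 hunit)
  have hnz : ∀ q : Polynomial k, q ≠ 0 → Polynomial.aeval (κ (CurveRing.z h r d)) q ∈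
      nonZeroDivisors Γ(C, U) := fun q hq => by
    have h1 : Polynomial.aeval (κ (CurveRing.z h r d)) q =
        κ (Polynomial.aeval (CurveRing.z h r d) q) := by
      rw [map_aeval, Polynomial.aeval_def]
      congr 1
      exact RingHom.ext fun c => (hκk c).symm
    rw [h1]
    exact mem_nonZeroDivisors_of_isAwayHom haway (CurveRing.aeval_z_mem_nonZeroDivisors hr0 d hq)
  obtain ⟨θ, hθ⟩ := exists_isProductHom hκk (fun c => (hp₁k c).trans (hp₂k c).symm) (huz.map p₁)
  obtain ⟨c, hc, hsum⟩ := hθ.exists_mul_eq_sum hd0 hr0 hκk hN hha haway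
  refine ⟨θ, p₁ (κ (CurveRing.z h r d)), p₁ (κ (CurveRing.w h r d)), c, hθ, ?_⟩
  have act := fun g => le_preimage_of_isMuAction sC hjC hρ hU hUd hUj (hκ ▸ haway) g
  have hκs : ∀ s, res hUj (coordHom jC s) = κ s := fun s => by rw [hκ]; rfl
  simp only [hκs] at act
  choose e hez hew using act
  have hle : ∀ g, geomSqProj sC ⁻¹ᵁ sqOpen sC U ≤ (antiDiag sC ρ g ≫ geomSqProj sC) ⁻¹ᵁ sqOpen sC U :=
    fun g => inf_le_inf
      (preimage_le_preimage (geomSqProj_fst sC) (antiDiag_geomSqProj_fst sC ρ g) (e g))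
      (preimage_le_preimage (geomSqProj_snd sC) (antiDiag_geomSqProj_snd sC ρ g) (e g⁻¹))
  have hsnd : pullback.snd (geom sC).hom (geom sC).hom ≫ (geom sC).hom =
      pullback.fst (geom sC).hom (geom sC).hom ≫ (geom sC).hom := pullback.condition.symm
  have hz₁ := fun g => appLE_appLE_eq_mul (geomSqProj_fst sC) (antiDiag_geomSqProj_fst sC ρ g)
    (V := sqOpen sC U) inf_le_left (hez g) (hle g)
  have hw₁ := fun g => appLE_appLE_eq_mul (geomSqProj_fst sC) (antiDiag_geomSqProj_fst sC ρ g)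
    (V := sqOpen sC U) inf_le_left (hew g) (hle g)
  have hz₂ := fun g => appLE_appLE_eq_mul (geomSqProj_snd sC) (antiDiag_geomSqProj_snd sC ρ g)
    (V := sqOpen sC U) inf_le_right (hez g⁻¹) (hle g)
  have hw₂ := fun g => appLE_appLE_eq_mul (geomSqProj_snd sC) (antiDiag_geomSqProj_snd sC ρ g)
    (V := sqOpen sC U) inf_le_right (hew g⁻¹) (hle g)
  rw [← hp₁] at hz₁ hw₁
  rw [← hp₂, hsnd] at hz₂ hw₂
  have hθk : ∀ c, θ (algebraMap k _ c) = pullHom (sqStr sC) (sqOpen sC U) c := fun c => by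
    rw [hθ.map_const, hκk, hp₁k]
  have : UniversallyOpen (geomSqProj sC) :=
    MorphismProperty.of_isPullback (P := @UniversallyOpen) (isPullback_geomSqProj sC).flip
      inferInstance
  have hdense : Dense (sqOpen sC U : Set ↥(pullback sC sC)) :=
    dense_inf (dense_preimage (pullback.fst sC sC) hUd) (dense_preimage (pullback.snd sC sC) hUd)
  refine {
    isAffineOpen := isAffineOpen_preimage_inf sC sC hU hU
    dense := dense_preimage (geomSqProj sC) hdense
    dense' := hdense
    le := hle
    map_const := hθk
    invariant := fun g s => ?_
    map_z := hz₁
    map_w := hw₁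
    isUnit_z := huz.map p₁
    isUnit_w := huw.map p₁
    nonZeroDivisors := fun hf => hθ.map_mem_nonZeroDivisors hd0 hr0 hκk hN hnz hf
    isUnit := hc
    exists_eq_sum := hsum }
  let J := pullHom (pullback.fst (geom sC).hom (geom sC).hom ≫ (geom sC).hom)
    (geomSqProj sC ⁻¹ᵁ sqOpen sC U)
  have hξ : J ((g.2 : (AlgebraicClosure k)ˣ) : AlgebraicClosure k) ^ d = 1 := by
    rw [← map_pow, (mem_rootsOfUnity' _ _).mp g.2.2, map_one]
  have hinv : ∀ {m : ℕ} (u : rootsOfUnity m (AlgebraicClosure k)),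
      J ((u : (AlgebraicClosure k)ˣ) : AlgebraicClosure k) *
        J (((u⁻¹ : rootsOfUnity m (AlgebraicClosure k)) : (AlgebraicClosure k)ˣ) :
          AlgebraicClosure k) = 1 := fun u => by
    rw [← map_mul, ← Units.val_mul, ← Subgroup.coe_mul, mul_inv_cancel, Subgroup.coe_one,
      Units.val_one, map_one]
  let A := ((antiDiag sC ρ g ≫ geomSqProj sC).appLE (sqOpen sC U) _ (hle g)).hom
  let B := ((geomSqProj sC).appLE (sqOpen sC U) (geomSqProj sC ⁻¹ᵁ sqOpen sC U) le_rfl).hom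
  -- It suffices to treat the generators: `z₁ ^ d` is fixed because `ξ ^ d = 1`, and in `w₁ w₂` and
  -- `z₁ z₂` the anti-diagonal action makes the two factors cancel.
  have key : A.comp θ = B.comp θ := by
    have e1 := hz₁ g
    have e2 := hw₁ g
    have e3 := hz₂ g
    have e4 := hw₂ g
    refine SurfaceRing.ringHom_ext (fun c => ?_) ?_ ?_ ?_
    · rw [RingHom.comp_apply, RingHom.comp_apply, hθk]
      refine (appLE_pullHom _ _ _ c).trans (Eq.trans ?_ (appLE_pullHom _ _ _ c).symm)
      rw [antiDiag_geomSqProj_sqStr]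
    · change A (θ _) = B (θ _)
      rw [hθ.map_x, map_pow A, map_pow B]
      refine (congrArg (· ^ d) e1).trans ?_
      rw [mul_pow]
      exact (congrArg (· * _) hξ).trans (one_mul _)
    · change A (θ _) = B (θ _)
      rw [hθ.map_y, map_mul A, map_mul B]
      refine (congrArg₂ (· * ·) e2 e4).trans ?_
      rw [mul_mul_mul_comm]
      exact (congrArg (· * _) (hinv g.1)).trans (one_mul _)
    · change A (θ _) = B (θ _)
      rw [hθ.map_t, map_mul A, map_mul B]
      refine (congrArg₂ (· * ·) e1 e3).trans ?_
      rw [mul_mul_mul_comm]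
      exact (congrArg (· * _) (hinv g.2)).trans (one_mul _)
  exact congrArg (fun f => f s) key

end AntiDiagonal

end UlmerVoloch

end

noncomputable section

namespace UlmerVoloch

/-! ### Points on the affine models -/

section Nontrivial

variable {k : Type u} [Field k] {h : Polynomial k} {r d : ℕ}

theorem CurveRing.nontrivial (hr : 0 < r) : Nontrivial (CurveRing h r d) := by
  obtain ⟨w, hw⟩ := IsAlgClosed.exists_pow_nat_eq
    (h.eval₂ (algebraMap k (AlgebraicClosure k)) (0 ^ d)) hr
  exact (CurveRing.lift (h := h) (r := r) (d := d) (algebraMap k (AlgebraicClosure k)) 0 w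
    hw).domain_nontrivial

theorem FamilyRing.nontrivial {A : Type u} [Field A] [Algebra k A] (a : A) (hr : 0 < r) :
    Nontrivial (FamilyRing h r A a) := by
  let i := algebraMap A (AlgebraicClosure A)
  obtain ⟨y, hy⟩ := IsAlgClosed.exists_pow_nat_eq (h.eval₂ (i.comp (algebraMap k A)) 1 *
    h.eval₂ (i.comp (algebraMap k A)) (i a * 1)) hr
  exact (FamilyRing.lift (h := h) (r := r) (a := a) i 1 y 1 (one_mul 1) hy).domain_nontrivial

theorem nonempty_pullback_self {C : Scheme.{u}} (sC : C ⟶ Spec (.of k)) [Nonempty C] :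
    Nonempty ↥(pullback sC sC) := by
  have : Surjective sC := ⟨fun x => ⟨Classical.arbitrary C, Subsingleton.elim _ _⟩⟩
  obtain ⟨y, -⟩ := (pullback.fst sC sC).surjective (Classical.arbitrary C)
  exact ⟨y⟩

end Nontrivial

end UlmerVoloch

end

noncomputable section

namespace UlmerVoloch

/-! ### Birationality of the quotient with the affine surface -/

section

variable {k : Type u} [Field k] {h : Polynomial k} {r d : ℕ}

/-- The quotient of `C × C` by the anti-diagonal action of `μ_r × μ_d` is birational to the surface
`y ^ r = h(x) h(t ^ d / x)`, with `x = z₁ ^ d`, `y = w₁ w₂`, `t = z₁ z₂`. -/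
theorem exists_partialIso_antiDiagQuotient (hr : (r : k) ≠ 0) (hd : (d : k) ≠ 0) (hh : h ≠ 0)
    [IsDomain (SurfaceRing h r d)] {C : Scheme.{u}} (sC : C ⟶ Spec (.of k)) [Smooth sC]
    [IsSeparated sC] {jC : C.PartialIso (Spec (.of (CurveRing h r d)))}
    (hjC : jC.IsOver sC (specStr k (CurveRing h r d))) {ρ : MuGroup k r d →* Aut (geom sC)}
    (hρ : IsMuAction sC jC ρ) {Q : Scheme.{u}} {sQ : Q ⟶ Spec (.of k)} {π : pullback sC sC ⟶ Q}
    (hπ : IsAntiDiagQuotient sC ρ sQ π) :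
    ∃ e : Q.PartialIso (Spec (.of (SurfaceRing h r d))), e.IsOver sQ (specStr k _) ∧
      ∀ (O : Q.Opens) (hO : O ≤ e.source), (O : Set Q).Nonempty →
        ∃ (W : (pullback sC sC).Opens) (_ : Dense (W : Set ↥(pullback sC sC)))
          (hW : W ≤ π ⁻¹ᵁ O) (hW₁ : W ≤ pullback.fst sC sC ⁻¹ᵁ jC.source)
          (hW₂ : W ≤ pullback.snd sC sC ⁻¹ᵁ jC.source),
          IsProductHom (coordHom jC) ((pullback.fst sC sC).appLE jC.source W hW₁).hom
            ((pullback.snd sC sC).appLE jC.source W hW₂).hom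
            ((π.appLE O W hW).hom.comp ((res hO).comp (coordHom e))) := by
  have hr0 : r ≠ 0 := by rintro rfl; simp at hr
  have hd0 : d ≠ 0 := by rintro rfl; simp at hd
  have hr' : (r : AlgebraicClosure k) ≠ 0 := by
    rw [← map_natCast (algebraMap k (AlgebraicClosure k)) r]
    exact (map_ne_zero _).mpr hr
  have hd' : (d : AlgebraicClosure k) ≠ 0 := by
    rw [← map_natCast (algebraMap k (AlgebraicClosure k)) d]
    exact (map_ne_zero _).mpr hd
  have : Nontrivial (CurveRing h r d) := CurveRing.nontrivial (Nat.pos_of_ne_zero hr0)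
  have : Nonempty C := nonempty_of_partialIso jC
  have : Nonempty ↥(pullback sC sC) := nonempty_pullback_self sC
  obtain ⟨a, U, hU, hUd, hUj, hha, hXa, haway⟩ := exists_curveChart hr hd0 hh jC
  obtain ⟨θ, z, w, c, hθ, hV⟩ := exists_isTwistedChart sC hr hd hjC hρ hU hUd hUj hha hXa haway
  have H := hπ.isGeometricQuotient
  have : Smooth (geom sC).hom := inferInstanceAs (Smooth (pullback.snd sC (closureStr k)))
  have : IsReduced (pullback sC sC) := isReduced_of_smooth (sqStr sC)
  have : IsReduced (geomSq sC) :=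
    isReduced_of_smooth (pullback.fst (geom sC).hom (geom sC).hom ≫ (geom sC).hom)
  have : IsLocallyNoetherian (geomSq sC) := LocallyOfFiniteType.isLocallyNoetherian
    (pullback.fst (geom sC).hom (geom sC).hom ≫ (geom sC).hom)
  obtain ⟨e, hle, he, hcoord⟩ := hV.exists_partialIso hr' hd' H (antiDiag_one sC ρ)
    (antiDiag_comp sC ρ)
  -- The formulas are proved over every smaller nonempty `O`, since composing with the map to the
  -- fibred surface will shrink the source. The whole preimage of `O` serves as `W`.
  refine ⟨e, he, fun O hO hne => ?_⟩
  have hOV : π ⁻¹ᵁ O ≤ sqOpen sC U := (π.preimage_mono hO).trans hle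
  have hW₁ : π ⁻¹ᵁ O ≤ pullback.fst sC sC ⁻¹ᵁ jC.source :=
    (hOV.trans inf_le_left).trans ((pullback.fst sC sC).preimage_mono hUj)
  have hW₂ : π ⁻¹ᵁ O ≤ pullback.snd sC sC ⁻¹ᵁ jC.source :=
    (hOV.trans inf_le_right).trans ((pullback.snd sC sC).preimage_mono hUj)
  have h1 : ∀ s, (π.appLE O (π ⁻¹ᵁ O) le_rfl).hom (res hO (coordHom e s)) = res hOV (θ s) := fun s => by
    rw [appLE_res, ← res_res hle (π.preimage_mono hO), ← hcoord, ← Scheme.Hom.appLE_eq_app, res_appLE]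
  have h2 : ∀ s, res hOV (((pullback.fst sC sC).appLE U (sqOpen sC U) inf_le_left).hom
      (res hUj (coordHom jC s))) =
      ((pullback.fst sC sC).appLE jC.source (π ⁻¹ᵁ O) hW₁).hom (coordHom jC s) := fun s => by
    rw [res_appLE, appLE_res]
  have h3 : ∀ s, res hOV (((pullback.snd sC sC).appLE U (sqOpen sC U) inf_le_right).hom
      (res hUj (coordHom jC s))) =
      ((pullback.snd sC sC).appLE jC.source (π ⁻¹ᵁ O) hW₂).hom (coordHom jC s) := fun s => by
    rw [res_appLE, appLE_res]
  refine ⟨π ⁻¹ᵁ O, hV.dense_preimage hr' hd' H (antiDiag_one sC ρ) (antiDiag_comp sC ρ) hne, le_rfl,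
    hW₁, hW₂, ?_, ?_, ?_, fun a => ?_⟩
  · refine (h1 _).trans ?_
    rw [hθ.map_x, map_pow (res hOV)]
    exact congrArg (· ^ d) (h2 _)
  · refine (h1 _).trans ?_
    rw [hθ.map_y, map_mul (res hOV)]
    exact congrArg₂ (· * ·) (h2 _) (h3 _)
  · refine (h1 _).trans ?_
    rw [hθ.map_t, map_mul (res hOV)]
    exact congrArg₂ (· * ·) (h2 _) (h3 _)
  · refine (h1 _).trans ?_
    rw [hθ.map_const]
    exact h2 _

end

end UlmerVoloch

end

/-! ### Assembly of the two birational maps -/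

theorem mainTheorem6 {k : Type u} [Field k] [Finite k] (p : ℕ) [Fact p.Prime] [CharP k p]
    (r d : ℕ) (hr : 1 < r) (hrp : r.Coprime p) (hdp : d.Coprime p)
    (h : Polynomial k) (hdeg : 0 < h.natDegree) (h0 : h.eval 0 ≠ 0)
    (hpow : ∀ e : ℕ, 1 < e → e ∣ r →
      ¬ ∃ g : RatFunc k, g ^ e = algebraMap (Polynomial k) (RatFunc k) h)
    -- the smooth projective curve `C` over `k` associated to `w ^ r = h(z ^ d)`
    {C : Scheme.{u}} (sC : C ⟶ Spec (.of k)) (hC : UlmerVoloch.IsSmoothProjective 1 sC)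
    (jC : C.PartialIso (Spec (.of (UlmerVoloch.CurveRing h r d))))
    (hjC : jC.IsOver sC (UlmerVoloch.specStr k (UlmerVoloch.CurveRing h r d)))
    -- the smooth projective curve `X` over `k(t)` associated to `y ^ r = h(x) h(t ^ d / x)`
    {X : Scheme.{u}} (sX : X ⟶ Spec (.of (RatFunc k))) (hX : UlmerVoloch.IsSmoothProjective 1 sX)
    (jX : X.PartialIso (Spec (.of (UlmerVoloch.GenericRing h r d))))
    (hjX : jX.IsOver sX (UlmerVoloch.specStr (RatFunc k) (UlmerVoloch.GenericRing h r d)))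
    -- a smooth projective surface `S ⟶ ℙ¹` with generic fibre `X`
    {S : Scheme.{u}} [IrreducibleSpace S] (sS : S ⟶ Spec (.of k))
    (hS : UlmerVoloch.IsSmoothProjective 2 sS)
    (f : S ⟶ UlmerVoloch.ProjSpace 1 k) (hf : f ≫ UlmerVoloch.ProjSpace.str 1 k = sS)
    (ι : X ⟶ S) (hι : IsPullback ι sX f (UlmerVoloch.genericPointP1 k))
    -- the action of `μ_r × μ_d` on `C` and the anti-diagonal quotient `Q` of `C × C`
    (ρ : UlmerVoloch.MuGroup k r d →* Aut (UlmerVoloch.geom sC))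
    (hρ : UlmerVoloch.IsMuAction sC jC ρ)
    {Q : Scheme.{u}} (sQ : Q ⟶ Spec (.of k)) (π : pullback sC sC ⟶ Q)
    (hπ : UlmerVoloch.IsAntiDiagQuotient sC ρ sQ π) :
    -- there are a birational map `Φ` from `Q` to `S` over `k`, and coordinates `(x, y, t)` on `S`,
    -- i.e. a birational map `e` over `k` to the affine surface `y ^ r = h(x) h(t ^ d / x)`
    ∃ (Φ : Q.PartialIso S) (e : S.PartialIso (Spec (.of (UlmerVoloch.SurfaceRing h r d)))),
      Φ.IsOver sQ sS ∧ e.IsOver sS (UlmerVoloch.specStr k (UlmerVoloch.SurfaceRing h r d)) ∧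
      -- on the generic fibre `X`, `x` and `y` are the given coordinates and `t` is that of `k(t)`
      (∃ (V : X.Opens) (_ : Dense (V : Set X)) (hVe : V ≤ ι ⁻¹ᵁ e.source) (hVj : V ≤ jX.source),
        (ι.appLE e.source V hVe).hom (UlmerVoloch.coord e (UlmerVoloch.FamilyRing.x h r _ _)) =
          (X.presheaf.map (homOfLE hVj).op).hom
            (UlmerVoloch.coord jX (UlmerVoloch.FamilyRing.x h r _ _)) ∧
        (ι.appLE e.source V hVe).hom (UlmerVoloch.coord e (UlmerVoloch.FamilyRing.y h r _ _)) =
          (X.presheaf.map (homOfLE hVj).op).hom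
            (UlmerVoloch.coord jX (UlmerVoloch.FamilyRing.y h r _ _)) ∧
        (ι.appLE e.source V hVe).hom (UlmerVoloch.coord e (UlmerVoloch.SurfaceRing.t h r d)) =
          UlmerVoloch.pullFun sX RatFunc.X V) ∧
      -- the composite of `Φ` with `C × C ⟶ Q` is `x = z₁ ^ d`, `y = w₁ w₂`, `t = z₁ z₂`
      (∃ (W : (pullback sC sC).Opens) (_ : Dense (W : Set ↥(pullback sC sC)))
        (hW : W ≤ π ⁻¹ᵁ (Φ.trans e).source)
        (hW₁ : W ≤ pullback.fst sC sC ⁻¹ᵁ jC.source)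
        (hW₂ : W ≤ pullback.snd sC sC ⁻¹ᵁ jC.source),
        (π.appLE (Φ.trans e).source W hW).hom
            (UlmerVoloch.coord (Φ.trans e) (UlmerVoloch.FamilyRing.x h r _ _)) =
          (((pullback.fst sC sC).appLE jC.source W hW₁).hom
            (UlmerVoloch.coord jC (UlmerVoloch.CurveRing.z h r d))) ^ d ∧
        (π.appLE (Φ.trans e).source W hW).hom
            (UlmerVoloch.coord (Φ.trans e) (UlmerVoloch.FamilyRing.y h r _ _)) =
          ((pullback.fst sC sC).appLE jC.source W hW₁).hom
              (UlmerVoloch.coord jC (UlmerVoloch.CurveRing.w h r d)) *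
            ((pullback.snd sC sC).appLE jC.source W hW₂).hom
              (UlmerVoloch.coord jC (UlmerVoloch.CurveRing.w h r d)) ∧
        (π.appLE (Φ.trans e).source W hW).hom
            (UlmerVoloch.coord (Φ.trans e) (UlmerVoloch.SurfaceRing.t h r d)) =
          ((pullback.fst sC sC).appLE jC.source W hW₁).hom
              (UlmerVoloch.coord jC (UlmerVoloch.CurveRing.z h r d)) *
            ((pullback.snd sC sC).appLE jC.source W hW₂).hom
              (UlmerVoloch.coord jC (UlmerVoloch.CurveRing.z h r d))) := by
  -- Being prime to the characteristic makes `r` and `d` nonzero in `k`, which gives separability of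
  -- the equations and makes averaging possible.
  have hcast : ∀ n : ℕ, n.Coprime p → (n : k) ≠ 0 := fun n hn h => by
    rw [CharP.cast_eq_zero_iff k p] at h
    exact (Fact.out : p.Prime).one_lt.ne (Nat.Coprime.eq_one_of_dvd hn.symm h).symm
  have hr' := hcast r hrp
  have hd' := hcast d hdp
  have h0' : h.coeff 0 ≠ 0 := by rwa [Polynomial.coeff_zero_eq_eval_zero]
  have hh : h ≠ 0 := by
    rintro rfl
    simp at hdeg
  have := hC.smooth
  have := hX.smooth
  have := hS.smooth
  have : Smooth sC := SmoothOfRelativeDimension.smooth 1 sC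
  have : Smooth sX := SmoothOfRelativeDimension.smooth 1 sX
  have : Smooth sS := SmoothOfRelativeDimension.smooth 2 sS
  have : IsSeparated sC := hC.isSeparated
  have : Nontrivial (UlmerVoloch.GenericRing h r d) :=
    UlmerVoloch.FamilyRing.nontrivial _ (one_pos.trans hr)
  have : Nonempty X := UlmerVoloch.nonempty_of_partialIso jX
  obtain ⟨_, e, he, V, hV, hVe, hVj, hVcoord⟩ :=
    UlmerVoloch.exists_partialIso_surfaceRing hr' h0' sX jX hjX sS f hf ι hι
  obtain ⟨e', he', hquot⟩ :=
    UlmerVoloch.exists_partialIso_antiDiagQuotient hr' hd' hh sC hjC hρ hπ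
  obtain ⟨hle, hcoord⟩ := UlmerVoloch.coordHom_trans_symm_trans e' e
  have hne : Nonempty Q := UlmerVoloch.nonempty_of_partialIso e'
  obtain ⟨W, hW, hWO, hW₁, hW₂, hprod⟩ := hquot _ hle ((e'.trans e.symm).trans e).dense_source.nonempty
  -- Go from `Q` to the affine surface by `e'` and back to `S` by the inverse of `e`. The
  -- coordinates of `e` composed with this map are those of `e'` on a smaller open set, where
  -- `hprod` gives the formulas.
  refine ⟨e'.trans e.symm, e, he'.trans he.symm, he, ⟨V, hV, hVe, hVj, ?_, ?_, ?_⟩,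
    ⟨W, hW, hWO, hW₁, hW₂, ?_, ?_, ?_⟩⟩
  · rw [UlmerVoloch.coord_eq, UlmerVoloch.coord_eq, hVcoord, UlmerVoloch.SurfaceRing.toGeneric_x]
    rfl
  · rw [UlmerVoloch.coord_eq, UlmerVoloch.coord_eq, hVcoord, UlmerVoloch.SurfaceRing.toGeneric_y]
    rfl
  · rw [UlmerVoloch.coord_eq, hVcoord, UlmerVoloch.SurfaceRing.toGeneric_t,
      (UlmerVoloch.isOver_iff jX sX).mp hjX, UlmerVoloch.res_pullHom]
    rfl
  · rw [UlmerVoloch.coord_eq, hcoord]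
    exact hprod.map_x
  · rw [UlmerVoloch.coord_eq, hcoord]
    exact hprod.map_y
  · rw [UlmerVoloch.coord_eq, hcoord]
    exact hprod.map_t
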